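/- Let $q(u,v,x_1,\dots,x_n)=-u^2-v^2+x_1^2+\dots+x_n^2$ on $\mathbb{R}^{n+2}$, with bilinear form $\langle\cdot|\cdot\rangle$. Let $\mathrm{AdS}^{n+1}=\{q=-1\}$, let $\partial\mathrm{AdS}^{n+1}$ be the quotient of $\{q=0\}\setminus\{0\}$ by positive homotheties, and give $\overline{\mathrm{AdS}^{n+1}}=\mathrm{AdS}^{n+1}\cup\partial\mathrm{AdS}^{n+1}$ the compact topology it inherits from the sphere of rays of $\mathbb{R}^{n+2}$. A set $\Lambda\subset\partial\mathrm{AdS}^{n+1}$ is acausal if $\langle\xi|\eta\rangle<0$ for all distinct $\xi,\eta\in\Lambda$; $C(\Lambda)\subset\mathrm{AdS}^{n+1}$ denotes its convex hull (computed in an affine chart, points of $\Lambda$ removed). A subgroup $\Gamma\subset\mathrm{SO}(2,n)$ is quasi-Fuchsian with limit set $\Lambda$ if it is discrete, torsion-free, preserves the acausal set $\Lambda$, which is homeomorphic to the $(n-1)$-sphere, and acts cocompactly on $C(\Lambda)$. For $x,y\in C(\Lambda)$ let $d(x,y)=d_{\mathrm{AdS}}(x,y)$ be the length of the geodesic segment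 from $x$ to $y$ if it is spacelike, and $0$ otherwise. Let $$\delta_{\mathrm{AdS}}(\Gamma)=\limsup_{R\to\infty}\frac1R\log\mathrm{Card}\{\gamma\in\Gamma\mid d(\gamma o,o)\le R\},\qquad \beta_\xi(x,y)=\ln\frac{\langle\xi|x\rangle}{\langle\xi|y\rangle}\quad(\xi\in\Lambda,\ x,y\in C(\Lambda)).$$ A conformal density of dimension $\delta$ is a family $(\nu_x)_{x\in C(\Lambda)}$ of finite Borel measures on $\overline{\mathrm{AdS}^{n+1}}$ such that, for all $g\in\Gamma$ and $x,y\in C(\Lambda)$: $g_*\nu_x=\nu_{gx}$; $\nu_x$ is absolutely continuous with respect to $\nu_y$ with $\frac{d\nu_x}{d\nu_y}(\xi)=e^{-\delta\beta_\xi(x,y)}$; and $\mathrm{supp}\,\nu_x=\Lambda$. Let $\Gamma\subset\mathrm{SO}(2,n)$ be quasi-Fuchsian with limit set $\Lambda$, and let $o\in C(\Lambda)$. Then $\delta:=\delta_{\mathrm{AdS}}(\Gamma)$ is a (finite) real number, which does not depend on the base point in $C(\Lambda)$. Call a nondecreasing function $h:[0,\infty)\to[0,\infty)$ a Patterson function if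 the modified Poincaré series $$Q(s)=\sum_{\gamma\in\Gamma}h(d(\gamma o,o))\,e^{-s\,d(\gamma o,o)}$$ converges for $s>\delta$ and diverges for $s=\delta$, and if for every $\varepsilon>0$ there is $y_0>0$ such that $h(y+x)\le e^{\varepsilon x}h(y)$ for all $y>y_0$ and $x>0$. Patterson functions exist. Let $h$ be any Patterson function and for $s>\delta$ and $x\in C(\Lambda)$ put $$\mu_x^s=\frac1{Q(s)}\sum_{\gamma\in\Gamma}h(d(\gamma o,x))\,e^{-s\,d(\gamma o,x)}\,\Delta_{\gamma o},$$ where $\Delta_z$ is the Dirac mass at $z$. Then, for every sequence $s_k>\delta$ with $s_k\to\delta$: 1. there is a subsequence along which the measures $\mu_x^{s_k}$ are finite and converge weakly to a finite measure, for all $x\in C(\Lambda)$ simultaneously; 2. if $\mu_x^{s_k}$ converges weakly to a finite measure $\mu_x$ for every $x\in C(\Lambda)$, then $(\mu_x)_{x\in C(\Lambda)}$ is a conformal density of dimension $\delta_{\mathrm{AdS}}(\Gamma)$. -/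

import Mathlib

open MeasureTheory Filter Topology
open scoped ENNReal

namespace AdSGeom

noncomputable section

/-! ## The quadratic form of signature `(2, n)`, anti-de Sitter space, its compactification -/

/-- `ℝ^{n+2}`, with coordinates `(u, v)` indexed by `Fin 2` and `(x₁, …, xₙ)` by `Fin n`. -/
abbrev V (n : ℕ) : Type := EuclideanSpace ℝ (Fin 2 ⊕ Fin n)

/-- The bilinear form `⟨x|y⟩` of `q = -du² - dv² + dx₁² + ⋯ + dxₙ²`. -/
def form {n : ℕ} (x y : V n) : ℝ :=
  -(∑ i : Fin 2, x (Sum.inl i) * y (Sum.inl i)) + ∑ j : Fin n, x (Sum.inr j) * y (Sum.inr j)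

lemma form_smul_left {n : ℕ} (c : ℝ) (x y : V n) : form (c • x) y = c * form x y := by
  simp only [form, PiLp.smul_apply, smul_eq_mul, mul_add, mul_neg, Finset.mul_sum, mul_assoc]

lemma form_comm {n : ℕ} (x y : V n) : form x y = form y x := by
  simp only [form, mul_comm]

lemma form_smul_right {n : ℕ} (c : ℝ) (x y : V n) : form x (c • y) = c * form x y := by
  rw [form_comm, form_smul_left, form_comm]

lemma form_add_left {n : ℕ} (x y z : V n) : form (x + y) z = form x z + form y z := by
  simp only [form, PiLp.add_apply, add_mul, Finset.sum_add_distrib]; ring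

lemma form_add_right {n : ℕ} (x y z : V n) : form x (y + z) = form x y + form x z := by
  rw [form_comm, form_add_left, form_comm y, form_comm z]

/-- Anti-de Sitter space `AdS^{n+1} = {q = -1}`. -/
abbrev AdS (n : ℕ) : Type := {x : V n // form x x = -1}

/-- The compactification `AdS^{n+1} ∪ ∂AdS^{n+1}`: the rays (quotient of `ℝ^{n+2} ∖ {0}` by
positive homotheties) on which `q ≤ 0`. The sphere of rays is identified with the unit sphere of
`ℝ^{n+2}`, each ray being represented by its unit vector. -/
abbrev AdSBar (n : ℕ) : Type := {u : V n // ‖u‖ = 1 ∧ form u u ≤ 0}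

/-- The ray of a nonzero vector on which `q ≤ 0`. -/
def ray {n : ℕ} (v : V n) (hv : v ≠ 0) (hq : form v v ≤ 0) : AdSBar n :=
  ⟨‖v‖⁻¹ • v, by
    rw [norm_smul, norm_inv, norm_norm, inv_mul_cancel₀ (norm_ne_zero_iff.2 hv)], by
    rw [form_smul_left, form_smul_right, ← mul_assoc]
    exact mul_nonpos_of_nonneg_of_nonpos (by positivity) hq⟩

lemma AdSBar.ne_zero {n : ℕ} (u : AdSBar n) : (u : V n) ≠ 0 := by
  intro h
  have := u.2.1
  simp [h] at this

lemma AdS.ne_zero {n : ℕ} (x : AdS n) : (x : V n) ≠ 0 := by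
  intro h
  have := x.2
  simp [h, form] at this

/-- The embedding of `AdS^{n+1}` into its compactification. -/
def AdS.toBar {n : ℕ} (x : AdS n) : AdSBar n :=
  ray (x : V n) (AdS.ne_zero x) (by rw [x.2]; norm_num)

/-- The boundary `∂AdS^{n+1}`: the isotropic rays. -/
def boundary (n : ℕ) : Set (AdSBar n) := {ξ | form (ξ : V n) (ξ : V n) = 0}

/-! ## The group `SO(2, n)` and its actions -/

/-- The action of a matrix on column vectors of `ℝ^{n+2}`. -/
def act {n : ℕ} (g : Matrix.SpecialLinearGroup (Fin 2 ⊕ Fin n) ℝ) (x : V n) : V n :=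
  Matrix.toEuclideanLin (g : Matrix (Fin 2 ⊕ Fin n) (Fin 2 ⊕ Fin n) ℝ) x

lemma act_one {n : ℕ} (x : V n) : act 1 x = x := by
  ext i
  simp [act]

lemma act_mul {n : ℕ} (g h : Matrix.SpecialLinearGroup (Fin 2 ⊕ Fin n) ℝ) (x : V n) :
    act (g * h) x = act g (act h x) := by
  ext i
  simp [act, Matrix.toLpLin_apply, Matrix.mulVec_mulVec]

lemma act_smul {n : ℕ} (g : Matrix.SpecialLinearGroup (Fin 2 ⊕ Fin n) ℝ) (c : ℝ) (x : V n) :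
    act g (c • x) = c • act g x := by
  simp [act]

lemma act_ne_zero {n : ℕ} (g : Matrix.SpecialLinearGroup (Fin 2 ⊕ Fin n) ℝ) {x : V n}
    (hx : x ≠ 0) : act g x ≠ 0 := by
  intro h
  apply hx
  have h2 : act (g⁻¹ * g) x = 0 := by rw [act_mul, h]; simp [act]
  rwa [inv_mul_cancel, act_one] at h2

/-- `SO(2, n)`: the matrices of determinant one that preserve the form. -/
def SO2 (n : ℕ) : Subgroup (Matrix.SpecialLinearGroup (Fin 2 ⊕ Fin n) ℝ) where
  carrier := {g | ∀ x y : V n, form (act g x) (act g y) = form x y}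
  mul_mem' := by
    intro a b ha hb x y
    rw [act_mul, act_mul, ha, hb]
  one_mem' := by
    intro x y
    rw [act_one, act_one]
  inv_mem' := by
    intro a ha x y
    have h := ha (act a⁻¹ x) (act a⁻¹ y)
    rw [← act_mul, ← act_mul, mul_inv_cancel, act_one, act_one] at h
    exact h.symm

instance (n : ℕ) : MulAction (SO2 n) (AdS n) where
  smul g x := ⟨act g.1 x, by rw [g.2]; exact x.2⟩
  one_smul x := Subtype.ext (act_one _)
  mul_smul g h x := Subtype.ext (act_mul _ _ _)

lemma coe_smul_AdS {n : ℕ} (g : SO2 n) (x : AdS n) : ((g • x : AdS n) : V n) = act g.1 x := rfl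

lemma ray_congr {n : ℕ} {v w : V n} (hv : v ≠ 0) (hq : form v v ≤ 0) (hw : w ≠ 0)
    (hq' : form w w ≤ 0) {c : ℝ} (hc : 0 < c) (h : w = c • v) : ray w hw hq' = ray v hv hq := by
  apply Subtype.ext
  subst h
  simp only [ray, norm_smul, Real.norm_of_nonneg hc.le, smul_smul]
  congr 1
  field_simp

/-- `SO(2, n)` acts on rays. -/
instance (n : ℕ) : MulAction (SO2 n) (AdSBar n) where
  smul g u := ray (act g.1 u) (act_ne_zero _ (AdSBar.ne_zero u)) (by rw [g.2]; exact u.2.2)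
  one_smul u := by
    apply Subtype.ext
    change ‖act 1 (u : V n)‖⁻¹ • act 1 (u : V n) = u
    rw [act_one, u.2.1, inv_one, one_smul]
  mul_smul g h u := by
    refine ray_congr _ _ _ _ (c := ‖act h.1 (u : V n)‖)
      (norm_pos_iff.2 (act_ne_zero _ (AdSBar.ne_zero u))) ?_
    change act (g.1 * h.1) (u : V n) = _ • act g.1 (‖act h.1 (u : V n)‖⁻¹ • act h.1 (u : V n))
    rw [act_smul, smul_smul, mul_inv_cancel₀
      (norm_ne_zero_iff.2 (act_ne_zero _ (AdSBar.ne_zero u))), one_smul, act_mul]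

/-- The embedding of `AdS^{n+1}` into its compactification is equivariant. -/
lemma toBar_smul {n : ℕ} (g : SO2 n) (x : AdS n) : (g • x).toBar = g • x.toBar := by
  symm
  refine ray_congr _ _ _ _ (c := ‖(x : V n)‖⁻¹)
    (inv_pos.2 (norm_pos_iff.2 (AdS.ne_zero x))) ?_
  change act g.1 (‖(x : V n)‖⁻¹ • (x : V n)) = _
  rw [act_smul, coe_smul_AdS]

/-! ## Acausal sets, convex hulls, quasi-Fuchsian groups -/

/-- `Λ ⊆ ∂AdS` is acausal if `⟨ξ|η⟩ < 0` for distinct `ξ, η ∈ Λ`. -/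
def IsAcausal {n : ℕ} (Λ : Set (AdSBar n)) : Prop :=
  Λ ⊆ boundary n ∧ ∀ ξ ∈ Λ, ∀ η ∈ Λ, ξ ≠ η → form (ξ : V n) (η : V n) < 0

/-- The convex hull `C(Λ) ⊆ AdS` of `Λ` (its points at infinity removed): the points of `AdS`
whose ray lies in the convex cone spanned by the rays of `Λ`. By `mem_hull_iff_chart` this is the
convex hull computed in any affine domain whose closure contains `Λ`. -/
def hull {n : ℕ} (Λ : Set (AdSBar n)) : Set (AdS n) :=
  {y | ∃ t : ℝ, 0 < t ∧ t • (y : V n) ∈ convexHull ℝ ((fun ξ : AdSBar n => (ξ : V n)) '' Λ)}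

/-- The affine chart of the affine domain `{v | ⟨x|v⟩ < 0}` of `x`: radial projection to the
affine hyperplane `⟨x|·⟩ = -1`. -/
def chart {n : ℕ} (x : AdS n) (v : V n) : V n := (-form (x : V n) v)⁻¹ • v

/-- In every affine domain that contains `Λ` in its boundary, `C(Λ)` is the convex hull of `Λ`. -/
lemma mem_hull_iff_chart {n : ℕ} {Λ : Set (AdSBar n)} (x : AdS n)
    (hx : ∀ ξ ∈ Λ, form (x : V n) (ξ : V n) < 0) (y : AdS n) :
    y ∈ hull Λ ↔ form (x : V n) (y : V n) < 0 ∧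
      chart x y ∈ convexHull ℝ ((fun ξ : AdSBar n => chart x (ξ : V n)) '' Λ) := by
  have key : ∀ f : AdSBar n → ℝ, (∀ ξ ∈ Λ, 0 < f ξ) →
      ∀ v ∈ convexHull ℝ ((fun ξ : AdSBar n => f ξ • (ξ : V n)) '' Λ),
      ∀ g : AdSBar n → ℝ, (∀ ξ ∈ Λ, 0 < g ξ) →
      ∃ t : ℝ, 0 < t ∧ t • v ∈ convexHull ℝ ((fun ξ : AdSBar n => g ξ • (ξ : V n)) '' Λ) := by
    intro f hf v hv g hg
    have hconv : Convex ℝ {v : V n | ∃ t : ℝ, 0 < t ∧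
        t • v ∈ convexHull ℝ ((fun ξ : AdSBar n => g ξ • (ξ : V n)) '' Λ)} := by
      rintro v ⟨t, ht, hv⟩ w ⟨r, hr, hw⟩ a b ha hb hab
      have hD : 0 < a / t + b / r := by
        rcases ha.eq_or_lt with h0 | h0
        · have : 0 < b := by linarith
          positivity
        · positivity
      refine ⟨(a / t + b / r)⁻¹, inv_pos.2 hD, ?_⟩
      have h := (convex_convexHull ℝ ((fun ξ : AdSBar n => g ξ • (ξ : V n)) '' Λ)) hv hw
        (a := (a / t + b / r)⁻¹ * (a / t)) (b := (a / t + b / r)⁻¹ * (b / r))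
        (by positivity) (by positivity) (by rw [← mul_add, inv_mul_cancel₀ hD.ne'])
      convert h using 1
      rw [smul_add, smul_smul, smul_smul, smul_smul, smul_smul]
      congr 2 <;> field_simp
    refine convexHull_min ?_ hconv hv
    rintro _ ⟨ξ, hξ, rfl⟩
    refine ⟨g ξ / f ξ, div_pos (hg ξ hξ) (hf ξ hξ), subset_convexHull ℝ _ ⟨ξ, hξ, ?_⟩⟩
    have := (hf ξ hξ).ne'
    simp only [smul_smul]
    congr 1
    field_simp
  have hpos : ∀ ξ ∈ Λ, 0 < (-form (x : V n) (ξ : V n))⁻¹ := fun ξ hξ =>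
    inv_pos.2 (neg_pos.2 (hx ξ hξ))
  constructor
  · rintro ⟨t, ht, hy⟩
    obtain ⟨r, hr, hy'⟩ := key (fun _ => 1) (fun _ _ => one_pos) (t • (y : V n))
      (by simpa using hy) (fun ξ => (-form (x : V n) (ξ : V n))⁻¹) hpos
    have hlin : convexHull ℝ ((fun ξ : AdSBar n => chart x (ξ : V n)) '' Λ) ⊆
        {v | form (x : V n) v = -1} := by
      refine convexHull_min ?_ ?_
      · rintro _ ⟨ξ, hξ, rfl⟩
        have := (hx ξ hξ).ne
        simp only [chart, Set.mem_ofPred_eq, form_smul_right]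
        field_simp
      · intro v hv w hw a b _ _ hab
        simp only [Set.mem_ofPred_eq] at hv hw ⊢
        rw [form_add_right, form_smul_right, form_smul_right, hv, hw]
        linarith
    have h1 : form (x : V n) (r • t • (y : V n)) = -1 := hlin hy'
    rw [form_smul_right, form_smul_right, ← mul_assoc] at h1
    have hrt : 0 < r * t := mul_pos hr ht
    have hneg : form (x : V n) (y : V n) < 0 := by
      by_contra hc
      have := mul_nonneg hrt.le (not_lt.1 hc)
      linarith
    refine ⟨hneg, ?_⟩
    have h2 : (-form (x : V n) (y : V n))⁻¹ = r * t := by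
      rw [inv_eq_iff_eq_inv]
      exact eq_inv_of_mul_eq_one_left (by linarith)
    rw [smul_smul] at hy'
    rw [chart, h2]
    exact hy'
  · rintro ⟨hneg, hy⟩
    obtain ⟨r, hr, hy'⟩ := key (fun ξ => (-form (x : V n) (ξ : V n))⁻¹) hpos _ hy
      (fun _ => 1) (fun _ _ => one_pos)
    refine ⟨r * (-form (x : V n) (y : V n))⁻¹, mul_pos hr (inv_pos.2 (neg_pos.2 hneg)), ?_⟩
    rw [chart, smul_smul] at hy'
    simpa using hy'

/-- `Γ ⊆ SO(2, n)` is quasi-Fuchsian with limit set `Λ`: it is discrete and torsion-free, it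
preserves the acausal set `Λ`, which is homeomorphic to the `(n-1)`-sphere, and it acts
cocompactly on `C(Λ)`. -/
structure IsQuasiFuchsian {n : ℕ} (Γ : Subgroup (SO2 n)) (Λ : Set (AdSBar n)) : Prop where
  discrete : DiscreteTopology Γ
  torsionFree : ∀ g ∈ Γ, IsOfFinOrder g → g = 1
  acausal : IsAcausal Λ
  sphere : Nonempty (Λ ≃ₜ Metric.sphere (0 : EuclideanSpace ℝ (Fin n)) 1)
  invariant : ∀ g ∈ Γ, ∀ ξ ∈ Λ, g • ξ ∈ Λ
  cocompact : ∃ K : Set (AdS n), IsCompact K ∧ K ⊆ hull Λ ∧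
    ∀ x ∈ hull Λ, ∃ g ∈ Γ, ∃ y ∈ K, g • y = x

/-! ## Lorentzian distance, critical exponent, Busemann functions -/

/-- `T` is the length of a spacelike geodesic segment from `x` to `y`: the segment of parameters
`0 ≤ t ≤ T` of the unit speed spacelike geodesic `t ↦ cosh t • x + sinh t • v`, where `v` is a
unit spacelike tangent vector at `x`. (For `T = 0` the segment is reduced to the point `x = y`.) -/
def IsSpacelikeLength {n : ℕ} (x y : AdS n) (T : ℝ) : Prop :=
  0 ≤ T ∧ ∃ v : V n, form v v = 1 ∧ form (x : V n) v = 0 ∧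
    (y : V n) = Real.cosh T • (x : V n) + Real.sinh T • v

open scoped Classical in
/-- The Lorentzian distance: the length of the geodesic segment from `x` to `y` if it is
spacelike, and `0` otherwise. -/
def lorentzDist {n : ℕ} (x y : AdS n) : ℝ :=
  if h : ∃ T : ℝ, IsSpacelikeLength x y T then h.choose else 0

/-- The length of a spacelike segment from `x` to `y` is unique. -/
lemma IsSpacelikeLength.eq_arcosh {n : ℕ} {x y : AdS n} {T : ℝ} (h : IsSpacelikeLength x y T) :
    T = Real.arcosh (-form (x : V n) (y : V n)) := by
  obtain ⟨h0, v, _, hxv, hy⟩ := h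
  rw [hy, form_add_right, form_smul_right, form_smul_right, hxv, x.2]
  simp [Real.arcosh_cosh h0]

/-- `d(x, y) = arcosh |⟨x|y⟩|` if `⟨x|y⟩ < -1`, and `d(x, y) = 0` otherwise. -/
lemma lorentzDist_eq {n : ℕ} (x y : AdS n) :
    lorentzDist x y = if form (x : V n) (y : V n) < -1 then
      Real.arcosh (-form (x : V n) (y : V n)) else 0 := by
  unfold lorentzDist
  split_ifs with h hlt hlt
  · exact h.choose_spec.eq_arcosh
  · rw [h.choose_spec.eq_arcosh]
    obtain ⟨T, h0, v, _, hxv, hy⟩ := h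
    have hf : form (x : V n) (y : V n) = -Real.cosh T := by
      rw [hy, form_add_right, form_smul_right, form_smul_right, hxv, x.2]; ring
    have hc := Real.one_le_cosh T
    have : -form (x : V n) (y : V n) = 1 := by linarith
    rw [this]
    exact Real.arcosh_zero
  · exfalso
    apply h
    set c := -form (x : V n) (y : V n) with hcdef
    have hc : 1 < c := by linarith
    have hs : 0 < Real.sinh (Real.arcosh c) := Real.sinh_pos_iff.2 (Real.arcosh_pos hc)
    have hcosh : Real.cosh (Real.arcosh c) = c := Real.cosh_arcosh hc.le
    have hsq : Real.sinh (Real.arcosh c) ^ 2 = c ^ 2 - 1 := by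
      rw [Real.sinh_sq, hcosh]
    have hxy : form (x : V n) (y : V n) = -c := by linarith
    have hyx : form (y : V n) (x : V n) = -c := by rw [form_comm, hxy]
    refine ⟨Real.arcosh c, Real.arcosh_nonneg hc.le,
      (Real.sinh (Real.arcosh c))⁻¹ • ((y : V n) + (-c) • (x : V n)), ?_, ?_, ?_⟩
    · simp only [form_smul_left, form_smul_right, form_add_left, form_add_right, x.2, y.2, hxy, hyx]
      field_simp
      linarith
    · simp only [form_smul_right, form_add_right, x.2, hxy]
      ring
    · rw [hcosh, smul_smul, mul_inv_cancel₀ hs.ne', one_smul, neg_smul]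
      module
  · rfl

/-- `δ_AdS(Γ) = limsup_{R → ∞} (1/R) log Card {γ ∈ Γ | d(γ o, o) ≤ R}`, as an extended real. -/
def criticalExponent {n : ℕ} (Γ : Subgroup (SO2 n)) (o : AdS n) : EReal :=
  limsup (fun R : ℝ =>
    ENNReal.log (({γ : Γ | lorentzDist (γ • o) o ≤ R}.encard : ℕ∞) : ℝ≥0∞) / (R : EReal)) atTop

/-- The Busemann function `β_ξ(x, y) = log (⟨ξ|x⟩ / ⟨ξ|y⟩)`. -/
def busemann {n : ℕ} (ξ : AdSBar n) (x y : AdS n) : ℝ :=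
  Real.log (form (ξ : V n) (x : V n) / form (ξ : V n) (y : V n))

/-! ## Conformal densities -/

/-- A conformal density of dimension `s`: a family `(ν_x)`, indexed by `x ∈ C(Λ)`, of finite
measures with `g_* ν_x = ν_{g x}`, `dν_x / dν_y (ξ) = exp (-s β_ξ(x, y))` and `supp ν_x = Λ`.
Values of `ν` outside `C(Λ)` play no role. -/
structure IsConformalDensity {n : ℕ} (Γ : Subgroup (SO2 n)) (Λ : Set (AdSBar n)) (s : ℝ)
    (ν : AdS n → FiniteMeasure (AdSBar n)) : Prop where
  equivariant : ∀ g ∈ Γ, ∀ x ∈ hull Λ,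
    (ν x : Measure (AdSBar n)).map (fun ξ => g • ξ) = (ν (g • x) : Measure (AdSBar n))
  conformal : ∀ x ∈ hull Λ, ∀ y ∈ hull Λ,
    (ν x : Measure (AdSBar n)) =
      (ν y : Measure (AdSBar n)).withDensity
        (fun ξ => ENNReal.ofReal (Real.exp (-s * busemann ξ x y)))
  support_eq : ∀ x ∈ hull Λ, (ν x : Measure (AdSBar n)).support = Λ

/-! ## Patterson's construction -/

/-- The modified Poincaré series `Q(s) = ∑_γ h(d(γ o, o)) exp (-s d(γ o, o))`, in `[0, ∞]`. -/
def poincareSeries {n : ℕ} (Γ : Subgroup (SO2 n)) (o : AdS n) (h : ℝ → ℝ) (s : ℝ) : ℝ≥0∞ :=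
  ∑' γ : Γ, ENNReal.ofReal
    (h (lorentzDist (γ • o) o) * Real.exp (-s * lorentzDist (γ • o) o))

/-- `h : [0, ∞) → [0, ∞)` is a Patterson function: it is increasing, the modified Poincaré series
converges for `s > δ` and diverges at `δ` (hence, its terms being nonincreasing in `s`, for all
`s ≤ δ`), and for every `ε > 0`, `h(y + x) ≤ e^{ε x} h(y)` for all large `y` and all `x > 0`.
Values of `h` at negative reals play no role. -/
structure IsPattersonFunction {n : ℕ} (Γ : Subgroup (SO2 n)) (o : AdS n) (δ : ℝ) (h : ℝ → ℝ) :
    Prop where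
  nonneg : ∀ t, 0 ≤ t → 0 ≤ h t
  mono : MonotoneOn h (Set.Ici 0)
  convergent : ∀ s, δ < s → poincareSeries Γ o h s ≠ ⊤
  divergent : poincareSeries Γ o h δ = ⊤
  slow : ∀ ε > 0, ∃ y₀ > 0, ∀ y > y₀, ∀ x > 0, h (y + x) ≤ Real.exp (ε * x) * h y

/-- `μ_x^s = Q(s)⁻¹ ∑_γ h(d(γ o, x)) exp (-s d(γ o, x)) Δ_{γ o}`, a measure on the
compactification of `AdS`. -/
def pattersonMeasure {n : ℕ} (Γ : Subgroup (SO2 n)) (o : AdS n) (h : ℝ → ℝ) (s : ℝ) (x : AdS n) :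
    Measure (AdSBar n) :=
  (poincareSeries Γ o h s)⁻¹ • Measure.sum (fun γ : Γ =>
    ENNReal.ofReal (h (lorentzDist (γ • o) x) * Real.exp (-s * lorentzDist (γ • o) x)) •
      Measure.dirac (γ • o).toBar)

/-- The measures `m k` are finite and converge weakly to the finite measure `ν`. -/
def ConvergesWeakly {n : ℕ} (m : ℕ → Measure (AdSBar n)) (ν : FiniteMeasure (AdSBar n)) : Prop :=
  ∃ μ : ℕ → FiniteMeasure (AdSBar n),
    (∀ k, (μ k : Measure (AdSBar n)) = m k) ∧ Tendsto μ atTop (𝓝 ν)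

end

end AdSGeom

open AdSGeom

/-!
All estimates are about `pair v w = -⟨v|w⟩`, which is nonnegative on the convex cone over `Λ`. On
`C(Λ)` it is, up to bounded factors, the exponential of the distance (`lorentzDist_eq_arcosh_max`).

*The group acts properly.* The form is negative definite on the orthogonal of `Λ`
(`form_self_neg_of_orthogonal`): otherwise a projection would embed the `(n-1)`-sphere `Λ` in an
`(n-2)`-sphere, which a weak form of invariance of domain excludes
(`not_injective_closedBall_sphere`, deduced from the analytic proof of Brouwer's theorem). With
discreteness this gives `IsQuasiFuchsian.finite_setOf_pair_le`.

*The critical exponent.* By cocompactness, `pair v w ≤ C * (pair v z * pair z w)` for `z` in `C(Λ)`,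
and the orbit of `o` is coarsely dense (`IsQuasiFuchsian.exists_isCoarseConst`). Since `C(Λ)`
contains its spacelike segments, the number `N(T)` of orbit points with `pair (γ o) o ≤ T` is
submultiplicative up to constants, and Fekete's lemma gives an exponent `δ` with
`c T ^ δ ≤ N(T) ≤ C_ε T ^ (δ + ε)`. The lower bound, without `ε`, makes the Poincaré series diverge
at `δ`, so that the constant `1` is a Patterson function.

*The limits.* As `γ` leaves finite sets, `d(γ o, x) - d(γ o, o)` is asymptotic to
`log (⟨γ o|x⟩ / ⟨γ o|o⟩)`, and a Patterson function varies slowly. The series `Q(s)` tends to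
infinity as `s` tends to `δ`, so that finitely many terms do not matter, and weak convergence for the
base point `o` implies weak convergence for all `x`, the limits having the expected densities
(`IsQuasiFuchsian.convergesWeakly_withDensity`). For the base point `o` the measures are
probability measures on a compact metrizable space, whence the convergent subsequences. The limits
live on `Λ` because the orbits accumulate only there.

*The support.* Its closedness and invariance force it to be `Λ` or a point `η` fixed by `Γ`
(`IsQuasiFuchsian.subsingleton_of_invariant`). In the second case, the elements of `Γ` that do
not stretch `η` keep `o` outside a neighbourhood `U` of `η`
(`IsQuasiFuchsian.exists_pair_le_of_fixed`). Since `γ` and `γ⁻¹` have the same weight, at most half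
of the mass comes from elements that stretch `η`, so that `U` has mass at most `1 / 2`
(`IsQuasiFuchsian.exists_apply_le_of_fixed`), although `η` should carry all of it.
-/

namespace AdSGeom

open scoped NNReal

/-! ### A ball does not embed into its boundary sphere -/

section BallInSphere

open Metric

/-- The value at `1` of the polynomials of bounded degree is a fixed combination of their values at
points close to `0`. -/
lemma exists_eval_one_eq_sum (d : ℕ) {r : ℝ} (hr : 0 < r) :
    ∃ (s : Finset ℝ) (c : ℝ → ℝ), (∀ t ∈ s, 0 < t ∧ t < r) ∧
      ∀ p : Polynomial ℝ, p.natDegree ≤ d → p.eval 1 = ∑ t ∈ s, c t * p.eval t := by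
  obtain ⟨s, hs, hcard⟩ := (Set.Ioo_infinite hr).exists_subset_card_eq (d + 1)
  refine ⟨s, fun t => (Lagrange.basis s id t).eval 1, fun t ht => hs ht, fun p hp => ?_⟩
  have hdeg : p.degree < s.card := by
    rw [hcard]
    exact (Polynomial.degree_le_of_natDegree_le hp).trans_lt (by exact_mod_cast Nat.lt_succ_self d)
  have h := Lagrange.eq_interpolate_of_eval_eq (s := s) (v := id) (fun t => p.eval t)
    Function.injective_id.injOn hdeg (fun i _ => rfl)
  conv_lhs => rw [h, Lagrange.interpolate_apply, Polynomial.eval_finsetSum]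
  exact Finset.sum_congr rfl fun t _ => by rw [Polynomial.eval_mul, Polynomial.eval_C, mul_comm]

lemma exists_polynomial_eval_eq_det_one_add_smul {m : Type*} [Fintype m] [DecidableEq m]
    (M : Matrix m m ℝ) :
    ∃ p : Polynomial ℝ, p.natDegree ≤ Fintype.card m ∧ ∀ t : ℝ, p.eval t = (1 + t • M).det := by
  refine ⟨(Polynomial.X • M.map Polynomial.C + (1 : Matrix m m ℝ).map Polynomial.C).det,
    Polynomial.natDegree_det_X_add_C_le M 1, fun t => ?_⟩
  rw [← Polynomial.coe_evalRingHom, RingHom.map_det]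
  congr 1
  ext i j
  by_cases hij : i = j <;> simp [hij, RingHom.mapMatrix_apply] <;> ring

lemma exists_polynomial_eval_eq_det_id_add_smul {E : Type*} [NormedAddCommGroup E]
    [NormedSpace ℝ E] [FiniteDimensional ℝ E] (A : E →L[ℝ] E) :
    ∃ p : Polynomial ℝ, p.natDegree ≤ Module.finrank ℝ E ∧
      ∀ t : ℝ, p.eval t = (ContinuousLinearMap.id ℝ E + t • A).det := by
  have b := Module.finBasis ℝ E
  obtain ⟨p, hp, hpe⟩ := exists_polynomial_eval_eq_det_one_add_smul
    (LinearMap.toMatrix b b (A : E →ₗ[ℝ] E))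
  refine ⟨p, hp.trans_eq (Fintype.card_fin _), fun t => ?_⟩
  rw [hpe, ContinuousLinearMap.det, ← LinearMap.det_toMatrix b, ContinuousLinearMap.toLinearMap_add,
    ContinuousLinearMap.toLinearMap_smul, map_add, map_smul, ContinuousLinearMap.coe_id,
    LinearMap.toMatrix_id]

variable {E : Type*} [NormedAddCommGroup E]

lemma bijective_id_add_of_lipschitzWith [CompleteSpace E] {K : NNReal} (hK : K < 1) {h : E → E}
    (hh : LipschitzWith K h) : Function.Bijective (fun x => x + h x) := by
  constructor
  · intro x y hxy
    have h1 : dist x y ≤ K * dist x y := by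
      have h2 : x - y = h y - h x := by
        have : x + h x = y + h y := hxy
        rw [sub_eq_sub_iff_add_eq_add, this, add_comm]
      calc dist x y = dist (h y) (h x) := by rw [dist_eq_norm, h2, ← dist_eq_norm]
        _ ≤ K * dist x y := by rw [dist_comm]; exact hh.dist_le_mul x y
    have hK' : (K : ℝ) < 1 := hK
    have : dist x y ≤ 0 := by nlinarith [dist_nonneg (x := x) (y := y)]
    exact dist_le_zero.1 this
  · intro y
    have hc : ContractingWith K (fun x => y - h x) :=
      ⟨hK, LipschitzWith.of_dist_le_mul fun a b => by
        rw [dist_sub_left]; exact hh.dist_le_mul a b⟩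
    refine ⟨ContractingWith.fixedPoint _ hc, ?_⟩
    have : y - h (ContractingWith.fixedPoint _ hc) = ContractingWith.fixedPoint _ hc :=
      hc.fixedPoint_isFixedPt
    change _ + h _ = y
    nth_rw 1 [← this]
    simp

variable [InnerProductSpace ℝ E]

/-- A function that is Lipschitz on the closed unit ball and zero on the unit sphere stays
Lipschitz when it is extended by zero. -/
lemma lipschitzWith_indicator_closedBall {L : NNReal} {g : E → E}
    (hg : LipschitzOnWith L g (closedBall 0 1)) (h0 : ∀ x, ‖x‖ = 1 → g x = 0) :
    LipschitzWith L ((closedBall (0 : E) 1).indicator g) := by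
  have key : ∀ x ∈ closedBall (0 : E) 1, ∀ y ∉ closedBall (0 : E) 1, ‖g x‖ ≤ L * dist x y := by
    intro x hx y hy
    have hx' : ‖x‖ ≤ 1 := by simpa using hx
    have hy' : 1 < ‖y‖ := by simpa using hy
    have hcont : ContinuousOn (fun t : ℝ => ‖AffineMap.lineMap x y t‖) (Set.Icc 0 1) :=
      (AffineMap.lineMap_continuous.norm).continuousOn
    obtain ⟨t, ht, hz⟩ := intermediate_value_Icc zero_le_one hcont
      (show (1 : ℝ) ∈ _ by simpa using ⟨hx', hy'.le⟩)
    have hz' : ‖(AffineMap.lineMap x y t : E)‖ = 1 := hz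
    calc ‖g x‖ = dist (g x) (g (AffineMap.lineMap x y t)) := by rw [h0 _ hz', dist_zero_right]
      _ ≤ L * dist x (AffineMap.lineMap x y t) := hg.dist_le_mul x hx _ (by simp [hz'])
      _ ≤ L * dist x y := by
        rw [dist_left_lineMap, Real.norm_of_nonneg ht.1]
        gcongr
        exact mul_le_of_le_one_left dist_nonneg ht.2
  refine LipschitzWith.of_dist_le_mul fun x y => ?_
  by_cases hx : x ∈ closedBall (0 : E) 1 <;> by_cases hy : y ∈ closedBall (0 : E) 1
  · rw [Set.indicator_of_mem hx, Set.indicator_of_mem hy]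
    exact hg.dist_le_mul x hx y hy
  · rw [Set.indicator_of_mem hx, Set.indicator_of_notMem hy, dist_zero_right]
    exact key x hx y hy
  · rw [Set.indicator_of_notMem hx, Set.indicator_of_mem hy, dist_zero_left, dist_comm]
    exact key y hy x hx
  · rw [Set.indicator_of_notMem hx, Set.indicator_of_notMem hy, dist_self]
    positivity

/-- A differentiable map with values in the unit sphere has singular derivative. -/
lemma det_fderiv_eq_zero_of_norm_eq_one [FiniteDimensional ℝ E] {F : E → E} {x : E}
    (hF : DifferentiableAt ℝ F x) (h1 : ∀ y, ‖F y‖ = 1) : (fderiv ℝ F x).det = 0 := by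
  by_contra hdet
  have hsurj : Function.Surjective (fderiv ℝ F x) := by
    have hu : IsUnit (LinearMap.det (fderiv ℝ F x : E →ₗ[ℝ] E)) := Ne.isUnit hdet
    have := (LinearMap.isUnit_iff_isUnit_det _).2 hu
    exact ((Module.End.isUnit_iff _).1 this).2
  obtain ⟨v, hv⟩ := hsurj (F x)
  have hd : HasFDerivAt (fun y => inner ℝ (F y) (F y)) _ x := hF.hasFDerivAt.inner ℝ hF.hasFDerivAt
  have hconst : (fun y => inner ℝ (F y) (F y)) = fun _ => (1 : ℝ) := by
    ext y; rw [real_inner_self_eq_norm_sq, h1, one_pow]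
  rw [hconst] at hd
  have := congrArg (fun T : E →L[ℝ] ℝ => T v) (hd.unique (hasFDerivAt_const (1 : ℝ) x))
  simp [hv, h1] at this

variable [FiniteDimensional ℝ E]

/-- There is no `C¹` retraction of the closed unit ball onto the unit sphere. With `g = F - id`, the
maps `id + t g` are, for small `t`, bijections of the ball, so `∫ det (1 + t g')` is the volume of
the ball for those `t`; being polynomial in `t`, it is so at `t = 1`, where the integrand is zero. -/
lemma not_exists_contDiff_retraction_sphere {F : E → E} (hF : ContDiff ℝ 1 F)
    (h1 : ∀ x, ‖F x‖ = 1) (hS : ∀ x, ‖x‖ = 1 → F x = x) : False := by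
  borelize E
  set B := closedBall (0 : E) 1
  let g : E → E := fun x => F x - x
  have hg : ContDiff ℝ 1 g := hF.sub contDiff_id
  have hgd : ∀ x, DifferentiableAt ℝ g x := fun x => (hg.differentiable one_ne_zero) x
  have hg' : Continuous (fderiv ℝ g) := hg.continuous_fderiv one_ne_zero
  have hB : IsCompact B := isCompact_closedBall 0 1
  obtain ⟨C, hC⟩ := hB.exists_bound_of_continuousOn hg'.continuousOn
  set L : NNReal := Real.toNNReal (max C 1) with hL
  have hLC : (L : ℝ) = max C 1 := Real.coe_toNNReal _ (by positivity)
  have hL0 : (0 : ℝ) < L := by rw [hLC]; positivity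
  have hlip : LipschitzOnWith L g B := LipschitzOnWith.of_dist_le_mul fun x hx y hy => by
    rw [dist_eq_norm, dist_eq_norm]
    exact Convex.norm_image_sub_le_of_norm_fderiv_le (fun z _ => hgd z)
      (fun z hz => (hC z hz).trans (by rw [hLC]; exact le_max_left _ _))
      (convex_closedBall 0 1) hy hx
  have hlip' := lipschitzWith_indicator_closedBall hlip (fun x hx => by simp [g, hS x hx])
  have hpos : ∀ᶠ A : E →L[ℝ] E in 𝓝 (ContinuousLinearMap.id ℝ E), 0 < A.det := by
    refine ContinuousLinearMap.continuous_det.continuousAt.eventually (lt_mem_nhds ?_)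
    simp [ContinuousLinearMap.det]
  obtain ⟨r, hr, hball⟩ := Metric.eventually_nhds_iff.1 hpos
  obtain ⟨s, c, hs, hc⟩ := exists_eval_one_eq_sum (Module.finrank ℝ E)
    (show (0 : ℝ) < min (r / L) (1 / L) by positivity)
  let J : ℝ → E → ℝ := fun t x => (ContinuousLinearMap.id ℝ E + t • fderiv ℝ g x).det
  have hJc : ∀ t, Continuous (J t) := fun t =>
    ContinuousLinearMap.continuous_det.comp (continuous_const.add (hg'.const_smul t))
  -- for `t ∈ s`, the map `x ↦ x + t g x`, extended by the identity, is a bijection that preserves `B`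
  have hvol : ∀ t ∈ s, ∫ x in B, J t x = (volume B).toReal := by
    intro t ht
    obtain ⟨ht0, htr⟩ := hs t ht
    have htr1 : t * L < r := by
      have := htr.trans_le (min_le_left _ _); rwa [lt_div_iff₀ hL0] at this
    have htr2 : t * L < 1 := by
      have := htr.trans_le (min_le_right _ _); rwa [lt_div_iff₀ hL0] at this
    let T : NNReal := ⟨t, ht0.le⟩
    have hlipt : LipschitzWith (T * L) (fun x => t • B.indicator g x) := by
      refine LipschitzWith.of_dist_le_mul fun x y => ?_
      rw [dist_smul₀, Real.norm_of_nonneg ht0.le, NNReal.coe_mul, mul_assoc]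
      exact mul_le_mul_of_nonneg_left (hlip'.dist_le_mul x y) ht0.le
    have hbij := bijective_id_add_of_lipschitzWith (K := T * L) htr2 hlipt
    set f : E → E := fun x => x + t • B.indicator g x with hf
    have hfB : f '' B = B := by
      have hout : ∀ x ∈ Bᶜ, f x = x := fun x hx => by
        simp [hf, Set.indicator_of_notMem (show x ∉ B from hx)]
      have : f '' Bᶜ = Bᶜ := by
        rw [Set.image_congr hout, Set.image_id']
      rw [← compl_inj_iff, ← Set.image_compl_eq hbij, this]
    have hder : ∀ x ∈ B, HasFDerivWithinAt f (ContinuousLinearMap.id ℝ E + t • fderiv ℝ g x) B x := by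
      intro x hx
      have h2 : HasFDerivWithinAt (fun x => x + t • g x)
          (ContinuousLinearMap.id ℝ E + t • fderiv ℝ g x) B x :=
        ((hasFDerivAt_id x).add ((hgd x).hasFDerivAt.const_smul t)).hasFDerivWithinAt
      refine h2.congr (fun y hy => ?_) ?_
      · simp [hf, Set.indicator_of_mem hy]
      · simp [hf, Set.indicator_of_mem hx]
    have hcv := integral_image_eq_integral_abs_det_fderiv_smul volume hB.measurableSet hder
      hbij.1.injOn (fun _ => (1 : ℝ))
    rw [hfB] at hcv
    have habs : ∫ x in B, J t x =
        ∫ x in B, |(ContinuousLinearMap.id ℝ E + t • fderiv ℝ g x).det| • (1 : ℝ) := by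
      refine setIntegral_congr_fun hB.measurableSet fun x hx => ?_
      have : 0 < J t x := by
        apply hball
        rw [dist_eq_norm, add_sub_cancel_left, norm_smul, Real.norm_of_nonneg ht0.le]
        refine lt_of_le_of_lt ?_ htr1
        gcongr
        exact (hC x hx).trans (by rw [hLC]; exact le_max_left _ _)
      simp only [smul_eq_mul, mul_one]
      exact (abs_of_pos this).symm
    rw [habs, ← hcv]
    simp [Measure.real]
  -- `J t x` is polynomial in `t`, so that its integral at `t = 1` follows from those at `t ∈ s`
  have hsum : ∀ x, J 1 x = ∑ t ∈ s, c t * J t x := by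
    intro x
    obtain ⟨p, hp, hpe⟩ := exists_polynomial_eval_eq_det_id_add_smul (fderiv ℝ g x)
    have := hc p hp
    simpa only [hpe] using this
  have hone : ∑ t ∈ s, c t = 1 := by
    have := hc 1 (by simp)
    simpa using this.symm
  have hJ1 : ∫ x in B, J 1 x = (volume B).toReal := by
    simp_rw [hsum]
    rw [integral_finsetSum]
    · rw [Finset.sum_congr rfl (fun t ht => by rw [integral_const_mul, hvol t ht]),
        ← Finset.sum_mul, hone, one_mul]
    · intro t _
      exact ((continuous_const.mul (hJc t)).continuousOn.integrableOn_compact hB)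
  have hJ0 : ∀ x, J 1 x = 0 := by
    intro x
    have hFd : DifferentiableAt ℝ F x := (hF.differentiable one_ne_zero) x
    have : fderiv ℝ g x = fderiv ℝ F x - ContinuousLinearMap.id ℝ E :=
      (hFd.hasFDerivAt.sub (hasFDerivAt_id x)).fderiv
    simp only [J, this, one_smul, add_sub_cancel]
    exact det_fderiv_eq_zero_of_norm_eq_one hFd h1
  simp only [hJ0, integral_zero] at hJ1
  have hvpos : 0 < (volume B).toReal :=
    ENNReal.toReal_pos (measure_closedBall_pos volume 0 one_pos).ne' hB.measure_lt_top.ne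
  exact hvpos.ne hJ1

lemma exists_eq_zero_of_contDiff_of_eq_id {ψ : E → E} (hψ : ContDiff ℝ 1 ψ)
    (h : ∀ x, ‖x‖ = 1 → ψ x = x) : ∃ x, ψ x = 0 := by
  by_contra! hne
  have hn : ∀ x, ‖ψ x‖ ≠ 0 := fun x => norm_ne_zero_iff.2 (hne x)
  refine not_exists_contDiff_retraction_sphere (F := fun x => ‖ψ x‖⁻¹ • ψ x)
    (((hψ.norm ℝ hne).inv hn).smul hψ) (fun x => ?_) (fun x hx => ?_)
  · rw [norm_smul, norm_inv, norm_norm, inv_mul_cancel₀ (hn x)]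
  · simp [h x hx, hx]

/-- A form of Brouwer's theorem: a continuous map that moves the points of the closed unit ball by
at most `1 / 2` vanishes somewhere. -/
lemma exists_eq_zero_of_norm_sub_le {φ : E → E} (hφ : ContinuousOn φ (closedBall 0 1))
    (h : ∀ x ∈ closedBall (0 : E) 1, ‖φ x - x‖ ≤ 1 / 2) : ∃ x ∈ closedBall (0 : E) 1, φ x = 0 := by
  by_contra! hne
  have hB : IsCompact (closedBall (0 : E) 1) := isCompact_closedBall 0 1
  obtain ⟨x₀, hx₀, hmin⟩ := hB.exists_isMinOn ⟨0, by simp⟩ hφ.norm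
  set m := ‖φ x₀‖
  have hm : 0 < m := norm_pos_iff.2 (hne x₀ hx₀)
  have hp : ContinuousOn (fun x => φ x - x) (closedBall (0 : E) 1) := hφ.sub continuousOn_id
  obtain ⟨p, hp'⟩ := ContinuousMap.exists_restrict_eq isClosed_closedBall
    ⟨(closedBall (0 : E) 1).domRestrict (fun x => φ x - x), hp.domRestrict⟩
  have hpe : ∀ x ∈ closedBall (0 : E) 1, p x = φ x - x := fun x hx =>
    congrArg (fun q : C(closedBall (0 : E) 1, E) => q ⟨x, hx⟩) hp'
  obtain ⟨P, hP, hPd, -⟩ := p.continuous.exists_contDiff_approx 1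
    (ε := fun _ => min m (1 / 8)) continuous_const (fun _ => by positivity)
  -- `P` is a smooth approximation of `φ - id`; the map `id + χ P` is the identity on the sphere, its
  -- zeros lie where `χ = 1`, and there `φ` would be smaller than its minimum
  let χ : ContDiffBump (0 : E) := ⟨3 / 4, 1, by norm_num, by norm_num⟩
  have hχ1 : ∀ x : E, ‖x‖ ≤ 3 / 4 → χ x = 1 := fun x hx =>
    χ.one_of_mem_closedBall (by simpa [χ] using hx)
  have hχ0 : ∀ x : E, 1 ≤ ‖x‖ → χ x = 0 := fun x hx => χ.zero_of_le_dist (by simpa [χ] using hx)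
  obtain ⟨x, hx⟩ := exists_eq_zero_of_contDiff_of_eq_id (ψ := fun x => x + χ x • P x)
    (contDiff_id.add (χ.contDiff.smul hP)) (fun x hx => by simp [hχ0 x hx.ge])
  have hx1 : x ∈ closedBall (0 : E) 1 := by
    by_contra hx1
    have : 1 < ‖x‖ := by simpa using hx1
    simp only [hχ0 x this.le, zero_smul, add_zero] at hx
    simp [hx] at this
    linarith
  have hPx : ‖P x - (φ x - x)‖ < min m (1 / 8) := by
    rw [← hpe x hx1, ← dist_eq_norm]; exact hPd x
  have hnx : ‖x‖ ≤ 3 / 4 := by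
    have h1 : ‖x‖ = χ x * ‖P x‖ := by
      have h0 : ‖x‖ = ‖χ x • P x‖ := by
        rw [← norm_neg (χ x • P x)]; exact congrArg norm (eq_neg_of_add_eq_zero_left hx)
      rw [h0, norm_smul, Real.norm_of_nonneg χ.nonneg]
    have h2 : ‖P x‖ ≤ 1 / 8 + 1 / 2 := by
      calc ‖P x‖ = ‖(P x - (φ x - x)) + (φ x - x)‖ := by rw [sub_add_cancel]
        _ ≤ _ := norm_add_le _ _
        _ ≤ _ := add_le_add (hPx.le.trans (min_le_right _ _)) (h x hx1)
    have := mul_le_of_le_one_left (norm_nonneg (P x)) (χ.le_one (x := x))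
    linarith
  simp only [hχ1 x hnx, one_smul] at hx
  have : ‖φ x‖ < m := by
    have h3 : P x - (φ x - x) = - φ x := by
      rw [eq_neg_of_add_eq_zero_right hx]; abel
    rw [h3, norm_neg] at hPx
    exact hPx.trans_le (min_le_left _ _)
  exact absurd (hmin hx1) (not_le.2 this)

/-- The closed unit ball does not embed into the unit sphere of the same space: a `C¹` map close to
the inverse of such an embedding would map the sphere, a null set, onto a neighbourhood of `0`. -/
theorem not_injOn_closedBall_of_mapsTo_sphere {f : E → E} (hf : ContinuousOn f (closedBall 0 1))
    (hinj : Set.InjOn f (closedBall 0 1)) (hmaps : Set.MapsTo f (closedBall 0 1) (sphere 0 1)) :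
    False := by
  borelize E
  set B := closedBall (0 : E) 1
  have : Nontrivial E := by
    have h0 : f 0 ∈ sphere (0 : E) 1 := hmaps (by simp [B])
    exact ⟨f 0, 0, fun h => by simp [h] at h0⟩
  have hB : IsCompact B := isCompact_closedBall 0 1
  have : CompactSpace B := isCompact_iff_compactSpace.1 hB
  have hemb : IsClosedEmbedding (B.domRestrict f) :=
    hf.domRestrict.isClosedEmbedding hinj.injective
  obtain ⟨G, hG⟩ := ContinuousMap.exists_extension hemb
    (⟨Subtype.val, continuous_subtype_val⟩ : C(B, E))
  have hGf : ∀ x ∈ B, G (f x) = x := fun x hx =>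
    congrArg (fun q : C(B, E) => q ⟨x, hx⟩) hG
  obtain ⟨P, hP, hPd, -⟩ := G.continuous.exists_contDiff_approx 1
    (ε := fun _ => 1 / 4) continuous_const (fun _ => by norm_num)
  have hsub : closedBall (0 : E) (1 / 4) ⊆ P '' sphere 0 1 := by
    intro c hc
    have hc' : ‖c‖ ≤ 1 / 4 := by simpa using hc
    obtain ⟨x, hx, hx0⟩ := exists_eq_zero_of_norm_sub_le (φ := fun x => P (f x) - c)
      ((hP.continuous.comp_continuousOn hf).sub continuousOn_const) (fun x hx => by
        have h1 : ‖P (f x) - x‖ < 1 / 4 := by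
          have := hPd (f x)
          rwa [hGf x hx, dist_eq_norm] at this
        calc ‖P (f x) - c - x‖ = ‖(P (f x) - x) - c‖ := by congr 1; abel
          _ ≤ ‖P (f x) - x‖ + ‖c‖ := norm_sub_le _ _
          _ ≤ 1 / 2 := by linarith)
    exact ⟨f x, hmaps hx, sub_eq_zero.1 hx0⟩
  have hnull : (volume : Measure E) (P '' sphere 0 1) = 0 :=
    addHaar_image_eq_zero_of_differentiableOn_of_addHaar_eq_zero volume
      (hP.differentiable one_ne_zero).differentiableOn (Measure.addHaar_sphere volume 0 1)
  have hpos : 0 < (volume : Measure E) (closedBall (0 : E) (1 / 4)) :=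
    measure_closedBall_pos volume 0 (by norm_num)
  exact absurd (measure_mono_null hsub hnull) hpos.ne'

theorem not_injective_closedBall_sphere {f : closedBall (0 : E) 1 → sphere (0 : E) 1}
    (hf : Continuous f) (hinj : Function.Injective f) : False := by
  obtain ⟨p, hp⟩ := ContinuousMap.exists_restrict_eq isClosed_closedBall
    (⟨fun x => (f x : E), continuous_subtype_val.comp hf⟩ : C(closedBall (0 : E) 1, E))
  have hpe : ∀ x (hx : x ∈ closedBall (0 : E) 1), p x = f ⟨x, hx⟩ := fun x hx =>
    congrArg (fun q : C(closedBall (0 : E) 1, E) => q ⟨x, hx⟩) hp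
  refine not_injOn_closedBall_of_mapsTo_sphere p.continuous.continuousOn (fun x hx y hy hxy => ?_)
    (fun x hx => by rw [hpe x hx]; exact (f ⟨x, hx⟩).2)
  rw [hpe x hx, hpe y hy] at hxy
  exact congrArg Subtype.val (hinj (Subtype.ext hxy))

end BallInSphere

/-! ### The bilinear form, and the cone over an acausal set -/

section Form

variable {n : ℕ}

/-- The coordinates `(u, v)` of a vector of `ℝ^{n+2}`. -/
noncomputable def timePart (v : V n) : EuclideanSpace ℝ (Fin 2) := WithLp.toLp 2 fun i => v (Sum.inl i)

/-- The coordinates `(x₁, …, xₙ)` of a vector of `ℝ^{n+2}`. -/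
noncomputable def spacePart (v : V n) : EuclideanSpace ℝ (Fin n) := WithLp.toLp 2 fun j => v (Sum.inr j)

lemma form_eq_inner (v w : V n) :
    form v w = -inner ℝ (timePart v) (timePart w) + inner ℝ (spacePart v) (spacePart w) := by
  simp [form, timePart, spacePart, PiLp.inner_apply, mul_comm]

lemma form_self (v : V n) : form v v = -‖timePart v‖ ^ 2 + ‖spacePart v‖ ^ 2 := by
  rw [form_eq_inner, real_inner_self_eq_norm_sq, real_inner_self_eq_norm_sq]

lemma continuous_spacePart : Continuous (spacePart (n := n)) := by
  unfold spacePart; fun_prop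

lemma eq_zero_of_parts_eq_zero {v : V n} (h1 : timePart v = 0) (h2 : spacePart v = 0) : v = 0 := by
  ext i
  rcases i with i | i
  · exact congrArg (fun w : EuclideanSpace ℝ (Fin 2) => w i) h1
  · exact congrArg (fun w : EuclideanSpace ℝ (Fin n) => w i) h2

/-- The orthogonal symmetry of `ℝ^{n+2}` whose composition with the inner product is the form. -/
noncomputable def timeReflection : V n →ₗ[ℝ] V n where
  toFun v := WithLp.toLp 2 (Sum.elim (fun i => -v (Sum.inl i)) fun j => v (Sum.inr j))
  map_add' v w := by ext i; rcases i with i | i <;> simp [add_comm]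
  map_smul' c v := by ext i; rcases i with i | i <;> simp

lemma form_eq_inner_timeReflection (v w : V n) : form v w = inner ℝ (timeReflection v) w := by
  simp [form, timeReflection, PiLp.inner_apply, mul_comm]

lemma timeReflection_timeReflection (v : V n) : timeReflection (timeReflection v) = v := by
  ext i; rcases i with i | i <;> simp [timeReflection]

lemma norm_timeReflection (v : V n) : ‖timeReflection v‖ = ‖v‖ := by
  simp [EuclideanSpace.norm_eq, timeReflection]

lemma abs_form_le (v w : V n) : |form v w| ≤ ‖v‖ * ‖w‖ := by
  rw [form_eq_inner_timeReflection, ← norm_timeReflection v]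
  exact abs_real_inner_le_norm _ _

lemma continuous_form : Continuous fun p : V n × V n => form p.1 p.2 := by
  unfold form; fun_prop

lemma act_add (g : Matrix.SpecialLinearGroup (Fin 2 ⊕ Fin n) ℝ) (x y : V n) :
    act g (x + y) = act g x + act g y := by
  simp [act]

lemma continuous_act (g : Matrix.SpecialLinearGroup (Fin 2 ⊕ Fin n) ℝ) : Continuous (act (n := n) g) :=
  (Matrix.toEuclideanLin (g : Matrix (Fin 2 ⊕ Fin n) (Fin 2 ⊕ Fin n) ℝ)).continuous_of_finiteDimensional

lemma act_act_inv (g : Matrix.SpecialLinearGroup (Fin 2 ⊕ Fin n) ℝ) (x : V n) :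
    act g (act g⁻¹ x) = x := by
  rw [← act_mul, mul_inv_cancel, act_one]

lemma form_act_left (g : SO2 n) (x y : V n) : form (act g.1 x) y = form x (act g.1⁻¹ y) := by
  rw [← g.2 x (act g.1⁻¹ y), act_act_inv]

/-- The function `-⟨v|w⟩`. It is positive on pairs of vectors of the cone over an acausal set that
do not lie on a common isotropic ray. -/
noncomputable def pair (v w : V n) : ℝ := -form v w

lemma pair_comm (v w : V n) : pair v w = pair w v := by rw [pair, pair, form_comm]

lemma pair_add_left (v w z : V n) : pair (v + w) z = pair v z + pair w z := by
  simp only [pair, form_add_left]; ring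

lemma pair_add_right (v w z : V n) : pair v (w + z) = pair v w + pair v z := by
  simp only [pair, form_add_right]; ring

lemma pair_smul_left (c : ℝ) (v w : V n) : pair (c • v) w = c * pair v w := by
  simp only [pair, form_smul_left]; ring

lemma pair_smul_right (c : ℝ) (v w : V n) : pair v (c • w) = c * pair v w := by
  simp only [pair, form_smul_right]; ring

lemma pair_act_act (g : SO2 n) (v w : V n) : pair (act g.1 v) (act g.1 w) = pair v w := by
  rw [pair, pair, g.2]

lemma pair_le (v w : V n) : pair v w ≤ ‖v‖ * ‖w‖ :=
  (neg_le_abs _).trans (abs_form_le v w)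

lemma continuous_pair : Continuous fun p : V n × V n => pair p.1 p.2 := continuous_form.neg

lemma continuous_pair_left (w : V n) : Continuous fun v : V n => pair v w :=
  continuous_pair.comp (continuous_id.prodMk continuous_const)

lemma pair_self (x : AdS n) : pair (x : V n) x = 1 := by
  rw [pair, x.2]; norm_num

/-- The convex cone over `Λ`. -/
def cone (Λ : Set (AdSBar n)) : Set (V n) :=
  {v | ∃ t : ℝ, 0 < t ∧ t • v ∈ convexHull ℝ ((fun ξ : AdSBar n => (ξ : V n)) '' Λ)}

variable {Λ : Set (AdSBar n)}

lemma coe_mem_cone {ξ : AdSBar n} (hξ : ξ ∈ Λ) : (ξ : V n) ∈ cone Λ :=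
  ⟨1, one_pos, by rw [one_smul]; exact subset_convexHull ℝ _ ⟨ξ, hξ, rfl⟩⟩

lemma smul_mem_cone {c : ℝ} (hc : 0 < c) {v : V n} (hv : v ∈ cone Λ) : c • v ∈ cone Λ := by
  obtain ⟨t, ht, h⟩ := hv
  refine ⟨t / c, by positivity, ?_⟩
  rwa [smul_smul, div_mul_cancel₀ t hc.ne']

lemma add_mem_cone {v w : V n} (hv : v ∈ cone Λ) (hw : w ∈ cone Λ) : v + w ∈ cone Λ := by
  obtain ⟨t, ht, hv⟩ := hv
  obtain ⟨r, hr, hw⟩ := hw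
  refine ⟨(t⁻¹ + r⁻¹)⁻¹, by positivity, ?_⟩
  have h := (convex_convexHull ℝ ((fun ξ : AdSBar n => (ξ : V n)) '' Λ)) hv hw
    (a := (t⁻¹ + r⁻¹)⁻¹ * t⁻¹) (b := (t⁻¹ + r⁻¹)⁻¹ * r⁻¹)
    (by positivity) (by positivity) (by rw [← mul_add]; exact inv_mul_cancel₀ (by positivity))
  convert h using 1
  rw [smul_add, smul_smul, smul_smul]
  congr 2 <;> field_simp

lemma cone_induction {P : V n → Prop} (hΛ : ∀ ξ ∈ Λ, P (ξ : V n))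
    (hadd : ∀ v w, P v → P w → P (v + w)) (hsmul : ∀ (c : ℝ) v, 0 < c → P v → P (c • v))
    {v : V n} (hv : v ∈ cone Λ) : P v := by
  obtain ⟨t, ht, hv⟩ := hv
  have hconv : Convex ℝ {v : V n | P v} := by
    refine convex_iff_forall_pos.2 fun v hv w hw a b ha hb _ => ?_
    exact hadd _ _ (hsmul a v ha hv) (hsmul b w hb hw)
  have h : t • v ∈ {v : V n | P v} := convexHull_min (by rintro _ ⟨ξ, hξ, rfl⟩; exact hΛ ξ hξ) hconv hv
  have := hsmul t⁻¹ (t • v) (inv_pos.2 ht) h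
  rwa [smul_smul, inv_mul_cancel₀ ht.ne', one_smul] at this

lemma mem_hull_iff {x : AdS n} : x ∈ hull Λ ↔ (x : V n) ∈ cone Λ := Iff.rfl

lemma act_eq_norm_smul (g : SO2 n) (ξ : AdSBar n) :
    act g.1 (ξ : V n) = ‖act g.1 (ξ : V n)‖ • ((g • ξ : AdSBar n) : V n) := by
  change _ = _ • (‖act g.1 (ξ : V n)‖⁻¹ • act g.1 (ξ : V n))
  rw [smul_smul, mul_inv_cancel₀ (norm_ne_zero_iff.2 (act_ne_zero _ (AdSBar.ne_zero ξ))), one_smul]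

lemma act_mem_cone {g : SO2 n} (hg : ∀ ξ ∈ Λ, g • ξ ∈ Λ) {v : V n} (hv : v ∈ cone Λ) :
    act g.1 v ∈ cone Λ := by
  refine cone_induction (P := fun v => act g.1 v ∈ cone Λ) (fun ξ hξ => ?_) (fun v w hv hw => ?_)
    (fun c v hc hv => ?_) hv
  · rw [act_eq_norm_smul]
    exact smul_mem_cone (norm_pos_iff.2 (act_ne_zero _ (AdSBar.ne_zero ξ))) (coe_mem_cone (hg ξ hξ))
  · rw [act_add]; exact add_mem_cone hv hw
  · rw [act_smul]; exact smul_mem_cone hc hv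

lemma norm_le_one_of_mem_convexHull {b : V n}
    (hb : b ∈ convexHull ℝ ((fun ξ : AdSBar n => (ξ : V n)) '' Λ)) : ‖b‖ ≤ 1 := by
  have : b ∈ Metric.closedBall (0 : V n) 1 :=
    convexHull_min (by rintro _ ⟨ξ, _, rfl⟩; simp [ξ.2.1]) (convex_closedBall 0 1) hb
  simpa using this

lemma pair_nonneg_of_isAcausal (hΛ : IsAcausal Λ) {v w : V n} (hv : v ∈ cone Λ) (hw : w ∈ cone Λ) :
    0 ≤ pair v w := by
  refine cone_induction (P := fun v => 0 ≤ pair v w) (fun ξ hξ => ?_) (fun v v' hv hv' => ?_)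
    (fun c v hc hv => ?_) hv
  · refine cone_induction (P := fun w => 0 ≤ pair (ξ : V n) w) (fun η hη => ?_)
      (fun v v' hv hv' => ?_) (fun c v hc hv => ?_) hw
    · rcases eq_or_ne ξ η with rfl | h
      · have : form (ξ : V n) ξ = 0 := hΛ.1 hξ
        rw [pair, this, neg_zero]
      · exact (neg_pos.2 (hΛ.2 ξ hξ η hη h)).le
    · rw [pair_add_right]; positivity
    · rw [pair_smul_right]; positivity
  · rw [pair_add_left]; positivity
  · rw [pair_smul_left]; positivity

/-- A vector of the cone over an acausal set is either on the ray `ξ` or not orthogonal to `ξ`. -/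
lemma pair_pos_or_mem_ray (hΛ : IsAcausal Λ) {v : V n} (hv : v ∈ cone Λ) {ξ : AdSBar n} (hξ : ξ ∈ Λ) :
    0 < pair v (ξ : V n) ∨ ∃ c : ℝ, 0 < c ∧ v = c • (ξ : V n) := by
  refine cone_induction (P := fun v => 0 < pair v (ξ : V n) ∨ ∃ c : ℝ, 0 < c ∧ v = c • (ξ : V n))
    (fun η hη => ?_) (fun v w hv hw => ?_) (fun c v hc hv => ?_) hv
  · rcases eq_or_ne η ξ with rfl | h
    · exact Or.inr ⟨1, one_pos, (one_smul ℝ _).symm⟩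
    · exact Or.inl (neg_pos.2 (hΛ.2 η hη ξ hξ h))
  · have h0 : pair (ξ : V n) ξ = 0 := by
      have : form (ξ : V n) ξ = 0 := hΛ.1 hξ
      rw [pair, this, neg_zero]
    rcases hv with hv | ⟨c, hc, rfl⟩ <;> rcases hw with hw | ⟨d, hd, rfl⟩
    · left; rw [pair_add_left]; positivity
    · left; rw [pair_add_left, pair_smul_left, h0]; linarith
    · left; rw [pair_add_left, pair_smul_left, h0]; linarith
    · exact Or.inr ⟨c + d, by positivity, (add_smul _ _ _).symm⟩
  · rcases hv with hv | ⟨d, hd, rfl⟩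
    · left; rw [pair_smul_left]; positivity
    · exact Or.inr ⟨c * d, by positivity, smul_smul _ _ _⟩

lemma pair_pos_of_mem_hull (hΛ : IsAcausal Λ) {x : AdS n} (hx : x ∈ hull Λ) {v : V n}
    (hv : v ∈ cone Λ) : 0 < pair (x : V n) v := by
  refine cone_induction (P := fun v => 0 < pair (x : V n) v) (fun ξ hξ => ?_) (fun v w hv hw => ?_)
    (fun c v hc hv => ?_) hv
  · rcases pair_pos_or_mem_ray hΛ (mem_hull_iff.1 hx) hξ with h | ⟨c, hc, h⟩
    · exact h
    · have h1 := x.2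
      have h0 : form (ξ : V n) ξ = 0 := hΛ.1 hξ
      rw [h, form_smul_left, form_smul_right, h0] at h1
      norm_num at h1
  · rw [pair_add_right]; positivity
  · rw [pair_smul_right]; positivity

lemma exists_ne_of_mem_hull (hΛ : IsAcausal Λ) {x : AdS n} (hx : x ∈ hull Λ) (ξ : AdSBar n) :
    ∃ η ∈ Λ, η ≠ ξ := by
  by_contra! h
  have hcone : ∃ c : ℝ, 0 < c ∧ (x : V n) = c • (ξ : V n) := by
    refine cone_induction (Λ := Λ) (P := fun v => ∃ c : ℝ, 0 < c ∧ v = c • (ξ : V n))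
      (fun η hη => ⟨1, one_pos, by rw [h η hη, one_smul]⟩) ?_ ?_ hx
    · rintro v w ⟨c, hc, rfl⟩ ⟨d, hd, rfl⟩
      exact ⟨c + d, by positivity, (add_smul _ _ _).symm⟩
    · rintro c v hc ⟨d, hd, rfl⟩
      exact ⟨c * d, by positivity, smul_smul _ _ _⟩
  have hξ : ξ ∈ Λ := by
    have hne : Λ.Nonempty := by
      by_contra! hne
      obtain ⟨t, -, ht⟩ := hx
      simp [hne] at ht
    obtain ⟨η, hη⟩ := hne
    exact h η hη ▸ hη
  obtain ⟨c, hc, hxc⟩ := hcone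
  have h1 := pair_pos_of_mem_hull hΛ hx (coe_mem_cone hξ)
  have h0 : form (ξ : V n) ξ = 0 := hΛ.1 hξ
  rw [hxc, pair_smul_left, pair, h0] at h1
  simp at h1

/-- For `x` in a compact part of `C(Λ)`, `v ↦ -⟨x|v⟩` is equivalent to the norm on the cone. -/
lemma exists_mul_norm_le_pair (hΛ : IsAcausal Λ) (hc : IsCompact Λ) {K : Set (AdS n)} (hK : IsCompact K)
    (hKΛ : K ⊆ hull Λ) : ∃ c : ℝ, 0 < c ∧ ∀ x ∈ K, ∀ v ∈ cone Λ, c * ‖v‖ ≤ pair (x : V n) v := by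
  obtain ⟨c, hc0, h⟩ : ∃ c : ℝ, 0 < c ∧ ∀ x ∈ K, ∀ ξ ∈ Λ, c ≤ pair (x : V n) (ξ : V n) := by
    rcases (K ×ˢ Λ).eq_empty_or_nonempty with he | hne
    · refine ⟨1, one_pos, fun x hx ξ hξ => ?_⟩
      have : (x, ξ) ∈ K ×ˢ Λ := ⟨hx, hξ⟩
      simp [he] at this
    · obtain ⟨⟨x₀, ξ₀⟩, h₀, hmin⟩ := (hK.prod hc).exists_isMinOn hne
        (f := fun p : AdS n × AdSBar n => pair (p.1 : V n) (p.2 : V n))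
        (continuous_pair.comp ((continuous_subtype_val.comp continuous_fst).prodMk
          (continuous_subtype_val.comp continuous_snd))).continuousOn
      exact ⟨_, pair_pos_of_mem_hull hΛ (hKΛ h₀.1) (coe_mem_cone h₀.2), fun x hx ξ hξ =>
        hmin (show (x, ξ) ∈ K ×ˢ Λ from ⟨hx, hξ⟩)⟩
  refine ⟨c, hc0, fun x hx v hv => ?_⟩
  refine cone_induction (P := fun v => c * ‖v‖ ≤ pair (x : V n) v) (fun ξ hξ => ?_)
    (fun v w hv hw => ?_) (fun r v hr hv => ?_) hv
  · rw [ξ.2.1, mul_one]; exact h x hx ξ hξ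
  · rw [pair_add_right]
    calc c * ‖v + w‖ ≤ c * (‖v‖ + ‖w‖) := by gcongr; exact norm_add_le v w
      _ ≤ _ := by linarith
  · rw [pair_smul_right, norm_smul, Real.norm_of_nonneg hr.le]
    calc c * (r * ‖v‖) = r * (c * ‖v‖) := by ring
      _ ≤ _ := by gcongr

/-- If a point of the closed convex hull of `Λ` is orthogonal to `ξ ∈ Λ`, it is `ξ`: it is a limit of
convex combinations in which the weight of the points far from `ξ` tends to zero. -/
lemma eq_of_mem_closure_convexHull_of_pair_eq_zero (hΛ : IsAcausal Λ) (hc : IsCompact Λ) {b : V n}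
    (hb : b ∈ closure (convexHull ℝ ((fun ξ : AdSBar n => (ξ : V n)) '' Λ))) {ξ : AdSBar n}
    (hξ : ξ ∈ Λ) (h0 : pair b (ξ : V n) ≤ 0) : b = ξ := by
  have key : ∀ r : ℝ, 0 < r → ‖b - ξ‖ ≤ r := by
    intro r hr
    obtain ⟨m, hm, hmle⟩ : ∃ m : ℝ, 0 < m ∧ ∀ η ∈ Λ, r ≤ ‖(η : V n) - ξ‖ → m ≤ pair (η : V n) ξ := by
      have hcont : Continuous fun η : AdSBar n => ‖(η : V n) - ξ‖ := by fun_prop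
      have hcl : IsCompact (Λ ∩ {η | r ≤ ‖(η : V n) - ξ‖}) :=
        hc.inter_right (isClosed_le continuous_const hcont)
      rcases (Λ ∩ {η | r ≤ ‖(η : V n) - ξ‖}).eq_empty_or_nonempty with he | hne
      · refine ⟨1, one_pos, fun η hη hr => ?_⟩
        have : η ∈ Λ ∩ {η | r ≤ ‖(η : V n) - ξ‖} := ⟨hη, hr⟩
        simp [he] at this
      · obtain ⟨η₀, h₀, hmin⟩ := hcl.exists_isMinOn hne
          (f := fun η : AdSBar n => pair (η : V n) ξ)
          ((continuous_pair_left _).comp continuous_subtype_val).continuousOn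
        refine ⟨_, neg_pos.2 (hΛ.2 η₀ h₀.1 ξ hξ ?_), fun η hη hr => hmin ⟨hη, hr⟩⟩
        rintro rfl
        have : r ≤ ‖(η₀ : V n) - η₀‖ := h₀.2
        simp at this
        linarith
    -- a closed convex set that contains `Λ`, and whose points orthogonal to `ξ` are close to `ξ`
    let S : Set (V n) := {v | ‖v - ξ‖ ≤ r + 2 / m * pair v (ξ : V n)}
    have hScl : IsClosed S := isClosed_le (by fun_prop)
      (continuous_const.add (continuous_const.mul (continuous_pair_left _)))
    have hSconv : Convex ℝ S := by
      intro v hv w hw a c ha hc hac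
      have hv' : ‖v - ξ‖ ≤ r + 2 / m * pair v (ξ : V n) := hv
      have hw' : ‖w - ξ‖ ≤ r + 2 / m * pair w (ξ : V n) := hw
      change ‖a • v + c • w - ξ‖ ≤ r + 2 / m * pair (a • v + c • w) (ξ : V n)
      have h1 : a • v + c • w - (ξ : V n) = a • (v - ξ) + c • (w - ξ) := by
        rw [show c = 1 - a by linarith]
        module
      rw [h1, pair_add_left, pair_smul_left, pair_smul_left]
      calc ‖a • (v - ξ) + c • (w - ξ)‖ ≤ a * ‖v - ξ‖ + c * ‖w - ξ‖ := by
            refine (norm_add_le _ _).trans_eq ?_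
            rw [norm_smul, norm_smul, Real.norm_of_nonneg ha, Real.norm_of_nonneg hc]
        _ ≤ a * (r + 2 / m * pair v (ξ : V n)) + c * (r + 2 / m * pair w (ξ : V n)) := by gcongr
        _ = (a + c) * r + 2 / m * (a * pair v (ξ : V n) + c * pair w (ξ : V n)) := by ring
        _ = _ := by rw [hac, one_mul]
    have hΛS : (fun ξ : AdSBar n => (ξ : V n)) '' Λ ⊆ S := by
      rintro _ ⟨η, hη, rfl⟩
      change ‖(η : V n) - ξ‖ ≤ r + 2 / m * pair (η : V n) (ξ : V n)
      have hp := pair_nonneg_of_isAcausal hΛ (coe_mem_cone hη) (coe_mem_cone hξ)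
      rcases le_total r ‖(η : V n) - ξ‖ with hle | hle
      · have h2 : ‖(η : V n) - ξ‖ ≤ 2 := by
          refine (norm_sub_le _ _).trans ?_
          rw [η.2.1, ξ.2.1]; norm_num
        have h3 : 2 ≤ 2 / m * pair (η : V n) (ξ : V n) := by
          rw [div_mul_eq_mul_div, le_div_iff₀ hm]
          have := hmle η hη hle
          linarith
        linarith
      · have : 0 ≤ 2 / m * pair (η : V n) (ξ : V n) := by positivity
        linarith
    have hbS : b ∈ S := closure_minimal (convexHull_min hΛS hSconv) hScl hb
    have hbS' : ‖b - ξ‖ ≤ r + 2 / m * pair b (ξ : V n) := hbS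
    have : 2 / m * pair b (ξ : V n) ≤ 0 := mul_nonpos_of_nonneg_of_nonpos (by positivity) h0
    linarith
  have : ‖b - ξ‖ ≤ 0 := le_of_forall_pos_le_add fun r hr => by simpa using key r hr
  exact sub_eq_zero.1 (norm_le_zero_iff.1 this)

/-- The isotropic points of the closed convex hull of `Λ` are the points of `Λ`. -/
lemma exists_eq_of_mem_closure_convexHull_of_pair_self_le (hΛ : IsAcausal Λ) (hc : IsCompact Λ) {b : V n}
    (hb : b ∈ closure (convexHull ℝ ((fun ξ : AdSBar n => (ξ : V n)) '' Λ)))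
    (h0 : pair b b ≤ 0) : ∃ ξ ∈ Λ, b = (ξ : V n) := by
  by_contra! hne
  have hpos : ∀ ξ ∈ Λ, 0 < pair b (ξ : V n) := fun ξ hξ => by
    by_contra hle
    exact hne ξ hξ (eq_of_mem_closure_convexHull_of_pair_eq_zero hΛ hc hb hξ (not_lt.1 hle))
  have hΛne : Λ.Nonempty := by
    by_contra! he
    simp [he] at hb
  obtain ⟨ξ₀, h₀, hmin⟩ := hc.exists_isMinOn hΛne
    (f := fun η : AdSBar n => pair b (η : V n))
    (continuous_pair.comp (continuous_const.prodMk continuous_subtype_val)).continuousOn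
  -- if `b` were not in `Λ`, `pair b` would be at least `m > 0` on `Λ`, hence at `b`
  set m := pair b (ξ₀ : V n)
  have hcl : IsClosed {v : V n | m ≤ pair b v} :=
    isClosed_le continuous_const (continuous_pair.comp (continuous_const.prodMk continuous_id))
  have hconv : Convex ℝ {v : V n | m ≤ pair b v} := by
    intro v hv w hw a c ha hc hac
    have hv' : m ≤ pair b v := hv
    have hw' : m ≤ pair b w := hw
    change m ≤ pair b (a • v + c • w)
    rw [pair_add_right, pair_smul_right, pair_smul_right]
    calc m = a * m + c * m := by rw [← add_mul, hac, one_mul]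
      _ ≤ _ := by gcongr
  have : b ∈ {v : V n | m ≤ pair b v} := closure_minimal
    (convexHull_min (by rintro _ ⟨ξ, hξ, rfl⟩; exact hmin hξ) hconv) hcl hb
  have h1 : m ≤ pair b b := this
  linarith [hpos ξ₀ h₀]

end Form

/-! ### The orthogonal of a full-dimensional acausal sphere, and properness of the action -/

section Proper

variable {n : ℕ} {Λ : Set (AdSBar n)}

/-- The map from the ball of a hyperplane `bᗮ` to the sphere, given by the hemisphere around `b`. -/
lemma exists_closedBall_orthogonal_embedding {F : Type*} [NormedAddCommGroup F]
    [InnerProductSpace ℝ F] {b : F} (hb : ‖b‖ = 1) :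
    ∃ f : Metric.closedBall (0 : (ℝ ∙ b)ᗮ) 1 → Metric.sphere (0 : F) 1,
      Continuous f ∧ Function.Injective f := by
  have hper : ∀ y : (ℝ ∙ b)ᗮ, inner ℝ (y : F) b = 0 := fun y =>
    Submodule.mem_orthogonal_singleton_iff_inner_left.1 y.2
  have hnorm : ∀ y : Metric.closedBall (0 : (ℝ ∙ b)ᗮ) 1,
      ‖((y : (ℝ ∙ b)ᗮ) : F) + √(1 - ‖(y : (ℝ ∙ b)ᗮ)‖ ^ 2) • b‖ = 1 := by
    intro y
    have hy : ‖(y : (ℝ ∙ b)ᗮ)‖ ≤ 1 := mem_closedBall_zero_iff.1 y.2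
    have h0 : 0 ≤ 1 - ‖(y : (ℝ ∙ b)ᗮ)‖ ^ 2 := by nlinarith [norm_nonneg (y : (ℝ ∙ b)ᗮ)]
    have h1 : ‖((y : (ℝ ∙ b)ᗮ) : F) + √(1 - ‖(y : (ℝ ∙ b)ᗮ)‖ ^ 2) • b‖ ^ 2 = 1 := by
      rw [norm_add_sq_real, inner_smul_right, hper, norm_smul, hb, mul_one,
        Real.norm_of_nonneg (Real.sqrt_nonneg _), Real.sq_sqrt h0, Submodule.coe_norm]
      ring
    exact (pow_eq_one_iff_of_nonneg (norm_nonneg _) two_ne_zero).1 h1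
  refine ⟨fun y => ⟨((y : (ℝ ∙ b)ᗮ) : F) + √(1 - ‖(y : (ℝ ∙ b)ᗮ)‖ ^ 2) • b, mem_sphere_zero_iff_norm.2 (hnorm y)⟩,
    by fun_prop, fun y z hyz => ?_⟩
  have h1 : ((y : (ℝ ∙ b)ᗮ) : F) + √(1 - ‖(y : (ℝ ∙ b)ᗮ)‖ ^ 2) • b =
      ((z : (ℝ ∙ b)ᗮ) : F) + √(1 - ‖(z : (ℝ ∙ b)ᗮ)‖ ^ 2) • b := congrArg Subtype.val hyz
  have h2 : √(1 - ‖(y : (ℝ ∙ b)ᗮ)‖ ^ 2) = √(1 - ‖(z : (ℝ ∙ b)ᗮ)‖ ^ 2) := by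
    have := congrArg (fun v => inner ℝ v b) h1
    simpa [inner_add_left, inner_smul_left, hper, real_inner_self_eq_norm_sq, hb] using this
  rw [h2] at h1
  exact Subtype.ext (Subtype.ext (add_right_cancel h1))

/-- Cauchy-Schwarz for the form `⟪p, q⟫ - ⟪p, a⟫ ⟪q, a⟫`, which is positive semidefinite if
`‖a‖ ≤ 1`. -/
lemma inner_sub_mul_inner_le {F : Type*} [NormedAddCommGroup F] [InnerProductSpace ℝ F] {a : F}
    (ha : ‖a‖ ≤ 1) (p q : F) {r s : ℝ} (hr : 0 ≤ r) (hs : 0 ≤ s)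
    (hp : r ^ 2 = ‖p‖ ^ 2 - inner ℝ p a ^ 2) (hq : s ^ 2 = ‖q‖ ^ 2 - inner ℝ q a ^ 2) :
    inner ℝ p q - inner ℝ p a * inner ℝ q a ≤ r * s := by
  have hpsd : ∀ v : F, 0 ≤ ‖v‖ ^ 2 - inner ℝ v a ^ 2 := by
    intro v
    have h1 := abs_real_inner_le_norm v a
    have h2 : |inner ℝ v a| ≤ ‖v‖ := h1.trans (mul_le_of_le_one_right (norm_nonneg _) ha)
    have := sq_le_sq' (by linarith [abs_nonneg (inner ℝ v a), norm_nonneg v]) h2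
    rw [sq_abs] at this
    linarith
  set m := inner ℝ p q - inner ℝ p a * inner ℝ q a with hm
  have hd := discrim_le_zero (a := s ^ 2) (b := 2 * m) (c := r ^ 2) (fun t => by
    have h := hpsd (t • q + p)
    rw [norm_add_sq_real, inner_add_left, inner_smul_left, inner_smul_left, norm_smul, mul_pow,
      Real.norm_eq_abs, sq_abs, real_inner_comm] at h
    simp only [conj_trivial] at h
    rw [hp, hq, hm]
    linarith)
  rw [discrim] at hd
  refine abs_le_of_sq_le_sq' ?_ (by positivity) |>.2
  nlinarith

/-- An acausal `(n-1)`-sphere is full-dimensional: the vectors orthogonal to it are timelike.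
If `w ≠ 0` is orthogonal to `Λ` and `⟨w|w⟩ ≥ 0`, the projection of the space coordinates along the
space part `b` of `w`, followed by the radial projection, maps `Λ` injectively to the unit sphere
of `bᗮ`, of dimension one less. -/
lemma form_self_neg_of_orthogonal (hΛ : IsAcausal Λ)
    (hS : Nonempty (Λ ≃ₜ Metric.sphere (0 : EuclideanSpace ℝ (Fin n)) 1)) {o : AdS n}
    (ho : o ∈ hull Λ) {w : V n} (hw : w ≠ 0) (horth : ∀ ξ ∈ Λ, form w (ξ : V n) = 0) :
    form w w < 0 := by
  by_contra! hq
  rw [form_self] at hq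
  have hab : ‖timePart w‖ ≤ ‖spacePart w‖ :=
    abs_le_of_sq_le_sq' (by linarith) (norm_nonneg _) |>.2
  have hb0 : 0 < ‖spacePart w‖ := by
    rcases (norm_nonneg (spacePart w)).eq_or_lt with h | h
    · refine absurd (eq_zero_of_parts_eq_zero (norm_eq_zero.1 ?_) (norm_eq_zero.1 h.symm)) hw
      exact le_antisymm (hab.trans h.symm.le) (norm_nonneg _)
    · exact h
  set b : EuclideanSpace ℝ (Fin n) := ‖spacePart w‖⁻¹ • spacePart w with hb
  set a : EuclideanSpace ℝ (Fin 2) := ‖spacePart w‖⁻¹ • timePart w with ha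
  have hbn : ‖b‖ = 1 := by
    rw [hb, norm_smul, norm_inv, norm_norm, inv_mul_cancel₀ hb0.ne']
  have han : ‖a‖ ≤ 1 := by
    rw [ha, norm_smul, norm_inv, norm_norm, inv_mul_le_iff₀ hb0, mul_one]; exact hab
  have hinner : ∀ ξ ∈ Λ, inner ℝ (timePart (ξ : V n)) a = inner ℝ (spacePart (ξ : V n)) b := by
    intro ξ hξ
    have h := horth ξ hξ
    rw [form_comm, form_eq_inner] at h
    rw [ha, hb, inner_smul_right, inner_smul_right]
    congr 1
    linarith
  let p : EuclideanSpace ℝ (Fin n) →L[ℝ] (ℝ ∙ b)ᗮ := (ℝ ∙ b)ᗮ.orthogonalProjectionOnto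
  have hp : ∀ x : EuclideanSpace ℝ (Fin n), ((p x : (ℝ ∙ b)ᗮ) : EuclideanSpace ℝ (Fin n)) =
      x - inner ℝ x b • b := by
    intro x
    have h1 := Submodule.starProjection_orthogonal_val (K := ℝ ∙ b) x
    change (ℝ ∙ b)ᗮ.starProjection x = _
    rw [h1, Submodule.starProjection_unit_singleton ℝ hbn, real_inner_comm]
  have hpp : ∀ x y : EuclideanSpace ℝ (Fin n),
      inner ℝ (p x) (p y) = inner ℝ x y - inner ℝ x b * inner ℝ y b := by
    intro x y
    rw [Submodule.coe_inner, hp, hp]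
    simp only [inner_sub_left, inner_sub_right, inner_smul_left, inner_smul_right,
      real_inner_self_eq_norm_sq, hbn, conj_trivial, real_inner_comm y b]
    ring
  have hform : ∀ ξ ∈ Λ, ∀ η ∈ Λ, inner ℝ (p (spacePart (ξ : V n))) (p (spacePart (η : V n))) -
      ‖p (spacePart (ξ : V n))‖ * ‖p (spacePart (η : V n))‖ ≤ form (ξ : V n) (η : V n) := by
    have hsq : ∀ ξ ∈ Λ, ‖p (spacePart (ξ : V n))‖ ^ 2 =
        ‖timePart (ξ : V n)‖ ^ 2 - inner ℝ (timePart (ξ : V n)) a ^ 2 := by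
      intro ξ hξ
      have h0 : form (ξ : V n) ξ = 0 := hΛ.1 hξ
      rw [form_self] at h0
      rw [← real_inner_self_eq_norm_sq (p _), hpp, hinner ξ hξ, real_inner_self_eq_norm_sq]
      linarith
    intro ξ hξ η hη
    have h := inner_sub_mul_inner_le han (timePart (ξ : V n)) (timePart (η : V n))
      (norm_nonneg _) (norm_nonneg _) (hsq ξ hξ) (hsq η hη)
    rw [hinner ξ hξ, hinner η hη] at h
    rw [hpp, form_eq_inner]
    linarith
  have hne : ∀ ξ ∈ Λ, ‖p (spacePart (ξ : V n))‖ ≠ 0 := by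
    intro ξ hξ h0
    obtain ⟨η, hη, hne⟩ := exists_ne_of_mem_hull hΛ ho ξ
    have h1 := hform ξ hξ η hη
    rw [h0, norm_eq_zero.1 h0, inner_zero_left] at h1
    linarith [hΛ.2 ξ hξ η hη hne.symm]
  obtain ⟨e⟩ := hS
  obtain ⟨f, hf, hfi⟩ := exists_closedBall_orthogonal_embedding hbn
  let G : Λ → Metric.sphere (0 : (ℝ ∙ b)ᗮ) 1 := fun ξ =>
    ⟨‖p (spacePart ((ξ : AdSBar n) : V n))‖⁻¹ • p (spacePart ((ξ : AdSBar n) : V n)), by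
      rw [mem_sphere_zero_iff_norm, norm_smul, norm_inv, norm_norm, inv_mul_cancel₀ (hne ξ ξ.2)]⟩
  have hG : Continuous G := by
    have h1 : Continuous fun ξ : Λ => p (spacePart ((ξ : AdSBar n) : V n)) :=
      p.continuous.comp (continuous_spacePart.comp
        (continuous_subtype_val.comp continuous_subtype_val))
    exact ((h1.norm.inv₀ fun ξ => hne ξ ξ.2).smul h1).subtype_mk _
  have hGi : Function.Injective G := by
    intro ξ η h
    by_contra hξη
    have h1 : ‖p (spacePart ((ξ : AdSBar n) : V n))‖⁻¹ • p (spacePart ((ξ : AdSBar n) : V n)) =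
      ‖p (spacePart ((η : AdSBar n) : V n))‖⁻¹ • p (spacePart ((η : AdSBar n) : V n)) :=
      congrArg Subtype.val h
    have h2 := hform ξ ξ.2 η η.2
    have h3 := hΛ.2 ξ ξ.2 η η.2 (fun h => hξη (Subtype.ext h))
    have hx := hne ξ ξ.2
    have hy := hne η η.2
    set P := p (spacePart ((ξ : AdSBar n) : V n))
    set Q := p (spacePart ((η : AdSBar n) : V n))
    have h4 : P = (‖P‖ * ‖Q‖⁻¹) • Q := by
      rw [mul_smul, ← h1, smul_smul, mul_inv_cancel₀ hx, one_smul]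
    have h5 : inner ℝ P Q = ‖P‖ * ‖Q‖ := by
      nth_rw 1 [h4]
      rw [inner_smul_left, real_inner_self_eq_norm_sq]
      simp only [conj_trivial]
      field_simp
    linarith
  exact not_injective_closedBall_sphere (hG.comp (e.symm.continuous.comp hf))
    (hGi.comp (e.symm.injective.comp hfi))

/-- The span of an acausal sphere and its orthogonal for the form generate `ℝ^{n+2}`. -/
lemma span_sup_eq_top (hneg : ∀ w : V n, w ≠ 0 → (∀ ξ ∈ Λ, form w (ξ : V n) = 0) → form w w < 0) :
    Submodule.span ℝ ((fun ξ : AdSBar n => (ξ : V n)) '' Λ ∪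
      {w | ∀ ξ ∈ Λ, form w (ξ : V n) = 0}) = ⊤ := by
  rw [← Submodule.orthogonal_eq_bot_iff, Submodule.eq_bot_iff]
  intro y hy
  have hy' : ∀ v ∈ (fun ξ : AdSBar n => (ξ : V n)) '' Λ ∪ {w | ∀ ξ ∈ Λ, form w (ξ : V n) = 0},
      inner ℝ v y = 0 := fun v hv => hy v (Submodule.subset_span hv)
  set W := Submodule.span ℝ ((fun ξ : AdSBar n => (ξ : V n)) '' Λ) with hW
  -- the reflection of `y` is both in the span of `Λ` and orthogonal to `Λ` for the form
  have h1 : ∀ ξ ∈ Λ, form (timeReflection y) (ξ : V n) = 0 := by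
    intro ξ hξ
    rw [form_eq_inner_timeReflection, timeReflection_timeReflection, real_inner_comm]
    exact hy' _ (Or.inl ⟨ξ, hξ, rfl⟩)
  have h2 : timeReflection y ∈ W := by
    rw [← Submodule.orthogonal_orthogonal W, Submodule.mem_orthogonal]
    intro z hz
    have h3 : ∀ ξ ∈ Λ, form (timeReflection z) (ξ : V n) = 0 := by
      intro ξ hξ
      rw [form_eq_inner_timeReflection, timeReflection_timeReflection, real_inner_comm]
      exact hz _ (Submodule.subset_span ⟨ξ, hξ, rfl⟩)
    have h4 := hy' _ (Or.inr h3)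
    rwa [← form_eq_inner_timeReflection, form_comm, form_eq_inner_timeReflection,
      real_inner_comm] at h4
  have h5 : ∀ v ∈ W, form v (timeReflection y) = 0 := by
    intro v hv
    refine Submodule.span_induction (p := fun v _ => form v (timeReflection y) = 0) ?_ ?_ ?_ ?_ hv
    · rintro _ ⟨ξ, hξ, rfl⟩
      rw [form_comm]; exact h1 ξ hξ
    · simp [form]
    · intro v w _ _ hv hw
      rw [form_add_left, hv, hw, add_zero]
    · intro c v _ hv
      rw [form_smul_left, hv, mul_zero]
  by_contra hne
  have hne' : timeReflection y ≠ 0 := fun h => hne (by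
    rw [← timeReflection_timeReflection y, h, map_zero])
  exact (hneg _ hne' h1).ne (h5 _ h2)

lemma exists_mul_norm_sq_le_of_orthogonal
    (hneg : ∀ w : V n, w ≠ 0 → (∀ ξ ∈ Λ, form w (ξ : V n) = 0) → form w w < 0) :
    ∃ c : ℝ, 0 < c ∧ ∀ w : V n, (∀ ξ ∈ Λ, form w (ξ : V n) = 0) → c * ‖w‖ ^ 2 ≤ -form w w := by
  have hcl : IsClosed {w : V n | ∀ ξ ∈ Λ, form w (ξ : V n) = 0} := by
    simp only [Set.ofPred_forall]
    exact isClosed_iInter fun ξ => isClosed_iInter fun _ => isClosed_eq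
      (continuous_form.comp (continuous_id.prodMk continuous_const)) continuous_const
  have hc : IsCompact (Metric.sphere (0 : V n) 1 ∩ {w : V n | ∀ ξ ∈ Λ, form w (ξ : V n) = 0}) :=
    (isCompact_sphere 0 1).inter_right hcl
  have hscale : ∀ w : V n, w ≠ 0 → (∀ ξ ∈ Λ, form w (ξ : V n) = 0) →
      ‖w‖⁻¹ • w ∈ Metric.sphere (0 : V n) 1 ∩ {w : V n | ∀ ξ ∈ Λ, form w (ξ : V n) = 0} := by
    intro w hw h
    refine ⟨?_, fun ξ hξ => by rw [form_smul_left, h ξ hξ, mul_zero]⟩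
    simp [norm_smul, inv_mul_cancel₀ (norm_ne_zero_iff.2 hw)]
  rcases (Metric.sphere (0 : V n) 1 ∩
    {w : V n | ∀ ξ ∈ Λ, form w (ξ : V n) = 0}).eq_empty_or_nonempty with he | hne
  · refine ⟨1, one_pos, fun w hw => ?_⟩
    by_cases h0 : w = 0
    · simp [h0, form]
    · have := hscale w h0 hw
      rw [he] at this
      exact absurd this (Set.notMem_empty _)
  · obtain ⟨w₀, h₀, hmin⟩ := hc.exists_isMinOn hne (f := fun w => -form w w)
      ((continuous_form.comp (continuous_id.prodMk continuous_id)).neg).continuousOn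
    have hw₀ : w₀ ≠ 0 := by
      rintro rfl
      simpa using h₀.1
    refine ⟨_, neg_pos.2 (hneg w₀ hw₀ h₀.2), fun w hw => ?_⟩
    by_cases h0 : w = 0
    · simp [h0, form]
    · have h1 : -form w₀ w₀ ≤ -form (‖w‖⁻¹ • w) (‖w‖⁻¹ • w) := hmin (hscale w h0 hw)
      have hn : 0 < ‖w‖ := norm_pos_iff.2 h0
      rw [form_smul_left, form_smul_right] at h1
      calc -form w₀ w₀ * ‖w‖ ^ 2 ≤ -(‖w‖⁻¹ * (‖w‖⁻¹ * form w w)) * ‖w‖ ^ 2 := by gcongr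
        _ = -form w w := by field_simp

/-- A family of matrices that is bounded at each vector of a generating set is bounded. -/
lemma exists_forall_entry_le {ι : Type*} (g : ι → Matrix.SpecialLinearGroup (Fin 2 ⊕ Fin n) ℝ)
    {S : Set (V n)} (hS : Submodule.span ℝ S = ⊤)
    (hb : ∀ v ∈ S, ∃ C : ℝ, ∀ i, ‖act (g i) v‖ ≤ C) :
    ∃ C : ℝ, ∀ i k l, |(g i : Matrix (Fin 2 ⊕ Fin n) (Fin 2 ⊕ Fin n) ℝ) k l| ≤ C := by
  have hall : ∀ v : V n, ∃ C : ℝ, ∀ i, ‖act (g i) v‖ ≤ C := by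
    intro v
    have hv : v ∈ Submodule.span ℝ S := by rw [hS]; trivial
    refine Submodule.span_induction (p := fun v _ => ∃ C : ℝ, ∀ i, ‖act (g i) v‖ ≤ C)
      hb ?_ ?_ ?_ hv
    · exact ⟨0, fun i => by simp [act]⟩
    · rintro v w _ _ ⟨C, hC⟩ ⟨D, hD⟩
      exact ⟨C + D, fun i => by rw [act_add]; exact norm_add_le_of_le (hC i) (hD i)⟩
    · rintro c v _ ⟨C, hC⟩
      refine ⟨‖c‖ * C, fun i => ?_⟩
      rw [act_smul, norm_smul]
      exact mul_le_mul_of_nonneg_left (hC i) (norm_nonneg _)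
  choose C hC using fun l : Fin 2 ⊕ Fin n => hall (EuclideanSpace.single l 1)
  refine ⟨∑ l, |C l|, fun i k l => ?_⟩
  have h1 : (g i : Matrix (Fin 2 ⊕ Fin n) (Fin 2 ⊕ Fin n) ℝ) k l =
      act (g i) (EuclideanSpace.single l 1) k := by
    simp [act, Matrix.toLpLin_apply]
  rw [h1]
  calc |act (g i) (EuclideanSpace.single l 1) k| ≤ ‖act (g i) (EuclideanSpace.single l 1)‖ :=
        PiLp.norm_apply_le (act (g i) (EuclideanSpace.single l 1)) k
    _ ≤ |C l| := (hC l i).trans (le_abs_self _)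
    _ ≤ ∑ l, |C l| := Finset.single_le_sum (f := fun l => |C l|) (fun _ _ => abs_nonneg _)
        (Finset.mem_univ l)

/-- A discrete subgroup of `SO(2, n)` has finitely many elements with bounded entries. -/
lemma finite_setOf_entry_le (Γ : Subgroup (SO2 n)) [DiscreteTopology Γ] (C : ℝ) :
    {g : Γ | ∀ k l, |((g : SO2 n).1 : Matrix (Fin 2 ⊕ Fin n) (Fin 2 ⊕ Fin n) ℝ) k l| ≤ C}.Finite := by
  have hclosed : IsClosed (SO2 n : Set (Matrix.SpecialLinearGroup (Fin 2 ⊕ Fin n) ℝ)) := by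
    have : (SO2 n : Set (Matrix.SpecialLinearGroup (Fin 2 ⊕ Fin n) ℝ)) =
        ⋂ (x : V n) (y : V n), {g | form (act g x) (act g y) = form x y} := by
      ext g
      simp only [Set.mem_iInter]
      exact Iff.rfl
    rw [this]
    have hc : ∀ x : V n, Continuous fun g : Matrix.SpecialLinearGroup (Fin 2 ⊕ Fin n) ℝ => act g x := by
      intro x
      have h1 : ∀ g : Matrix.SpecialLinearGroup (Fin 2 ⊕ Fin n) ℝ, act g x =
          WithLp.toLp 2 (Matrix.mulVec (g : Matrix (Fin 2 ⊕ Fin n) (Fin 2 ⊕ Fin n) ℝ) x.ofLp) :=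
        fun g => rfl
      simp only [h1]
      exact (PiLp.continuous_toLp 2 _).comp
        (Continuous.matrix_mulVec continuous_subtype_val continuous_const)
    exact isClosed_iInter fun x => isClosed_iInter fun y => isClosed_eq
      (continuous_form.comp ((hc x).prodMk (hc y))) continuous_const
  have hemb : IsClosedEmbedding fun g : SO2 n =>
      (g.1 : Matrix (Fin 2 ⊕ Fin n) (Fin 2 ⊕ Fin n) ℝ) :=
    Matrix.SpecialLinearGroup.isClosedEmbedding_val.comp hclosed.isClosedEmbedding_subtypeVal
  have hemb' : IsClosedEmbedding fun g : Γ =>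
      ((g : SO2 n).1 : Matrix (Fin 2 ⊕ Fin n) (Fin 2 ⊕ Fin n) ℝ) :=
    hemb.comp (Subgroup.isClosed_of_discrete (H := Γ)).isClosedEmbedding_subtypeVal
  have hK : IsCompact {M : Matrix (Fin 2 ⊕ Fin n) (Fin 2 ⊕ Fin n) ℝ | ∀ k l, |M k l| ≤ C} := by
    have h1 : {M : Matrix (Fin 2 ⊕ Fin n) (Fin 2 ⊕ Fin n) ℝ | ∀ k l, |M k l| ≤ C} =
        Set.pi Set.univ fun _ => Set.pi Set.univ fun _ => Set.Icc (-C) C := by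
      ext M
      exact ⟨fun h k _ l _ => abs_le.1 (h k l), fun h k l => abs_le.2 (h k trivial l trivial)⟩
    rw [h1]
    exact isCompact_univ_pi fun _ => isCompact_univ_pi fun _ => isCompact_Icc
  exact (hemb'.isCompact_preimage hK).finite_of_discrete

end Proper

/-! ### Properness and the coarse triangle inequality for quasi-Fuchsian groups -/

section QuasiFuchsian

variable {n : ℕ} {Γ : Subgroup (SO2 n)} {Λ : Set (AdSBar n)}

lemma IsQuasiFuchsian.isCompact (hΓ : IsQuasiFuchsian Γ Λ) : IsCompact Λ := by
  obtain ⟨e⟩ := hΓ.sphere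
  have : CompactSpace Λ := e.symm.compactSpace
  exact isCompact_iff_compactSpace.2 this

lemma IsQuasiFuchsian.act_mem_cone (hΓ : IsQuasiFuchsian Γ Λ) (γ : Γ) {v : V n} (hv : v ∈ cone Λ) :
    act γ.1.1 v ∈ cone Λ :=
  AdSGeom.act_mem_cone (hΓ.invariant γ γ.2) hv

lemma coe_smul (γ : Γ) (x : AdS n) : ((γ • x : AdS n) : V n) = act γ.1.1 x := rfl

lemma IsQuasiFuchsian.smul_mem_hull (hΓ : IsQuasiFuchsian Γ Λ) (γ : Γ) {x : AdS n} (hx : x ∈ hull Λ) :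
    γ • x ∈ hull Λ :=
  hΓ.act_mem_cone γ hx

lemma pair_act (γ : Γ) (v w : V n) : pair (act γ.1.1 v) (act γ.1.1 w) = pair v w :=
  pair_act_act γ.1 v w

lemma pair_act_left (γ : Γ) (v w : V n) : pair (act γ.1.1 v) w = pair v (act (γ⁻¹).1.1 w) := by
  rw [pair, form_act_left]; rfl

lemma pair_smul_smul (γ : Γ) (x y : AdS n) : pair ((γ • x : AdS n) : V n) (γ • y : AdS n) = pair (x : V n) y :=
  pair_act γ _ _

lemma IsQuasiFuchsian.pair_pos (hΓ : IsQuasiFuchsian Γ Λ) {x : AdS n} (hx : x ∈ hull Λ) {v : V n}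
    (hv : v ∈ cone Λ) : 0 < pair (x : V n) v :=
  pair_pos_of_mem_hull hΓ.acausal hx hv

/-- The action of `Γ` on `C(Λ)` is proper. If `γ o` stays bounded, so do the vectors `γ ξ` for
`ξ ∈ Λ`, because `-⟨o|γ ξ⟩` controls their norm; and `γ` preserves the orthogonal of `Λ`, on which
the form is negative definite. Hence the entries of `γ` are bounded, and `Γ` is discrete. -/
lemma IsQuasiFuchsian.finite_setOf_pair_le (hΓ : IsQuasiFuchsian Γ Λ) {o : AdS n} (ho : o ∈ hull Λ)
    (T : ℝ) : {γ : Γ | pair ((γ • o : AdS n) : V n) o ≤ T}.Finite := by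
  have := hΓ.discrete
  have hneg : ∀ w : V n, w ≠ 0 → (∀ ξ ∈ Λ, form w (ξ : V n) = 0) → form w w < 0 :=
    fun w hw h => form_self_neg_of_orthogonal hΓ.acausal hΓ.sphere ho hw h
  obtain ⟨c, hc, hcle⟩ := exists_mul_norm_sq_le_of_orthogonal hneg
  obtain ⟨m, hm, hmle⟩ := exists_mul_norm_le_pair hΓ.acausal hΓ.isCompact
    (isCompact_singleton (x := o)) (Set.singleton_subset_iff.2 ho)
  have hmle' : ∀ v ∈ cone Λ, ‖v‖ ≤ pair (o : V n) v / m := fun v hv => by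
    rw [le_div_iff₀ hm, mul_comm]; exact hmle o rfl v hv
  obtain ⟨C, hC⟩ := exists_forall_entry_le
    (fun γ : {γ : Γ | pair ((γ • o : AdS n) : V n) o ≤ T} => γ.1.1.1) (span_sup_eq_top hneg) (by
    rintro v (⟨ξ, hξ, rfl⟩ | hv)
    · refine ⟨(‖(ξ : V n)‖ * (T / m)) / m, fun ⟨γ, hγ⟩ => ?_⟩
      have h1 := hmle' _ (hΓ.act_mem_cone γ (coe_mem_cone hξ))
      have h2 : ‖act (γ⁻¹).1.1 (o : V n)‖ ≤ T / m := by
        refine (hmle' _ (hΓ.act_mem_cone γ⁻¹ ho)).trans ?_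
        rw [← pair_act_left]
        gcongr
        exact hγ
      refine h1.trans ?_
      rw [pair_comm, pair_act_left]
      gcongr
      exact (pair_le _ _).trans (by gcongr)
    · refine ⟨√(-form v v / c), fun ⟨γ, hγ⟩ => Real.le_sqrt_of_sq_le ?_⟩
      rw [le_div_iff₀ hc, mul_comm]
      refine (hcle _ fun ξ hξ => ?_).trans_eq (by rw [γ.1.2])
      rw [form_act_left]
      have h1 := act_eq_norm_smul (γ⁻¹).1 ξ
      have h2 : act γ.1.1⁻¹ (ξ : V n) = act (γ⁻¹).1.1 (ξ : V n) := rfl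
      rw [h2, h1, form_smul_right, hv _ (hΓ.invariant _ (γ⁻¹).2 ξ hξ), mul_zero])
  exact (finite_setOf_entry_le Γ C).subset fun γ hγ k l => hC ⟨γ, hγ⟩ k l

/-- A constant for which `-⟨·|·⟩` satisfies a multiplicative triangle inequality with vertex in
`C(Λ)`, and for which the orbit of `o` is coarsely dense in `C(Λ)`. -/
structure IsCoarseConst (Γ : Subgroup (SO2 n)) (Λ : Set (AdSBar n)) (o : AdS n) (C : ℝ) : Prop where
  one_le : 1 ≤ C
  triangle : ∀ v ∈ cone Λ, ∀ w ∈ cone Λ, ∀ z ∈ hull Λ, pair v w ≤ C * (pair v z * pair z w)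
  dense : ∀ x ∈ hull Λ, ∃ γ : Γ, pair ((γ • o : AdS n) : V n) x ≤ C

/-- By cocompactness, it suffices to know the triangle inequality with vertex in a compact part of
`C(Λ)`, where `-⟨z|v⟩` is equivalent to the norm of `v`. -/
lemma IsQuasiFuchsian.exists_isCoarseConst (hΓ : IsQuasiFuchsian Γ Λ) (o : AdS n) :
    ∃ C, IsCoarseConst Γ Λ o C := by
  obtain ⟨K, hK, hKΛ, hcov⟩ := hΓ.cocompact
  obtain ⟨c, hc, hcle⟩ := exists_mul_norm_le_pair hΓ.acausal hΓ.isCompact hK hKΛ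
  obtain ⟨M, hM⟩ := hK.exists_bound_of_continuousOn (f := fun x : AdS n => (x : V n))
    continuous_subtype_val.continuousOn
  refine ⟨max 1 (max (c⁻¹ * c⁻¹) (‖(o : V n)‖ * M)), le_max_left _ _, ?_, ?_⟩
  · intro v hv w hw z hz
    obtain ⟨g, hg, y, hy, rfl⟩ := hcov z hz
    let γ : Γ := ⟨g, hg⟩
    have hk : ∀ v ∈ cone Λ, ‖act (γ⁻¹).1.1 v‖ ≤ c⁻¹ * pair v (g • y : AdS n) := by
      intro v hv
      have h1 := hcle y hy _ (hΓ.act_mem_cone γ⁻¹ hv)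
      have h2 : pair v (g • y : AdS n) = pair (y : V n) (act (γ⁻¹).1.1 v) := by
        rw [pair_comm, ← pair_act_left]; rfl
      rw [h2, inv_mul_eq_div, le_div_iff₀ hc, mul_comm]
      exact h1
    have hpos : ∀ v ∈ cone Λ, 0 < pair v (g • y : AdS n) := fun v hv => by
      rw [pair_comm]; exact hΓ.pair_pos hz hv
    calc pair v w = pair (act (γ⁻¹).1.1 v) (act (γ⁻¹).1.1 w) := (pair_act _ _ _).symm
      _ ≤ ‖act (γ⁻¹).1.1 v‖ * ‖act (γ⁻¹).1.1 w‖ := pair_le _ _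
      _ ≤ (c⁻¹ * pair v (g • y : AdS n)) * (c⁻¹ * pair w (g • y : AdS n)) := by
        have := hpos v hv
        gcongr
        · exact hk v hv
        · exact hk w hw
      _ = (c⁻¹ * c⁻¹) * (pair v (g • y : AdS n) * pair ((g • y : AdS n) : V n) w) := by
        rw [pair_comm w]; ring
      _ ≤ _ := by
        have := hpos v hv
        have := hΓ.pair_pos hz hw
        gcongr
        exact (le_max_left _ _).trans (le_max_right _ _)
  · intro x hx
    obtain ⟨g, hg, y, hy, rfl⟩ := hcov x hx
    refine ⟨⟨g, hg⟩, ?_⟩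
    have h1 : pair ((((⟨g, hg⟩ : Γ) • o : AdS n)) : V n) (g • y : AdS n) = pair (o : V n) y :=
      pair_smul_smul ⟨g, hg⟩ o y
    rw [h1]
    refine (pair_le _ _).trans (le_trans ?_ ((le_max_right _ _).trans (le_max_right _ _)))
    gcongr
    exact hM y hy

variable {o : AdS n} {C : ℝ}

lemma IsCoarseConst.pos (hC : IsCoarseConst Γ Λ o C) : 0 < C := one_pos.trans_le hC.one_le

/-! ### Geodesic splitting and growth of the orbits -/

/-- The spacelike segment from `x` to `y` lies in `C(Λ)`; it contains a point `z` at any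
prescribed distance from `x`, and `⟨x|z⟩ ⟨z|y⟩ ≤ |⟨x|y⟩|` on it. -/
lemma exists_mem_hull_pair_eq {x y : AdS n} (hx : x ∈ hull Λ) (hy : y ∈ hull Λ) {τ : ℝ}
    (h1 : 1 ≤ τ) (h2 : τ ≤ pair (x : V n) y) :
    ∃ z ∈ hull Λ, pair (x : V n) z = τ ∧ τ * pair (z : V n) y ≤ pair (x : V n) y := by
  rcases h1.eq_or_lt with rfl | h1
  · exact ⟨x, hx, pair_self x, by rw [one_mul]⟩
  rcases h2.eq_or_lt with rfl | h2
  · exact ⟨y, hy, rfl, by rw [pair_self, mul_one]⟩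
  set c := pair (x : V n) y with hc
  have hc1 : 0 < c ^ 2 - 1 := by nlinarith
  set β := √((τ ^ 2 - 1) / (c ^ 2 - 1)) with hβ
  have hτ1 : 0 < τ ^ 2 - 1 := by nlinarith
  have hβ0 : 0 < β := Real.sqrt_pos.2 (by positivity)
  have hβ2 : β ^ 2 * (c ^ 2 - 1) = τ ^ 2 - 1 := by
    rw [hβ, Real.sq_sqrt (by positivity)]; field_simp
  have hα0 : 0 < τ - β * c := by
    have : (β * c) ^ 2 < τ ^ 2 := by nlinarith
    have := abs_lt_of_sq_lt_sq this (by linarith)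
    linarith [le_abs_self (β * c)]
  set α := τ - β * c with hα
  have hq : α ^ 2 + β ^ 2 + 2 * α * β * c = 1 := by rw [hα]; linarith
  have hyx : pair (y : V n) x = c := by rw [hc, pair_comm]
  have hz : form (α • (x : V n) + β • (y : V n)) (α • (x : V n) + β • (y : V n)) = -1 := by
    have : pair (α • (x : V n) + β • (y : V n)) (α • (x : V n) + β • (y : V n)) = 1 := by
      simp only [pair_add_left, pair_add_right, pair_smul_left, pair_smul_right, pair_self, hyx, ← hc]
      linarith
    rw [pair] at this
    linarith
  refine ⟨⟨_, hz⟩, add_mem_cone (smul_mem_cone hα0 hx) (smul_mem_cone hβ0 hy), ?_, ?_⟩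
  · simp only [pair_add_right, pair_smul_right, pair_self, ← hc]
    rw [hα]; ring
  · simp only [pair_add_left, pair_smul_left, pair_self, ← hc]
    have h3 : τ = α + β * c := by rw [hα]; ring
    have h4 : 0 ≤ α * β * (c ^ 2 - 1) := by positivity
    rw [h3]
    nlinarith

/-- The number of points of the orbit of `o` in the ball `-⟨·|o⟩ ≤ T`. -/
noncomputable def orbitCount (Γ : Subgroup (SO2 n)) (o : AdS n) (T : ℝ) : ℕ :=
  {γ : Γ | pair ((γ • o : AdS n) : V n) o ≤ T}.ncard

lemma IsQuasiFuchsian.orbitCount_mono (hΓ : IsQuasiFuchsian Γ Λ) (ho : o ∈ hull Λ) :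
    Monotone (orbitCount Γ o) := fun _ T hST =>
  Set.ncard_le_ncard (fun _ hγ => le_trans hγ hST) (hΓ.finite_setOf_pair_le ho T)

lemma IsQuasiFuchsian.one_le_orbitCount (hΓ : IsQuasiFuchsian Γ Λ) (ho : o ∈ hull Λ) {T : ℝ} (hT : 1 ≤ T) :
    1 ≤ orbitCount Γ o T := by
  refine (Set.ncard_pos (hΓ.finite_setOf_pair_le ho T)).2 ⟨1, ?_⟩
  change pair (((1 : Γ) • o : AdS n) : V n) o ≤ T
  rwa [one_smul, pair_self]

/-- Submultiplicativity of the orbital growth: cut the segment from `o` to `γ o` and move the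
cutting point to a nearby point of the orbit. -/
lemma IsQuasiFuchsian.orbitCount_mul_le (hΓ : IsQuasiFuchsian Γ Λ) (ho : o ∈ hull Λ)
    (hC : IsCoarseConst Γ Λ o C) {S T : ℝ} (hS : 1 ≤ S) (hT : 1 ≤ T) :
    orbitCount Γ o (S * T) ≤ orbitCount Γ o (C ^ 2 * S) * orbitCount Γ o (C ^ 2 * T) := by
  have hC2 : 1 ≤ C ^ 2 := one_le_pow₀ hC.one_le
  have key : ∀ γ : Γ, pair ((γ • o : AdS n) : V n) o ≤ S * T → ∃ γ' : Γ,
      pair ((γ' • o : AdS n) : V n) o ≤ C ^ 2 * S ∧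
      pair (((γ'⁻¹ * γ) • o : AdS n) : V n) o ≤ C ^ 2 * T := by
    intro γ hγ
    rcases le_total (pair ((γ • o : AdS n) : V n) o) S with hle | hle
    · refine ⟨γ, hle.trans (le_mul_of_one_le_left (by linarith) hC2), ?_⟩
      rw [inv_mul_cancel, one_smul, pair_self]
      exact hT.trans (le_mul_of_one_le_left (by linarith) hC2)
    · obtain ⟨z, hz, hz1, hz2⟩ := exists_mem_hull_pair_eq ho (hΓ.smul_mem_hull γ ho) hS
        (by rwa [pair_comm])
      obtain ⟨γ', hγ'⟩ := hC.dense z hz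
      have hzT : pair (z : V n) (γ • o : AdS n) ≤ T := by
        rw [pair_comm] at hγ
        exact le_of_mul_le_mul_left (hz2.trans hγ) (by linarith)
      have hC0 := hC.pos
      have hp1 := hΓ.pair_pos hz (hΓ.act_mem_cone γ ho)
      refine ⟨γ', ?_, ?_⟩
      · refine (hC.triangle _ (hΓ.smul_mem_hull γ' ho) _ ho z hz).trans ?_
        rw [pair_comm (z : V n), hz1, pow_two, mul_assoc]
        gcongr
      · rw [pair_comm, ← pair_smul_smul γ', smul_smul, mul_inv_cancel_left]
        refine (hC.triangle _ (hΓ.smul_mem_hull γ' ho) _ (hΓ.smul_mem_hull γ ho) z hz).trans ?_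
        rw [pow_two, mul_assoc]
        gcongr
  choose! f hf1 hf2 using key
  rw [orbitCount, orbitCount, orbitCount, ← Set.ncard_prod]
  refine Set.ncard_le_ncard_of_injOn (fun γ => (f γ, (f γ)⁻¹ * γ))
    (fun γ hγ => ⟨hf1 γ hγ, hf2 γ hγ⟩) (fun γ _ γ' _ h => ?_)
    ((hΓ.finite_setOf_pair_le ho _).prod (hΓ.finite_setOf_pair_le ho _))
  have h1 : f γ = f γ' := congrArg Prod.fst h
  have h2 : (f γ)⁻¹ * γ = (f γ')⁻¹ * γ' := congrArg Prod.snd h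
  rw [h1] at h2
  exact mul_left_cancel h2

/-- Fekete's lemma for the orbital growth: there is an exponent `δ ≥ 0` with
`c T ^ δ ≤ N(T) ≤ C_ε T ^ (δ + ε)`. -/
lemma exists_growth_exponent {A : ℝ → ℕ} (hA : Monotone A) (hA1 : ∀ T, 1 ≤ T → 1 ≤ A T) {κ : ℝ}
    (hκ : 1 ≤ κ) (hmul : ∀ S T, 1 ≤ S → 1 ≤ T → A (S * T) ≤ A (κ * S) * A (κ * T)) :
    ∃ δ : ℝ, 0 ≤ δ ∧ (∃ c > 0, ∀ T, 1 ≤ T → c * T ^ δ ≤ A T) ∧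
      ∀ ε > 0, ∃ c > 0, ∀ T, 1 ≤ T → A T ≤ c * T ^ (δ + ε) := by
  -- the factor `κ ^ 2` makes the sequence exactly subadditive
  set u : ℕ → ℝ := fun m => Real.log (A (κ ^ 2 * Real.exp m)) with hu
  have hκ2 : 1 ≤ κ ^ 2 := one_le_pow₀ hκ
  have hκ0 : 0 < κ := one_pos.trans_le hκ
  have hexp : ∀ m : ℕ, 1 ≤ Real.exp m := fun m => Real.one_le_exp (Nat.cast_nonneg m)
  have hge : ∀ m : ℕ, 1 ≤ κ ^ 2 * Real.exp m := fun m => one_le_mul_of_one_le_of_one_le hκ2 (hexp m)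
  have hAr : ∀ T, 1 ≤ T → (1 : ℝ) ≤ A T := fun T hT => by exact_mod_cast hA1 T hT
  have hu0 : ∀ m, 0 ≤ u m := fun m => Real.log_nonneg (hAr _ (hge m))
  have hsub : Subadditive u := by
    intro m k
    have h1 : κ ^ 2 * Real.exp ((m + k : ℕ) : ℝ) = (κ * Real.exp m) * (κ * Real.exp k) := by
      push_cast
      rw [Real.exp_add]; ring
    have h2 := hmul (κ * Real.exp m) (κ * Real.exp k) (one_le_mul_of_one_le_of_one_le hκ (hexp m))
      (one_le_mul_of_one_le_of_one_le hκ (hexp k))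
    rw [← h1, ← mul_assoc, ← mul_assoc, ← pow_two] at h2
    have hm := hAr _ (hge m)
    have hk := hAr _ (hge k)
    have hmk := hAr _ (hge (m + k))
    change Real.log _ ≤ Real.log _ + Real.log _
    rw [← Real.log_mul (by positivity) (by positivity)]
    exact Real.log_le_log (by positivity) (by exact_mod_cast h2)
  have hbdd : BddBelow (Set.range fun m => u m / m) :=
    ⟨0, by rintro _ ⟨m, rfl⟩; exact div_nonneg (hu0 m) (Nat.cast_nonneg m)⟩
  have hlim := hsub.tendsto_lim hbdd
  set δ := hsub.lim with hδ
  have hδ0 : 0 ≤ δ := ge_of_tendsto' hlim fun m => div_nonneg (hu0 m) (Nat.cast_nonneg m)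
  have hlow : ∀ m : ℕ, Real.exp (δ * m) ≤ A (κ ^ 2 * Real.exp m) := by
    intro m
    rcases Nat.eq_zero_or_pos m with rfl | hm
    · simpa using hAr _ (hge 0)
    · have h1 := hsub.lim_le_div hbdd hm.ne'
      rw [le_div_iff₀ (by positivity)] at h1
      have h3 := hAr _ (hge m)
      rwa [← Real.le_log_iff_exp_le (by linarith)]
  refine ⟨δ, hδ0, ⟨(κ ^ 2 * Real.exp 1) ^ (-δ), by positivity, fun T hT => ?_⟩, fun ε hε => ?_⟩
  · have hT0 : 0 < T := by linarith
    rw [Real.rpow_neg (by positivity), ← Real.inv_rpow (by positivity),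
      ← Real.mul_rpow (by positivity) hT0.le]
    rcases le_total T (κ ^ 2) with hle | hle
    · refine le_trans (Real.rpow_le_one (by positivity) ?_ hδ0) (hAr T hT)
      rw [inv_mul_le_iff₀ (by positivity), mul_one]
      exact hle.trans (le_mul_of_one_le_right (by positivity) (Real.one_le_exp zero_le_one))
    · have hlog : 0 ≤ Real.log (T / κ ^ 2) := Real.log_nonneg (by rwa [le_div_iff₀ (by positivity), one_mul])
      set m := ⌊Real.log (T / κ ^ 2)⌋₊
      have hm1 : (m : ℝ) ≤ Real.log (T / κ ^ 2) := Nat.floor_le hlog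
      have hm2 : Real.log (T / κ ^ 2) < m + 1 := Nat.lt_floor_add_one _
      have h1 : κ ^ 2 * Real.exp m ≤ T := by
        have := (Real.le_log_iff_exp_le (by positivity)).1 hm1
        rwa [le_div_iff₀ (by positivity), mul_comm] at this
      have h2 : (κ ^ 2 * Real.exp 1)⁻¹ * T ≤ Real.exp m := by
        have := (Real.log_lt_iff_lt_exp (by positivity)).1 hm2
        rw [Real.exp_add, div_lt_iff₀ (by positivity)] at this
        rw [inv_mul_le_iff₀ (by positivity)]
        linarith
      calc ((κ ^ 2 * Real.exp 1)⁻¹ * T) ^ δ ≤ (Real.exp m) ^ δ :=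
            Real.rpow_le_rpow (by positivity) h2 hδ0
        _ = Real.exp (δ * m) := by rw [← Real.exp_mul, mul_comm]
        _ ≤ A (κ ^ 2 * Real.exp m) := hlow m
        _ ≤ A T := by exact_mod_cast hA h1
  · have hev : ∀ᶠ m : ℕ in atTop, u m / m < δ + ε := hlim.eventually (gt_mem_nhds (by linarith))
    obtain ⟨m₀, hm₀⟩ := eventually_atTop.1 (hev.and (eventually_ge_atTop 1))
    set D : ℝ := ((A (κ ^ 2 * Real.exp m₀) : ℕ) : ℝ) with hD
    have hD1 : 1 ≤ D := hAr _ (hge m₀)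
    have hup : ∀ m : ℕ, A (κ ^ 2 * Real.exp m) ≤ D * Real.exp ((δ + ε) * m) := by
      intro m
      have hE : 1 ≤ Real.exp ((δ + ε) * m) := Real.one_le_exp (by positivity)
      rcases le_total m m₀ with hle | hle
      · have h1 : (A (κ ^ 2 * Real.exp m) : ℝ) ≤ D := by
          have : κ ^ 2 * Real.exp m ≤ κ ^ 2 * Real.exp m₀ := by gcongr
          rw [hD]
          exact_mod_cast hA this
        exact h1.trans (le_mul_of_one_le_right (by linarith) hE)
      · obtain ⟨h1, hm⟩ := hm₀ m hle
        have h2 : u m ≤ (δ + ε) * m := by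
          rw [div_lt_iff₀ (by positivity)] at h1
          exact h1.le
        have h3 := hAr _ (hge m)
        refine le_trans ((Real.log_le_iff_le_exp (by linarith)).1 h2) ?_
        exact le_mul_of_one_le_left (by positivity) hD1
    refine ⟨D * Real.exp (δ + ε), by positivity, fun T hT => ?_⟩
    have hT0 : 0 < T := by linarith
    set m := ⌈Real.log T⌉₊
    have hm1 : Real.log T ≤ m := Nat.le_ceil _
    have hm2 : (m : ℝ) < Real.log T + 1 := Nat.ceil_lt_add_one (Real.log_nonneg hT)
    have h1 : T ≤ κ ^ 2 * Real.exp m :=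
      ((Real.log_le_iff_le_exp hT0).1 hm1).trans (le_mul_of_one_le_left (by positivity) hκ2)
    calc (A T : ℝ) ≤ A (κ ^ 2 * Real.exp m) := by exact_mod_cast hA h1
      _ ≤ D * Real.exp ((δ + ε) * m) := hup m
      _ ≤ D * Real.exp ((δ + ε) * (Real.log T + 1)) := by gcongr
      _ = D * Real.exp (δ + ε) * T ^ (δ + ε) := by
        rw [Real.rpow_def_of_pos hT0, mul_assoc, ← Real.exp_add]
        ring_nf

end QuasiFuchsian

/-! ### The critical exponent and the Poincaré series -/

section Distance

variable {n : ℕ}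

lemma lorentzDist_eq_arcosh_max (x y : AdS n) :
    lorentzDist x y = Real.arcosh (max 1 (pair (x : V n) y)) := by
  rw [lorentzDist_eq]
  split_ifs with h
  · rw [max_eq_right (by rw [pair]; linarith)]; rfl
  · rw [max_eq_left (by rw [pair]; linarith), Real.arcosh_zero]

lemma lorentzDist_nonneg (x y : AdS n) : 0 ≤ lorentzDist x y := by
  rw [lorentzDist_eq_arcosh_max]; exact Real.arcosh_nonneg (le_max_left _ _)

lemma lorentzDist_comm (x y : AdS n) : lorentzDist x y = lorentzDist y x := by
  rw [lorentzDist_eq_arcosh_max, lorentzDist_eq_arcosh_max, pair_comm]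

lemma lorentzDist_smul_smul {Γ : Subgroup (SO2 n)} (γ : Γ) (x y : AdS n) :
    lorentzDist (γ • x) (γ • y) = lorentzDist x y := by
  rw [lorentzDist_eq_arcosh_max, lorentzDist_eq_arcosh_max, pair_smul_smul]

lemma arcosh_eq_log_add {c : ℝ} (hc : 1 ≤ c) :
    Real.arcosh c = Real.log c + Real.log (1 + √(1 - (c ^ 2)⁻¹)) := by
  have h0 : 0 < c := by linarith
  rw [← Real.log_mul (by positivity) (by positivity), Real.arcosh]
  congr 1
  rw [mul_add, mul_one]
  congr 1
  nth_rw 2 [← Real.sqrt_sq h0.le]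
  rw [← Real.sqrt_mul (by positivity)]
  congr 1
  field_simp

lemma log_le_arcosh {c : ℝ} (hc : 1 ≤ c) : Real.log c ≤ Real.arcosh c := by
  rw [arcosh_eq_log_add hc]
  have := Real.log_nonneg (le_add_of_nonneg_right (Real.sqrt_nonneg (1 - (c ^ 2)⁻¹)) : (1 : ℝ) ≤ _)
  linarith

lemma arcosh_le_log_two_mul {c : ℝ} (hc : 1 ≤ c) : Real.arcosh c ≤ Real.log (2 * c) := by
  rw [arcosh_eq_log_add hc, Real.log_mul two_ne_zero (by linarith), add_comm]
  gcongr
  have : √(1 - (c ^ 2)⁻¹) ≤ 1 := Real.sqrt_le_one.2 (by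
    have : 0 ≤ (c ^ 2)⁻¹ := by positivity
    linarith)
  linarith

lemma pair_le_exp_of_lorentzDist_le {x y : AdS n} {R : ℝ} (h : lorentzDist x y ≤ R) :
    pair (x : V n) y ≤ Real.exp R := by
  rw [lorentzDist_eq_arcosh_max] at h
  have h1 := (log_le_arcosh (le_max_left 1 (pair (x : V n) y))).trans h
  exact (le_max_right _ _).trans ((Real.log_le_iff_le_exp (by positivity)).1 h1)

lemma lorentzDist_le_of_pair_le {x y : AdS n} {R : ℝ} (hR : Real.log 2 ≤ R)
    (h : pair (x : V n) y ≤ 2⁻¹ * Real.exp R) : lorentzDist x y ≤ R := by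
  rw [lorentzDist_eq_arcosh_max]
  refine (arcosh_le_log_two_mul (le_max_left _ _)).trans ?_
  rw [Real.log_le_iff_le_exp (by positivity)]
  have h2 : 2 ≤ Real.exp R := (Real.log_le_iff_le_exp two_pos).1 hR
  have : max 1 (pair (x : V n) y) ≤ 2⁻¹ * Real.exp R := max_le (by linarith) h
  linarith

end Distance

section Counting

/-- The exponential growth rate of a function squeezed between powers of `exp R`. -/
lemma tendsto_log_div_of_growth {N : ℝ → ℝ} {δ c R₀ : ℝ} (hc : 0 < c)
    (hlow : ∀ R ≥ R₀, c * Real.exp (δ * R) ≤ N R)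
    (hup : ∀ ε > 0, ∃ c' > 0, ∀ R ≥ R₀, N R ≤ c' * Real.exp ((δ + ε) * R)) :
    Tendsto (fun R => Real.log (N R) / R) atTop (𝓝 δ) := by
  have hlim : ∀ a b : ℝ, Tendsto (fun R : ℝ => a / R + b) atTop (𝓝 b) := fun a b => by
    have := (tendsto_const_nhds (x := a)).div_atTop (tendsto_id (α := ℝ) (x := atTop))
    simpa using this.add_const b
  rw [tendsto_order]
  constructor
  · intro l hl
    filter_upwards [(hlim (Real.log c) δ).eventually (lt_mem_nhds hl), eventually_gt_atTop 0,
      eventually_ge_atTop R₀] with R h1 hR hR₀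
    refine h1.trans_le ?_
    have h2 := Real.log_le_log (by positivity) (hlow R hR₀)
    rw [Real.log_mul hc.ne' (Real.exp_pos _).ne', Real.log_exp] at h2
    rw [le_div_iff₀ hR, add_mul, div_mul_cancel₀ _ hR.ne']
    exact h2
  · intro u hu
    obtain ⟨c', hc', h⟩ := hup ((u - δ) / 2) (by linarith)
    filter_upwards [(hlim (Real.log c') (δ + (u - δ) / 2)).eventually
        (gt_mem_nhds (show δ + (u - δ) / 2 < u by linarith)),
      eventually_gt_atTop 0, eventually_ge_atTop R₀] with R h1 hR hR₀
    refine lt_of_le_of_lt ?_ h1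
    have hN : 0 < N R := lt_of_lt_of_le (by positivity) (hlow R hR₀)
    have h2 := Real.log_le_log hN (h R hR₀)
    rw [Real.log_mul hc'.ne' (Real.exp_pos _).ne', Real.log_exp] at h2
    rw [div_le_iff₀ hR, add_mul, div_mul_cancel₀ _ hR.ne']
    exact h2

variable {ι : Type*} {d : ι → ℝ}

/-- A Dirichlet series converges beyond the exponent of growth. -/
lemma tsum_exp_neg_mul_ne_top (hd : ∀ i, 0 ≤ d i) (hfin : ∀ R, {i | d i ≤ R}.Finite) {s t c : ℝ}
    (hs : 0 ≤ s) (hts : t < s) (hcount : ∀ R, 1 ≤ R → ({i | d i ≤ R}.ncard : ℝ) ≤ c * Real.exp (t * R)) :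
    ∑' i, ENNReal.ofReal (Real.exp (-s * d i)) ≠ ⊤ := by
  -- group the indices according to the integral part of `d i`
  let a : ι → ℕ → ℝ≥0∞ := fun i m =>
    {i | d i ≤ m + 1}.indicator (fun _ => ENNReal.ofReal (Real.exp (-s * m))) i
  have h1 : ∀ i, ENNReal.ofReal (Real.exp (-s * d i)) ≤ ∑' m, a i m := by
    intro i
    refine le_trans ?_ (ENNReal.le_tsum ⌊d i⌋₊)
    have hi : i ∈ {i | d i ≤ (⌊d i⌋₊ : ℝ) + 1} := (Nat.lt_floor_add_one (d i)).le
    simp only [a]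
    rw [Set.indicator_of_mem (by exact (Nat.lt_floor_add_one (d i)).le)]
    refine ENNReal.ofReal_le_ofReal (Real.exp_le_exp.2 ?_)
    have := Nat.floor_le (hd i)
    nlinarith
  have h2 : ∀ m : ℕ, ∑' i, a i m ≤ ENNReal.ofReal (c * Real.exp t * Real.exp ((t - s) * m)) := by
    intro m
    have hS := hfin (m + 1)
    have h3 : ∑' i, a i m = ({i | d i ≤ (m : ℝ) + 1}.ncard : ℝ≥0∞) * ENNReal.ofReal (Real.exp (-s * m)) := by
      simp only [a]
      rw [← tsum_subtype, ENNReal.tsum_const]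
      congr 1
      rw [← Set.encard, hS.cast_ncard_eq.symm]
      simp
    rw [h3, ← ENNReal.ofReal_natCast, ← ENNReal.ofReal_mul (by positivity)]
    refine ENNReal.ofReal_le_ofReal ?_
    calc _ ≤ c * Real.exp (t * (m + 1)) * Real.exp (-s * m) := by
          gcongr
          exact hcount (m + 1) (by linarith [Nat.cast_nonneg (α := ℝ) m])
      _ = c * Real.exp t * Real.exp ((t - s) * m) := by
          rw [mul_assoc, mul_assoc, ← Real.exp_add, ← Real.exp_add]; ring_nf
  have h4 : ∑' i, ENNReal.ofReal (Real.exp (-s * d i)) ≤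
      ∑' m : ℕ, ENNReal.ofReal (c * Real.exp t * Real.exp ((t - s) * m)) :=
    (ENNReal.tsum_le_tsum h1).trans ((ENNReal.tsum_comm).trans_le (ENNReal.tsum_le_tsum h2))
  have hc : 0 ≤ c := by
    have := (Nat.cast_nonneg _).trans (hcount 1 le_rfl)
    exact nonneg_of_mul_nonneg_left this (Real.exp_pos _)
  have hsum : Summable fun m : ℕ => c * Real.exp t * Real.exp ((t - s) * m) := by
    refine Summable.mul_left _ ?_
    have : ∀ m : ℕ, Real.exp ((t - s) * m) = Real.exp (t - s) ^ m := fun m => by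
      rw [← Real.exp_nat_mul, mul_comm]
    simp only [this]
    exact summable_geometric_of_lt_one (Real.exp_pos _).le (Real.exp_lt_one_iff.2 (by linarith))
  exact ne_top_of_le_ne_top hsum.tsum_ofReal_ne_top h4

/-- A Dirichlet series diverges at `δ` if the number of its exponents below `R` is at least
`c exp (δ R)`: otherwise all but finitely many terms would contribute little to this number. -/
lemma tsum_exp_neg_mul_eq_top [Infinite ι] (hfin : ∀ R, {i | d i ≤ R}.Finite)
    {δ c R₀ : ℝ} (hδ : 0 ≤ δ) (hc : 0 < c)
    (hcount : ∀ R ≥ R₀, c * Real.exp (δ * R) ≤ {i | d i ≤ R}.ncard) :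
    ∑' i, ENNReal.ofReal (Real.exp (-δ * d i)) = ⊤ := by
  classical
  rcases hδ.eq_or_lt with rfl | hδ
  · simp
  by_contra hne
  have hsum : Summable fun i => Real.exp (-δ * d i) := by
    have := ENNReal.summable_toReal hne
    simpa [ENNReal.toReal_ofReal (Real.exp_pos _).le] using this
  obtain ⟨F, hF⟩ := summable_iff_vanishing_norm.1 hsum (c / 2) (by positivity)
  have hbound : ∀ R ≥ R₀, c / 2 * Real.exp (δ * R) ≤ F.card := by
    intro R hR
    set S := (hfin R).toFinset with hS
    have h1 : ({i | d i ≤ R}.ncard : ℝ) = S.card := by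
      rw [Set.ncard_eq_toFinset_card _ (hfin R)]
    have h2 : (S.card : ℝ) ≤ F.card + (S \ F).card := by
      have := Finset.card_le_card (Finset.subset_union_right (s₁ := F) (s₂ := S))
      rw [← Finset.union_sdiff_self_eq_union] at this
      exact_mod_cast this.trans (Finset.card_union_le _ _)
    have h3 : ((S \ F).card : ℝ) * Real.exp (-δ * R) ≤ ∑ i ∈ S \ F, Real.exp (-δ * d i) := by
      rw [← nsmul_eq_mul]
      refine Finset.card_nsmul_le_sum _ _ _ fun i hi => Real.exp_le_exp.2 ?_
      have : d i ≤ R := by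
        have := (Finset.mem_sdiff.1 hi).1
        simpa [hS] using this
      nlinarith
    have h4 : ∑ i ∈ S \ F, Real.exp (-δ * d i) ≤ c / 2 :=
      (le_abs_self _).trans (hF (S \ F) Finset.sdiff_disjoint).le
    have h5 : ((S \ F).card : ℝ) ≤ c / 2 * Real.exp (δ * R) := by
      have h6 := h3.trans h4
      rw [neg_mul, Real.exp_neg] at h6
      rwa [← div_eq_mul_inv, div_le_iff₀ (Real.exp_pos _)] at h6
    have := hcount R hR
    rw [h1] at this
    linarith
  have htend : Tendsto (fun R : ℝ => c / 2 * Real.exp (δ * R)) atTop atTop :=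
    (Real.tendsto_exp_atTop.comp (tendsto_id.const_mul_atTop hδ)).const_mul_atTop (by positivity)
  obtain ⟨R, hR1, hR2⟩ := ((htend.eventually (eventually_gt_atTop (F.card : ℝ))).and
    (eventually_ge_atTop R₀)).exists
  linarith [hbound R hR2]

end Counting

section QuasiFuchsian

variable {n : ℕ} {Γ : Subgroup (SO2 n)} {Λ : Set (AdSBar n)} {o : AdS n} {C : ℝ}

/-- The point `e^t w + e^{-t} v` of the spacelike geodesic between the isotropic vectors `v`
and `w`, normalized by `-⟨v|w⟩ = 1 / 2`. -/
noncomputable def geodesicPoint (v w : V n) (hv : form v v = 0) (hw : form w w = 0)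
    (hvw : pair v w = 1 / 2) (t : ℝ) : AdS n :=
  ⟨Real.exp t • w + Real.exp (-t) • v, by
    have h1 : form v w = -(1 / 2) := by rw [pair] at hvw; linarith
    have h2 : Real.exp t * Real.exp (-t) = 1 := by rw [← Real.exp_add, add_neg_cancel, Real.exp_zero]
    simp only [form_add_left, form_add_right, form_smul_left, form_smul_right, hv, hw,
      form_comm w v, h1]
    linear_combination (-1 : ℝ) * h2⟩

lemma geodesicPoint_mem_hull {v w : V n} (hv : form v v = 0) (hw : form w w = 0)
    (hvw : pair v w = 1 / 2) (hvΛ : v ∈ cone Λ) (hwΛ : w ∈ cone Λ) (t : ℝ) :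
    geodesicPoint v w hv hw hvw t ∈ hull Λ :=
  add_mem_cone (smul_mem_cone (Real.exp_pos _) hwΛ) (smul_mem_cone (Real.exp_pos _) hvΛ)

/-- Every point of `Λ` is the end of a geodesic of `C(Λ)` with both ends in `Λ`. -/
lemma IsQuasiFuchsian.exists_isotropic_partner (hΓ : IsQuasiFuchsian Γ Λ) (ho : o ∈ hull Λ)
    {ξ : AdSBar n} (hξ : ξ ∈ Λ) :
    ∃ v ∈ cone Λ, form v v = 0 ∧ pair v (ξ : V n) = 1 / 2 := by
  obtain ⟨η, hη, hne⟩ := exists_ne_of_mem_hull hΓ.acausal ho ξ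
  have hp : 0 < pair (η : V n) ξ := neg_pos.2 (hΓ.acausal.2 η hη ξ hξ hne)
  have h0 : form (η : V n) η = 0 := hΓ.acausal.1 hη
  refine ⟨(2 * pair (η : V n) ξ)⁻¹ • (η : V n), smul_mem_cone (by positivity) (coe_mem_cone hη), ?_, ?_⟩
  · rw [form_smul_left, form_smul_right, h0, mul_zero, mul_zero]
  · rw [pair_smul_left]; field_simp

lemma nonempty_of_mem_hull (ho : o ∈ hull Λ) : Λ.Nonempty := by
  by_contra! hne
  obtain ⟨t, -, ht⟩ := ho
  simp [hne] at ht

/-- `Γ` is infinite: its orbits come near the points of a geodesic, which is unbounded. -/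
lemma IsQuasiFuchsian.infinite (hΓ : IsQuasiFuchsian Γ Λ) (ho : o ∈ hull Λ) : Infinite Γ := by
  by_contra hfin
  rw [not_infinite_iff_finite] at hfin
  obtain ⟨C, hC⟩ := hΓ.exists_isCoarseConst o
  obtain ⟨ξ, hξ⟩ := nonempty_of_mem_hull ho
  obtain ⟨v, hv, hv0, hvξ⟩ := hΓ.exists_isotropic_partner ho hξ
  have hξ0 : form (ξ : V n) ξ = 0 := hΓ.acausal.1 hξ
  obtain ⟨M, hM⟩ := (Set.finite_range fun γ : Γ => pair ((γ • o : AdS n) : V n) o).bddAbove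
  have hpξ := hΓ.pair_pos ho (coe_mem_cone hξ)
  have hpv := hΓ.pair_pos ho hv
  have hbound : ∀ t : ℝ, Real.exp t * pair (o : V n) (ξ : V n) ≤ C * (C * M) := by
    intro t
    have hz := geodesicPoint_mem_hull hv0 hξ0 hvξ hv (coe_mem_cone hξ) t
    set z := geodesicPoint v (ξ : V n) hv0 hξ0 hvξ t with hzdef
    obtain ⟨γ, hγ⟩ := hC.dense z hz
    have h1 := hC.triangle _ hz _ ho (γ • o) (hΓ.smul_mem_hull γ ho)
    have h2 : pair (z : V n) o = Real.exp t * pair (ξ : V n) o + Real.exp (-t) * pair v o := by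
      change pair (Real.exp t • (ξ : V n) + Real.exp (-t) • v) (o : V n) = _
      rw [pair_add_left, pair_smul_left, pair_smul_left]
    rw [h2, pair_comm (ξ : V n), pair_comm v] at h1
    have h3 : 0 < Real.exp (-t) * pair (o : V n) v := by positivity
    have h4 : pair (z : V n) (γ • o : AdS n) * pair ((γ • o : AdS n) : V n) o ≤ C * M := by
      have := hΓ.pair_pos (hΓ.smul_mem_hull γ ho) ho
      have := hC.pos
      gcongr
      · rw [pair_comm]; exact hγ
      · exact hM ⟨γ, rfl⟩
    have h5 := mul_le_mul_of_nonneg_left h4 hC.pos.le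
    linarith
  have htend : Tendsto (fun t : ℝ => Real.exp t * pair (o : V n) (ξ : V n)) atTop atTop :=
    Real.tendsto_exp_atTop.atTop_mul_const hpξ
  obtain ⟨t, ht⟩ := (htend.eventually (eventually_gt_atTop (C * (C * M)))).exists
  linarith [hbound t]

lemma IsQuasiFuchsian.finite_setOf_lorentzDist_le (hΓ : IsQuasiFuchsian Γ Λ) (ho : o ∈ hull Λ) (R : ℝ) :
    {γ : Γ | lorentzDist (γ • o) o ≤ R}.Finite :=
  (hΓ.finite_setOf_pair_le ho _).subset fun _ hγ => pair_le_exp_of_lorentzDist_le hγ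

/-- The growth of the orbits, for all base points at once. -/
lemma IsQuasiFuchsian.exists_growth (hΓ : IsQuasiFuchsian Γ Λ) (ho : o ∈ hull Λ) :
    ∃ δ : ℝ, 0 ≤ δ ∧ ∀ x ∈ hull Λ, ∃ R₀ : ℝ, 0 ≤ R₀ ∧
      (∃ c > 0, ∀ R ≥ R₀, c * Real.exp (δ * R) ≤ {γ : Γ | lorentzDist (γ • x) x ≤ R}.ncard) ∧
      ∀ ε > 0, ∃ c > 0, ∀ R ≥ R₀,
        ({γ : Γ | lorentzDist (γ • x) x ≤ R}.ncard : ℝ) ≤ c * Real.exp ((δ + ε) * R) := by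
  obtain ⟨C, hC⟩ := hΓ.exists_isCoarseConst o
  obtain ⟨δ, hδ, ⟨c, hc, hlow⟩, hup⟩ := exists_growth_exponent (hΓ.orbitCount_mono ho)
    (fun T hT => hΓ.one_le_orbitCount ho hT) (one_le_pow₀ hC.one_le : 1 ≤ C ^ 2)
    (fun S T hS hT => hΓ.orbitCount_mul_le ho hC hS hT)
  refine ⟨δ, hδ, fun x hx => ?_⟩
  have hC0 := hC.pos
  have hox := hΓ.pair_pos ho hx
  set k : ℝ := max 1 (C ^ 2 * pair (o : V n) x ^ 2) with hk
  have hk1 : 1 ≤ k := le_max_left _ _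
  have hk0 : 0 < k := by linarith
  have hcomp : ∀ y ∈ hull Λ, ∀ z ∈ hull Λ, pair (y : V n) z = pair (o : V n) x → ∀ γ : Γ,
      pair ((γ • y : AdS n) : V n) y ≤ k * pair ((γ • z : AdS n) : V n) z := by
    intro y hy z hz hyz γ
    have h1 := hC.triangle _ (hΓ.smul_mem_hull γ hy) _ hy z hz
    have h2 := hC.triangle _ (hΓ.smul_mem_hull γ hy) _ hz (γ • z) (hΓ.smul_mem_hull γ hz)
    rw [pair_smul_smul, hyz] at h2
    rw [pair_comm (z : V n) y, hyz] at h1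
    have hp := hΓ.pair_pos (hΓ.smul_mem_hull γ hz) hz
    calc pair ((γ • y : AdS n) : V n) y ≤ _ := h1
      _ ≤ C * ((C * (pair (o : V n) x * pair ((γ • z : AdS n) : V n) z)) * pair (o : V n) x) := by gcongr
      _ = (C ^ 2 * pair (o : V n) x ^ 2) * pair ((γ • z : AdS n) : V n) z := by ring
      _ ≤ _ := by gcongr; exact le_max_right _ _
  refine ⟨Real.log (2 * k), Real.log_nonneg (by linarith), ⟨c * ((2 * k)⁻¹) ^ δ, by positivity, fun R hR => ?_⟩,
    fun ε hε => ?_⟩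
  · have hR2 : 2 * k ≤ Real.exp R := (Real.log_le_iff_le_exp (by positivity)).1 hR
    have h1 : 1 ≤ (2 * k)⁻¹ * Real.exp R := by rwa [inv_mul_eq_div, le_div_iff₀ (by positivity), one_mul]
    calc c * ((2 * k)⁻¹) ^ δ * Real.exp (δ * R) = c * ((2 * k)⁻¹ * Real.exp R) ^ δ := by
          rw [Real.mul_rpow (by positivity) (by positivity), ← Real.exp_mul, mul_comm R, mul_assoc]
      _ ≤ orbitCount Γ o ((2 * k)⁻¹ * Real.exp R) := hlow _ h1
      _ ≤ _ := by
        norm_cast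
        refine Set.ncard_le_ncard (fun γ hγ => ?_) (hΓ.finite_setOf_lorentzDist_le hx R)
        refine lorentzDist_le_of_pair_le ?_ ((hcomp x hx o ho (pair_comm _ _) γ).trans ?_)
        · exact (Real.log_le_log two_pos (by linarith)).trans hR
        · calc k * pair ((γ • o : AdS n) : V n) o ≤ k * ((2 * k)⁻¹ * Real.exp R) := by
                gcongr; exact hγ
            _ = 2⁻¹ * Real.exp R := by field_simp
  · obtain ⟨c', hc', h⟩ := hup ε hε
    refine ⟨c' * k ^ (δ + ε), by positivity, fun R hR => ?_⟩
    have hR1 : 1 ≤ Real.exp R :=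
      Real.one_le_exp ((Real.log_nonneg (by linarith)).trans hR)
    calc ({γ : Γ | lorentzDist (γ • x) x ≤ R}.ncard : ℝ) ≤ orbitCount Γ o (k * Real.exp R) := by
          norm_cast
          refine Set.ncard_le_ncard (fun γ hγ => ?_) (hΓ.finite_setOf_pair_le ho _)
          refine (hcomp o ho x hx rfl γ).trans ?_
          gcongr
          exact pair_le_exp_of_lorentzDist_le hγ
      _ ≤ c' * (k * Real.exp R) ^ (δ + ε) := h _ (one_le_mul_of_one_le_of_one_le hk1 hR1)
      _ = _ := by
        rw [Real.mul_rpow (by positivity) (by positivity), ← Real.exp_mul, mul_comm R, mul_assoc]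

lemma criticalExponent_eq {x : AdS n} (hfin : ∀ R, {γ : Γ | lorentzDist (γ • x) x ≤ R}.Finite) {δ : ℝ}
    (h : Tendsto (fun R : ℝ => Real.log ({γ : Γ | lorentzDist (γ • x) x ≤ R}.ncard) / R) atTop (𝓝 δ)) :
    criticalExponent Γ x = δ := by
  refine Tendsto.limsup_eq (Tendsto.congr' ?_ ((continuous_coe_real_ereal.tendsto δ).comp h))
  filter_upwards [eventually_ge_atTop 0] with R hR
  have h1 : (1 : Γ) ∈ {γ : Γ | lorentzDist (γ • x) x ≤ R} := by
    change lorentzDist ((1 : Γ) • x) x ≤ R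
    rw [one_smul, lorentzDist_eq_arcosh_max, pair_self, max_self, Real.arcosh_zero]
    exact hR
  have h2 : 0 < {γ : Γ | lorentzDist (γ • x) x ≤ R}.ncard := (Set.ncard_pos (hfin R)).2 ⟨1, h1⟩
  rw [← (hfin R).cast_ncard_eq, ENat.toENNReal_coe, ENNReal.log_pos_real (by exact_mod_cast h2.ne')
    (ENNReal.natCast_ne_top _), ENNReal.toReal_natCast, Function.comp_apply, EReal.coe_div]

/-- The constant function `1` is a Patterson function: the Poincaré series itself diverges at the
critical exponent. -/
lemma IsQuasiFuchsian.isPattersonFunction_one (hΓ : IsQuasiFuchsian Γ Λ) (ho : o ∈ hull Λ) {δ R₀ c : ℝ}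
    (hδ : 0 ≤ δ) (hR₀ : 0 ≤ R₀) (hc : 0 < c)
    (hlow : ∀ R ≥ R₀, c * Real.exp (δ * R) ≤ {γ : Γ | lorentzDist (γ • o) o ≤ R}.ncard)
    (hup : ∀ ε > 0, ∃ c > 0, ∀ R ≥ R₀,
        ({γ : Γ | lorentzDist (γ • o) o ≤ R}.ncard : ℝ) ≤ c * Real.exp ((δ + ε) * R)) :
    IsPattersonFunction Γ o δ fun _ => 1 where
  nonneg _ _ := zero_le_one
  mono _ _ _ _ _ := le_rfl
  convergent s hs := by
    simp only [poincareSeries, one_mul]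
    obtain ⟨c', hc', h⟩ := hup ((s - δ) / 2) (by linarith)
    refine tsum_exp_neg_mul_ne_top (t := δ + (s - δ) / 2) (c := c' * Real.exp ((δ + (s - δ) / 2) * R₀))
      (fun γ => lorentzDist_nonneg _ _)
      (hΓ.finite_setOf_lorentzDist_le ho) (by linarith) (by linarith) (fun R hR => ?_)
    have h1 : ({γ : Γ | lorentzDist (γ • o) o ≤ R}.ncard : ℝ) ≤
        {γ : Γ | lorentzDist (γ • o) o ≤ R₀ + R}.ncard := by
      norm_cast
      exact Set.ncard_le_ncard (fun γ hγ => le_trans hγ (le_add_of_nonneg_left hR₀))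
        (hΓ.finite_setOf_lorentzDist_le ho _)
    refine h1.trans ((h (R₀ + R) (by linarith)).trans_eq ?_)
    rw [mul_add, Real.exp_add, mul_assoc]
  divergent := by
    have := hΓ.infinite ho
    simp only [poincareSeries, one_mul]
    exact tsum_exp_neg_mul_eq_top (hΓ.finite_setOf_lorentzDist_le ho) hδ hc hlow
  slow ε hε := ⟨1, one_pos, fun y _ x hx => by
    rw [mul_one]; exact Real.one_le_exp (by positivity)⟩

end QuasiFuchsian

/-! ### Comparison of the weights of Patterson's measures -/

section Weights

variable {n : ℕ} {Γ : Subgroup (SO2 n)} {Λ : Set (AdSBar n)} {o : AdS n} {C δ : ℝ} {h : ℝ → ℝ}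

/-- The weight `h(d(γ o, x)) exp (-s d(γ o, x))` of `γ o` in Patterson's measure. -/
noncomputable def weight (Γ : Subgroup (SO2 n)) (o : AdS n) (h : ℝ → ℝ) (s : ℝ) (x : AdS n) (γ : Γ) : ℝ :=
  h (lorentzDist (γ • o) x) * Real.exp (-s * lorentzDist (γ • o) x)

lemma IsPattersonFunction.weight_nonneg (hh : IsPattersonFunction Γ o δ h) (s : ℝ) (x : AdS n) (γ : Γ) :
    0 ≤ weight Γ o h s x γ :=
  mul_nonneg (hh.nonneg _ (lorentzDist_nonneg _ _)) (Real.exp_pos _).le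

lemma IsPattersonFunction.weight_le (hh : IsPattersonFunction Γ o δ h) {s : ℝ} (hs : δ ≤ s) (x : AdS n)
    (γ : Γ) : weight Γ o h s x γ ≤ weight Γ o h δ x γ := by
  refine mul_le_mul_of_nonneg_left (Real.exp_le_exp.2 ?_) (hh.nonneg _ (lorentzDist_nonneg _ _))
  have := lorentzDist_nonneg (γ • o) x
  nlinarith

lemma weight_inv (s : ℝ) (γ : Γ) : weight Γ o h s o γ⁻¹ = weight Γ o h s o γ := by
  have : lorentzDist (γ⁻¹ • o) o = lorentzDist (γ • o) o := by
    rw [← lorentzDist_smul_smul γ, smul_inv_smul, lorentzDist_comm]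
  rw [weight, weight, this]

lemma poincareSeries_eq_tsum_weight (s : ℝ) :
    poincareSeries Γ o h s = ∑' γ : Γ, ENNReal.ofReal (weight Γ o h s o γ) := rfl

lemma tendsto_arcosh_sub_log : Tendsto (fun c : ℝ => Real.arcosh c - Real.log c) atTop (𝓝 (Real.log 2)) := by
  have h1 : Tendsto (fun c : ℝ => Real.log (1 + √(1 - (c ^ 2)⁻¹))) atTop (𝓝 (Real.log (1 + √(1 - 0)))) := by
    refine Tendsto.log (tendsto_const_nhds.add (Tendsto.sqrt (tendsto_const_nhds.sub ?_))) (by simp)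
    exact tendsto_inv_atTop_zero.comp (tendsto_pow_atTop two_ne_zero)
  rw [sub_zero, Real.sqrt_one, one_add_one_eq_two] at h1
  refine h1.congr' ?_
  filter_upwards [eventually_ge_atTop 1] with c hc
  rw [arcosh_eq_log_add hc]; ring

lemma IsQuasiFuchsian.exists_pair_le_mul (hΓ : IsQuasiFuchsian Γ Λ) {x y : AdS n} (hx : x ∈ hull Λ)
    (hy : y ∈ hull Λ) : ∃ C : ℝ, 1 ≤ C ∧ ∀ v ∈ cone Λ, pair v x ≤ C * pair v y := by
  obtain ⟨C, hC⟩ := hΓ.exists_isCoarseConst x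
  refine ⟨max 1 (C * pair (y : V n) x), le_max_left _ _, fun v hv => ?_⟩
  have hp : 0 < pair v y := by rw [pair_comm]; exact hΓ.pair_pos hy hv
  calc pair v x ≤ C * (pair v y * pair (y : V n) x) := hC.triangle _ hv _ hx y hy
    _ = (C * pair (y : V n) x) * pair v y := by ring
    _ ≤ _ := by gcongr; exact le_max_right _ _

/-- Up to finitely many `γ`, `d(γ o, x) - d(γ o, o)` is close to `log (⟨γ o|x⟩ / ⟨γ o|o⟩)`, which is
bounded. -/
lemma IsQuasiFuchsian.exists_lorentzDist_sub (hΓ : IsQuasiFuchsian Γ Λ) (ho : o ∈ hull Λ)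
    {x : AdS n} (hx : x ∈ hull Λ) :
    ∃ M : ℝ, 0 ≤ M ∧
      (∀ γ : Γ, |Real.log (pair ((γ • o : AdS n) : V n) x / pair ((γ • o : AdS n) : V n) o)| ≤ M) ∧
      ∀ ε > 0, {γ : Γ | ε < |lorentzDist (γ • o) x - lorentzDist (γ • o) o -
        Real.log (pair ((γ • o : AdS n) : V n) x / pair ((γ • o : AdS n) : V n) o)|}.Finite := by
  obtain ⟨A, hA1, hA⟩ := hΓ.exists_pair_le_mul hx ho
  obtain ⟨B, hB1, hB⟩ := hΓ.exists_pair_le_mul ho hx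
  have hpx : ∀ γ : Γ, 0 < pair ((γ • o : AdS n) : V n) x := fun γ =>
    hΓ.pair_pos (hΓ.smul_mem_hull γ ho) hx
  have hpo : ∀ γ : Γ, 0 < pair ((γ • o : AdS n) : V n) o := fun γ =>
    hΓ.pair_pos (hΓ.smul_mem_hull γ ho) ho
  refine ⟨max (Real.log A) (Real.log B), (Real.log_nonneg hA1).trans (le_max_left _ _), fun γ => ?_,
    fun ε hε => ?_⟩
  · have h1 := hpx γ
    have h2 := hpo γ
    rw [abs_le]
    constructor
    · refine (neg_le_neg (le_max_right _ _)).trans ?_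
      rw [← Real.log_inv]
      refine Real.log_le_log (by positivity) ?_
      rw [le_div_iff₀ h2, inv_mul_le_iff₀ (by positivity)]
      exact hB _ (hΓ.smul_mem_hull γ ho)
    · refine le_trans ?_ (le_max_left _ _)
      refine Real.log_le_log (by positivity) ?_
      rw [div_le_iff₀ h2]
      exact hA _ (hΓ.smul_mem_hull γ ho)
  · obtain ⟨T, hT⟩ := eventually_atTop.1
      (tendsto_arcosh_sub_log.eventually (Metric.ball_mem_nhds _ (half_pos hε)))
    refine (hΓ.finite_setOf_pair_le ho (B * max 1 T)).subset fun γ hγ => ?_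
    by_contra hlt
    have hlt' : B * max 1 T < pair ((γ • o : AdS n) : V n) o := not_le.1 hlt
    have hm0 : 0 < max 1 T := by positivity
    have h1 : max 1 T < pair ((γ • o : AdS n) : V n) x :=
      lt_of_mul_lt_mul_left (hlt'.trans_le (hB _ (hΓ.smul_mem_hull γ ho))) (by positivity)
    have h2 : max 1 T < pair ((γ • o : AdS n) : V n) o :=
      (le_mul_of_one_le_left hm0.le hB1).trans_lt hlt'
    have h3 := hT _ ((le_max_right _ _).trans h1.le)
    have h4 := hT _ ((le_max_right _ _).trans h2.le)
    rw [Real.dist_eq] at h3 h4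
    have hγ' : ε < |lorentzDist (γ • o) x - lorentzDist (γ • o) o -
        Real.log (pair ((γ • o : AdS n) : V n) x / pair ((γ • o : AdS n) : V n) o)| := hγ
    rw [lorentzDist_eq_arcosh_max, lorentzDist_eq_arcosh_max,
      max_eq_right ((le_max_left _ _).trans h1.le), max_eq_right ((le_max_left _ _).trans h2.le),
      Real.log_div (hpx γ).ne' (hpo γ).ne'] at hγ'
    refine absurd hγ' (not_lt.2 ?_)
    rw [abs_lt] at h3 h4
    rw [abs_le]
    constructor <;> linarith

/-- A Patterson function varies slowly. -/
lemma IsPattersonFunction.exists_le_exp_mul (hh : IsPattersonFunction Γ o δ h) {ε : ℝ} (hε : 0 < ε)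
    {K : ℝ} (hK : 0 < K) : ∃ y₀ > 0, ∀ a > y₀, ∀ b > y₀, |b - a| ≤ K → h b ≤ Real.exp ε * h a := by
  obtain ⟨y₀, hy₀, hs⟩ := hh.slow (ε / K) (by positivity)
  refine ⟨y₀, hy₀, fun a ha b hb hab => ?_⟩
  have ha0 := hh.nonneg a (by linarith)
  rcases le_or_gt b a with hle | hlt
  · exact (hh.mono (by simp; linarith) (by simp; linarith) hle).trans
      (le_mul_of_one_le_left ha0 (Real.one_le_exp hε.le))
  · have h1 := hs a ha (b - a) (by linarith)
    rw [add_sub_cancel] at h1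
    refine h1.trans ?_
    gcongr
    rw [div_mul_eq_mul_div, div_le_iff₀ hK]
    gcongr
    exact (le_abs_self _).trans hab

/-- The ratio of the weights of `γ o` in Patterson's measures of base points `x` and `o` is
asymptotic to `(⟨γ o|x⟩ / ⟨γ o|o⟩) ^ (-δ)`. -/
lemma IsQuasiFuchsian.exists_weight_le (hΓ : IsQuasiFuchsian Γ Λ) (ho : o ∈ hull Λ)
    (hh : IsPattersonFunction Γ o δ h) {x : AdS n} (hx : x ∈ hull Λ) :
    ∃ M : ℝ, 0 ≤ M ∧
      (∀ γ : Γ, |Real.log (pair ((γ • o : AdS n) : V n) x / pair ((γ • o : AdS n) : V n) o)| ≤ M) ∧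
      ∀ ε > 0, ∃ F : Set Γ, F.Finite ∧ ∀ s, δ ≤ s → ∀ γ ∉ F,
        weight Γ o h s x γ ≤ Real.exp (ε * (1 + |s|) + (s - δ) * M) * (weight Γ o h s o γ *
          Real.exp (-δ * Real.log (pair ((γ • o : AdS n) : V n) x / pair ((γ • o : AdS n) : V n) o))) ∧
        weight Γ o h s o γ *
          Real.exp (-δ * Real.log (pair ((γ • o : AdS n) : V n) x / pair ((γ • o : AdS n) : V n) o)) ≤
          Real.exp (ε * (1 + |s|) + (s - δ) * M) * weight Γ o h s x γ := by
  obtain ⟨M, hM0, hM, hfin⟩ := hΓ.exists_lorentzDist_sub ho hx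
  refine ⟨M, hM0, hM, fun ε hε => ?_⟩
  obtain ⟨y₀, hy₀, hslow⟩ := hh.exists_le_exp_mul hε (show 0 < M + ε by positivity)
  obtain ⟨B, hB1, hB⟩ := hΓ.exists_pair_le_mul ho hx
  refine ⟨_, ((hfin ε hε).union (hΓ.finite_setOf_pair_le ho (B * Real.exp y₀))), fun s hs γ hγ => ?_⟩
  have hγ1 : |lorentzDist (γ • o) x - lorentzDist (γ • o) o -
      Real.log (pair ((γ • o : AdS n) : V n) x / pair ((γ • o : AdS n) : V n) o)| ≤ ε :=
    not_lt.1 fun hc => hγ (Or.inl hc)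
  have hγ2 : B * Real.exp y₀ < pair ((γ • o : AdS n) : V n) o := not_le.1 fun hc => hγ (Or.inr hc)
  have hdo : y₀ < lorentzDist (γ • o) o := by
    by_contra hle
    have h1 := pair_le_exp_of_lorentzDist_le (not_lt.1 hle)
    have := le_mul_of_one_le_left (Real.exp_pos y₀).le hB1
    linarith
  have hdx : y₀ < lorentzDist (γ • o) x := by
    by_contra hle
    have h1 := pair_le_exp_of_lorentzDist_le (not_lt.1 hle)
    have h2 := hB _ (hΓ.smul_mem_hull γ ho)
    have h3 : B * pair ((γ • o : AdS n) : V n) x ≤ B * Real.exp y₀ := by gcongr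
    linarith
  set a := lorentzDist (γ • o) o
  set b := lorentzDist (γ • o) x
  set L := Real.log (pair ((γ • o : AdS n) : V n) x / pair ((γ • o : AdS n) : V n) o)
  have hLM := hM γ
  have hab : |b - a| ≤ M + ε := by
    calc |b - a| = |L + (b - a - L)| := by ring_nf
      _ ≤ M + ε := (abs_add_le _ _).trans (add_le_add hLM hγ1)
  have ha := hh.nonneg a (lorentzDist_nonneg _ _)
  have hb := hh.nonneg b (lorentzDist_nonneg _ _)
  have hsθ : |s * (b - a - L)| ≤ ε * |s| := by
    rw [abs_mul, mul_comm]; gcongr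
  have hsL : |(s - δ) * L| ≤ (s - δ) * M := by
    rw [abs_mul, abs_of_nonneg (sub_nonneg.2 hs)]
    gcongr
  rw [abs_le] at hsθ hsL
  constructor
  · calc h b * Real.exp (-s * b) ≤ (Real.exp ε * h a) * Real.exp (-s * b) := by
          gcongr; exact hslow a hdo b hdx hab
      _ = h a * Real.exp (ε + -s * b) := by rw [Real.exp_add]; ring
      _ ≤ h a * Real.exp ((ε * (1 + |s|) + (s - δ) * M) + (-s * a) + (-δ * L)) := by
          refine mul_le_mul_of_nonneg_left (Real.exp_le_exp.2 ?_) ha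
          linarith [hsθ.1, hsL.1]
      _ = _ := by rw [Real.exp_add, Real.exp_add, weight]; ring
  · calc h a * Real.exp (-s * a) * Real.exp (-δ * L)
        ≤ (Real.exp ε * h b) * Real.exp (-s * a) * Real.exp (-δ * L) := by
          gcongr; exact hslow b hdx a hdo (by rwa [abs_sub_comm])
      _ = h b * Real.exp (ε + -s * a + -δ * L) := by rw [Real.exp_add, Real.exp_add]; ring
      _ ≤ h b * Real.exp ((ε * (1 + |s|) + (s - δ) * M) + (-s * b)) := by
          refine mul_le_mul_of_nonneg_left (Real.exp_le_exp.2 ?_) hb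
          linarith [hsθ.2, hsL.2]
      _ = _ := by rw [Real.exp_add, weight]; ring

/-- The modified Poincaré series tends to infinity at its exponent. -/
lemma IsPattersonFunction.tendsto_poincareSeries (hh : IsPattersonFunction Γ o δ h) {s : ℕ → ℝ}
    (hs : Tendsto s atTop (𝓝 δ)) : Tendsto (fun k => poincareSeries Γ o h (s k)) atTop (𝓝 ⊤) := by
  rw [ENNReal.tendsto_nhds_top_iff_nnreal]
  intro A
  have hdiv := hh.divergent
  rw [poincareSeries_eq_tsum_weight, ENNReal.tsum_eq_iSup_sum] at hdiv
  obtain ⟨G, hG⟩ := lt_iSup_iff.1 (hdiv ▸ ENNReal.coe_lt_top : (A : ℝ≥0∞) < _)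
  have hcont : Continuous fun s : ℝ => ∑ γ ∈ G, ENNReal.ofReal (weight Γ o h s o γ) := by
    refine continuous_finsetSum _ fun γ _ => ENNReal.continuous_ofReal.comp ?_
    unfold weight
    fun_prop
  filter_upwards [((hcont.tendsto δ).comp hs).eventually (lt_mem_nhds hG)] with k hk
  exact lt_of_lt_of_le hk (ENNReal.sum_le_tsum G)

lemma IsPattersonFunction.poincareSeries_ne_zero (hh : IsPattersonFunction Γ o δ h) (s : ℝ) :
    poincareSeries Γ o h s ≠ 0 := by
  intro h0
  rw [poincareSeries_eq_tsum_weight, ENNReal.tsum_eq_zero] at h0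
  have hdiv := hh.divergent
  rw [poincareSeries_eq_tsum_weight] at hdiv
  have : ∀ γ : Γ, ENNReal.ofReal (weight Γ o h δ o γ) = 0 := by
    intro γ
    have h1 := ENNReal.ofReal_eq_zero.1 (h0 γ)
    rw [ENNReal.ofReal_eq_zero]
    have h2 : h (lorentzDist (γ • o) o) ≤ 0 := nonpos_of_mul_nonpos_left h1 (Real.exp_pos _)
    exact mul_nonpos_of_nonpos_of_nonneg h2 (Real.exp_pos _).le
  simp [this] at hdiv

end Weights

/-! ### Weak limits of Patterson's measures -/

section Abstract

lemma tendsto_of_forall_exp_le {a b : ℕ → ℝ} {B : ℝ} (hb : Tendsto b atTop (𝓝 B))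
    (h1 : ∀ ε > 0, ∀ᶠ k in atTop, a k ≤ Real.exp ε * b k + ε)
    (h2 : ∀ ε > 0, ∀ᶠ k in atTop, b k ≤ Real.exp ε * a k + ε) : Tendsto a atTop (𝓝 B) := by
  rw [tendsto_order]
  constructor
  · intro l hl
    have hc : Continuous fun ε : ℝ => Real.exp (-ε) * (B - 2 * ε) := by fun_prop
    have hev : ∀ᶠ ε in 𝓝[>] (0 : ℝ), l < Real.exp (-ε) * (B - 2 * ε) :=
      (hc.continuousWithinAt).eventually (lt_mem_nhds (by simpa using hl))
    obtain ⟨ε, hε, hε0⟩ := (hev.and self_mem_nhdsWithin).exists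
    have hε0 : 0 < ε := hε0
    filter_upwards [h2 ε hε0, hb.eventually (lt_mem_nhds (show B - ε < B by linarith))] with k hk hbk
    refine hε.trans_le ?_
    rw [Real.exp_neg, inv_mul_le_iff₀ (Real.exp_pos _)]
    linarith
  · intro u hu
    have hc : Continuous fun ε : ℝ => Real.exp ε * (B + ε) + ε := by fun_prop
    have hev : ∀ᶠ ε in 𝓝[>] (0 : ℝ), Real.exp ε * (B + ε) + ε < u :=
      (hc.continuousWithinAt).eventually (gt_mem_nhds (by simpa using hu))
    obtain ⟨ε, hε, hε0⟩ := (hev.and self_mem_nhdsWithin).exists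
    have hε0 : 0 < ε := hε0
    filter_upwards [h1 ε hε0, hb.eventually (gt_mem_nhds (show B < B + ε by linarith))] with k hk hbk
    refine lt_of_le_of_lt (hk.trans ?_) hε
    gcongr

/-- Finitely many terms do not contribute to averages whose normalizing factors tend to infinity. -/
lemma eventually_inv_mul_tsum_le {ι : Type*} {Q : ℕ → ℝ≥0∞} (hQ : Tendsto Q atTop (𝓝 ⊤))
    {p q : ℕ → ι → ℝ≥0∞} {R : ι → ℝ≥0∞} (hR : ∀ i, R i ≠ ⊤) (hpR : ∀ k i, p k i ≤ R i) {ε : ℝ}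
    {E : ℝ≥0∞} (hε : 0 < ε) {F : Set ι} (hF : F.Finite) (hpq : ∀ᶠ k in atTop, ∀ i ∉ F, p k i ≤ E * q k i) :
    ∀ᶠ k in atTop, (Q k)⁻¹ * ∑' i, p k i ≤ E * ((Q k)⁻¹ * ∑' i, q k i) + ENNReal.ofReal ε := by
  classical
  have hsum : ∑ i ∈ hF.toFinset, R i ≠ ⊤ := ENNReal.sum_ne_top.2 fun i _ => hR i
  have h0 : Tendsto (fun k => (Q k)⁻¹ * ∑ i ∈ hF.toFinset, R i) atTop (𝓝 0) := by
    have h1 : Tendsto (fun k => (Q k)⁻¹) atTop (𝓝 0) := by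
      simpa using tendsto_inv_iff.2 hQ
    simpa using ENNReal.Tendsto.mul_const h1 (Or.inr hsum)
  filter_upwards [hpq, h0.eventually (gt_mem_nhds (ENNReal.ofReal_pos.2 hε))] with k hk hk0
  have h1 : ∀ i, p k i ≤ E * q k i + F.indicator R i := by
    intro i
    by_cases hi : i ∈ F
    · rw [Set.indicator_of_mem hi]
      exact (hpR k i).trans le_add_self
    · rw [Set.indicator_of_notMem hi, add_zero]
      exact hk i hi
  have h2 : ∑' i, F.indicator R i = ∑ i ∈ hF.toFinset, R i := by
    rw [tsum_eq_sum (s := hF.toFinset) fun i hi => Set.indicator_of_notMem (by simpa using hi) R]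
    exact Finset.sum_congr rfl fun i hi => Set.indicator_of_mem (by simpa using hi) R
  calc (Q k)⁻¹ * ∑' i, p k i ≤ (Q k)⁻¹ * ∑' i, (E * q k i + F.indicator R i) := by
        gcongr with i; exact h1 i
    _ = E * ((Q k)⁻¹ * ∑' i, q k i) + (Q k)⁻¹ * ∑ i ∈ hF.toFinset, R i := by
        rw [ENNReal.tsum_add, ENNReal.tsum_mul_left, h2]; ring
    _ ≤ _ := by gcongr

end Abstract

section Patterson

variable {n : ℕ} {Γ : Subgroup (SO2 n)} {Λ : Set (AdSBar n)} {o : AdS n} {δ : ℝ} {h : ℝ → ℝ}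

instance : CompactSpace (AdSBar n) := by
  have h1 : IsClosed {u : V n | form u u ≤ 0} :=
    isClosed_le (continuous_form.comp (continuous_id.prodMk continuous_id)) continuous_const
  have h2 : IsCompact {u : V n | ‖u‖ = 1 ∧ form u u ≤ 0} := by
    refine ((isCompact_sphere (0 : V n) 1).inter_right h1).of_isClosed_subset
      ((isClosed_eq continuous_norm continuous_const).inter h1) fun u hu => ⟨by simpa using hu.1, hu.2⟩
  exact isCompact_iff_compactSpace.1 h2

lemma continuous_smul_bar (g : SO2 n) : Continuous fun u : AdSBar n => g • u := by
  have h1 : Continuous fun u : AdSBar n => act g.1 (u : V n) :=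
    (continuous_act g.1).comp continuous_subtype_val
  have h2 : Continuous fun u : AdSBar n => ‖act g.1 (u : V n)‖⁻¹ • act g.1 (u : V n) :=
    (h1.norm.inv₀ fun u => norm_ne_zero_iff.2 (act_ne_zero _ (AdSBar.ne_zero u))).smul h1
  exact h2.subtype_mk _

lemma coe_toBar (x : AdS n) : (x.toBar : V n) = ‖(x : V n)‖⁻¹ • (x : V n) := rfl

lemma coe_toBar_mem_cone {x : AdS n} (hx : x ∈ hull Λ) : (x.toBar : V n) ∈ cone Λ :=
  smul_mem_cone (inv_pos.2 (norm_pos_iff.2 (AdS.ne_zero x))) hx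

lemma pair_toBar_div (z x y : AdS n) : pair (z.toBar : V n) x / pair (z.toBar : V n) y =
    pair (z : V n) x / pair (z : V n) y := by
  rw [coe_toBar, pair_smul_left, pair_smul_left,
    mul_div_mul_left _ _ (inv_ne_zero (norm_ne_zero_iff.2 (AdS.ne_zero z)))]

/-- The orbits accumulate only on `Λ`. -/
lemma IsQuasiFuchsian.finite_setOf_toBar_notMem (hΓ : IsQuasiFuchsian Γ Λ) (ho : o ∈ hull Λ)
    {U : Set (AdSBar n)} (hU : IsOpen U) (hΛU : Λ ⊆ U) : {γ : Γ | (γ • o).toBar ∉ U}.Finite := by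
  obtain ⟨W, hW, rfl⟩ := isOpen_induced_iff.1 hU
  set D := closure (convexHull ℝ ((fun ξ : AdSBar n => (ξ : V n)) '' Λ)) with hD
  have hDb : D ⊆ Metric.closedBall (0 : V n) 1 := closure_minimal
    (fun b hb => by simpa using norm_le_one_of_mem_convexHull hb) Metric.isClosed_closedBall
  have hDc : IsCompact D := (isCompact_closedBall (0 : V n) 1).of_isClosed_subset isClosed_closure hDb
  obtain ⟨m, hm, hmle⟩ := exists_mul_norm_le_pair hΓ.acausal hΓ.isCompact
    (isCompact_singleton (x := o)) (Set.singleton_subset_iff.2 ho)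
  have hnorm : ∃ c : ℝ, 0 < c ∧ ∀ b ∈ D, c ≤ ‖b‖ := by
    refine ⟨m / ‖(o : V n)‖, div_pos hm (norm_pos_iff.2 (AdS.ne_zero o)), fun b hb => ?_⟩
    have h1 : b ∈ {v : V n | m ≤ pair (o : V n) v} := by
      refine closure_minimal (convexHull_min ?_ ?_) ?_ hb
      · rintro _ ⟨ξ, hξ, rfl⟩
        have := hmle o rfl _ (coe_mem_cone hξ)
        rwa [ξ.2.1, mul_one] at this
      · intro v hv w hw a c ha hc hac
        have hv' : m ≤ pair (o : V n) v := hv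
        have hw' : m ≤ pair (o : V n) w := hw
        change m ≤ pair (o : V n) (a • v + c • w)
        rw [pair_add_right, pair_smul_right, pair_smul_right]
        calc m = a * m + c * m := by rw [← add_mul, hac, one_mul]
          _ ≤ _ := by gcongr
      · exact isClosed_le continuous_const (continuous_pair.comp (continuous_const.prodMk continuous_id))
    rw [div_le_iff₀ (norm_pos_iff.2 (AdS.ne_zero o)), mul_comm]
    exact le_trans h1 (pair_le _ _)
  obtain ⟨c, hc, hcle⟩ := hnorm
  have hDne : ∀ b ∈ D, ‖b‖ ≠ 0 := fun b hb => (hc.trans_le (hcle b hb)).ne'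
  have hcont : ContinuousOn (fun b : V n => ‖b‖⁻¹ • b) D :=
    (continuousOn_id.norm.inv₀ hDne).smul continuousOn_id
  have hD' : IsCompact (D ∩ (fun b : V n => ‖b‖⁻¹ • b) ⁻¹' Wᶜ) :=
    hDc.of_isClosed_subset (hcont.preimage_isClosed_of_isClosed isClosed_closure hW.isClosed_compl)
      Set.inter_subset_left
  -- away from `Λ`, the form is bounded away from zero on the closed convex hull
  obtain ⟨r, hr, hrle⟩ : ∃ r : ℝ, 0 < r ∧ ∀ b ∈ D, ‖b‖⁻¹ • b ∉ W → r ≤ pair b b := by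
    rcases (D ∩ (fun b : V n => ‖b‖⁻¹ • b) ⁻¹' Wᶜ).eq_empty_or_nonempty with he | hne
    · refine ⟨1, one_pos, fun b hb hbW => ?_⟩
      have : b ∈ D ∩ (fun b : V n => ‖b‖⁻¹ • b) ⁻¹' Wᶜ := ⟨hb, hbW⟩
      rw [he] at this
      exact absurd this (Set.notMem_empty _)
    · obtain ⟨b₀, hb₀, hmin⟩ := hD'.exists_isMinOn hne (f := fun b => pair b b)
        (continuous_pair.comp (continuous_id.prodMk continuous_id)).continuousOn
      refine ⟨pair b₀ b₀, ?_, fun b hb hbW => hmin ⟨hb, hbW⟩⟩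
      by_contra hle
      obtain ⟨ξ, hξ, hbξ⟩ := exists_eq_of_mem_closure_convexHull_of_pair_self_le hΓ.acausal
        hΓ.isCompact hb₀.1 (not_lt.1 hle)
      refine hb₀.2 ?_
      change ‖b₀‖⁻¹ • b₀ ∈ W
      rw [hbξ, ξ.2.1, inv_one, one_smul]
      exact hΛU hξ
  refine (hΓ.finite_setOf_pair_le ho ((√r)⁻¹ * ‖(o : V n)‖)).subset fun γ hγ => ?_
  obtain ⟨t, ht, htb⟩ := hΓ.smul_mem_hull γ ho
  have hbD := subset_closure htb
  have h1 := hrle _ hbD (by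
    rw [norm_smul, Real.norm_of_nonneg ht.le, mul_inv, smul_smul, mul_right_comm,
      inv_mul_cancel₀ ht.ne', one_mul]
    exact hγ)
  rw [pair_smul_left, pair_smul_right, pair_self, mul_one, ← pow_two] at h1
  have h2 : √r ≤ t := Real.sqrt_le_iff.2 ⟨ht.le, h1⟩
  have h3 : t * ‖((γ • o : AdS n) : V n)‖ ≤ 1 := by
    have := norm_le_one_of_mem_convexHull htb
    rwa [norm_smul, Real.norm_of_nonneg ht.le] at this
  have hr' : 0 < √r := Real.sqrt_pos.2 hr
  have h4 : ‖((γ • o : AdS n) : V n)‖ ≤ (√r)⁻¹ := by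
    rw [← one_div, le_div_iff₀ hr', mul_comm]
    exact (mul_le_mul_of_nonneg_right h2 (norm_nonneg _)).trans h3
  exact (pair_le _ _).trans (by gcongr)

lemma lintegral_pattersonMeasure (s : ℝ) (x : AdS n) (f : AdSBar n → ℝ≥0∞) :
    ∫⁻ u, f u ∂(pattersonMeasure Γ o h s x) =
      (poincareSeries Γ o h s)⁻¹ * ∑' γ : Γ, ENNReal.ofReal (weight Γ o h s x γ) * f (γ • o).toBar := by
  rw [pattersonMeasure, lintegral_smul_measure, lintegral_sum_measure, smul_eq_mul]
  congr 1
  refine tsum_congr fun γ => ?_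
  rw [lintegral_smul_measure, lintegral_dirac, smul_eq_mul]
  rfl

lemma pattersonMeasure_apply (s : ℝ) (x : AdS n) {A : Set (AdSBar n)} (hA : MeasurableSet A) :
    pattersonMeasure Γ o h s x A =
      (poincareSeries Γ o h s)⁻¹ * ∑' γ : Γ, ENNReal.ofReal (weight Γ o h s x γ) *
        A.indicator 1 (γ • o).toBar := by
  rw [← lintegral_indicator_one hA, lintegral_pattersonMeasure]

lemma IsPattersonFunction.isProbabilityMeasure (hh : IsPattersonFunction Γ o δ h) {s : ℝ} (hs : δ < s) :
    IsProbabilityMeasure (pattersonMeasure Γ o h s o) := by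
  constructor
  rw [pattersonMeasure_apply _ _ MeasurableSet.univ]
  simp only [Set.indicator_univ, Pi.one_apply, mul_one]
  exact ENNReal.inv_mul_cancel (hh.poincareSeries_ne_zero s) (hh.convergent s hs)

lemma IsQuasiFuchsian.isFiniteMeasure_pattersonMeasure (hΓ : IsQuasiFuchsian Γ Λ) (ho : o ∈ hull Λ)
    (hh : IsPattersonFunction Γ o δ h) {s : ℝ} (hs : δ < s) {x : AdS n} (hx : x ∈ hull Λ) :
    IsFiniteMeasure (pattersonMeasure Γ o h s x) := by
  classical
  constructor
  rw [pattersonMeasure_apply _ _ MeasurableSet.univ]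
  simp only [Set.indicator_univ, Pi.one_apply, mul_one]
  refine ENNReal.mul_lt_top (ENNReal.inv_lt_top.2 (pos_iff_ne_zero.2 (hh.poincareSeries_ne_zero s))) ?_
  obtain ⟨M, hM0, hM, hF⟩ := hΓ.exists_weight_le ho hh hx
  obtain ⟨F, hFfin, hle⟩ := hF 1 one_pos
  set E := Real.exp (1 * (1 + |s|) + (s - δ) * M) with hE
  have h1 : ∀ γ : Γ, ENNReal.ofReal (weight Γ o h s x γ) ≤
      ENNReal.ofReal (E * Real.exp (|δ| * M)) * ENNReal.ofReal (weight Γ o h s o γ) +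
        F.indicator (fun γ => ENNReal.ofReal (weight Γ o h s x γ)) γ := by
    intro γ
    by_cases hγ : γ ∈ F
    · rw [Set.indicator_of_mem hγ]; exact le_add_self
    · rw [Set.indicator_of_notMem hγ, add_zero, ← ENNReal.ofReal_mul (by positivity)]
      refine ENNReal.ofReal_le_ofReal (((hle s hs.le γ hγ).1).trans ?_)
      have h0 := hh.weight_nonneg s o γ
      rw [mul_assoc, mul_comm (weight _ _ _ _ _ _)]
      refine mul_le_mul_of_nonneg_left (mul_le_mul_of_nonneg_right (Real.exp_le_exp.2
        ((le_abs_self _).trans ?_)) h0) (Real.exp_pos _).le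
      rw [abs_mul, abs_neg]
      exact mul_le_mul_of_nonneg_left (hM γ) (abs_nonneg _)
  refine (ENNReal.tsum_le_tsum h1).trans_lt ?_
  rw [ENNReal.tsum_add, ENNReal.tsum_mul_left]
  refine ENNReal.add_lt_top.2 ⟨ENNReal.mul_lt_top ENNReal.ofReal_lt_top
    (lt_top_iff_ne_top.2 (hh.convergent s hs)), ?_⟩
  rw [tsum_eq_sum (s := hFfin.toFinset) fun γ hγ => Set.indicator_of_notMem (by simpa using hγ) _]
  refine ENNReal.sum_lt_top.2 fun γ _ => ?_
  by_cases hγ : γ ∈ F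
  · rw [Set.indicator_of_mem hγ]; exact ENNReal.ofReal_lt_top
  · rw [Set.indicator_of_notMem hγ]; exact ENNReal.zero_lt_top

/-- A continuous extension to the whole compactification of the density
`exp (-δ β_ξ(x, y))`; the extension is the expected function on the rays of the cone over `Λ` if `m`
is at most the values of `-⟨·|x⟩` and `-⟨·|y⟩` at the unit vectors of this cone. -/
noncomputable def density (δ m : ℝ) (x y : AdS n) (u : AdSBar n) : ℝ≥0 :=
  Real.toNNReal (Real.exp (-δ * Real.log (max m (pair (u : V n) x) / max m (pair (u : V n) y))))

lemma continuous_density (δ : ℝ) {m : ℝ} (hm : 0 < m) (x y : AdS n) :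
    Continuous (density δ m x y) := by
  have h1 : ∀ z : AdS n, Continuous fun u : AdSBar n => max m (pair (u : V n) z) := fun z =>
    continuous_const.max ((continuous_pair_left _).comp continuous_subtype_val)
  have h2 : ∀ (z : AdS n) (u : AdSBar n), max m (pair (u : V n) z) ≠ 0 := fun z u => by positivity
  refine continuous_real_toNNReal.comp (Real.continuous_exp.comp (continuous_const.mul ?_))
  exact ((h1 x).div (h1 y) (h2 y)).log fun u => div_ne_zero (h2 x u) (h2 y u)

/-- A lower bound of `-⟨·|x⟩` and `-⟨·|y⟩` on the unit vectors of the cone over `Λ`. -/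
def IsLowerBound (Λ : Set (AdSBar n)) (m : ℝ) (x y : AdS n) : Prop :=
  0 < m ∧ ∀ u : AdSBar n, (u : V n) ∈ cone Λ → m ≤ pair (u : V n) x ∧ m ≤ pair (u : V n) y

lemma IsQuasiFuchsian.exists_isLowerBound (hΓ : IsQuasiFuchsian Γ Λ) {x y : AdS n} (hx : x ∈ hull Λ)
    (hy : y ∈ hull Λ) : ∃ m, IsLowerBound Λ m x y := by
  have hK : ({x, y} : Set (AdS n)) ⊆ hull Λ := by
    rintro z (rfl | rfl)
    · exact hx
    · exact hy
  obtain ⟨m, hm, hle⟩ := exists_mul_norm_le_pair hΓ.acausal hΓ.isCompact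
    (Set.toFinite ({x, y} : Set (AdS n))).isCompact hK
  refine ⟨m, hm, fun u hu => ?_⟩
  have h1 := hle x (Or.inl rfl) u hu
  have h2 := hle y (Or.inr rfl) u hu
  rw [u.2.1, mul_one, pair_comm] at h1 h2
  exact ⟨h1, h2⟩

lemma density_of_mem_cone {m : ℝ} {x y : AdS n} (hm : IsLowerBound Λ m x y) {u : AdSBar n}
    (hu : (u : V n) ∈ cone Λ) : (density δ m x y u : ℝ≥0∞) =
      ENNReal.ofReal (Real.exp (-δ * Real.log (pair (u : V n) x / pair (u : V n) y))) := by
  rw [density, max_eq_right (hm.2 u hu).1, max_eq_right (hm.2 u hu).2]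
  rfl

lemma busemann_eq (ξ : AdSBar n) (x y : AdS n) :
    busemann ξ x y = Real.log (pair (ξ : V n) x / pair (ξ : V n) y) := by
  rw [busemann, pair, pair, neg_div_neg_eq]

instance (μ : Measure (AdSBar n)) [IsFiniteMeasure μ] (f : BoundedContinuousFunction (AdSBar n) ℝ≥0) :
    IsFiniteMeasure (μ.withDensity fun u => (f u : ℝ≥0∞)) :=
  isFiniteMeasure_withDensity (f.lintegral_lt_top_of_nnreal μ).ne

/-- Patterson's measures of base point `x` converge as soon as those of base point `o` do, and the
ratio of the limits is the exponential of the Busemann function. -/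
lemma IsQuasiFuchsian.convergesWeakly_withDensity (hΓ : IsQuasiFuchsian Γ Λ) (ho : o ∈ hull Λ)
    (hh : IsPattersonFunction Γ o δ h) {s : ℕ → ℝ} (hs : ∀ k, δ < s k) (hsδ : Tendsto s atTop (𝓝 δ))
    {π : FiniteMeasure (AdSBar n)}
    (hπ : ConvergesWeakly (fun k => pattersonMeasure Γ o h (s k) o) π)
    {x : AdS n} (hx : x ∈ hull Λ) {m : ℝ} (hm : IsLowerBound Λ m x o) :
    ConvergesWeakly (fun k => pattersonMeasure Γ o h (s k) x)
      (⟨(π : Measure (AdSBar n)).withDensity fun u => (BoundedContinuousFunction.mkOfCompact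
        ⟨density δ m x o, continuous_density δ hm.1 x o⟩ u : ℝ≥0∞), inferInstance⟩ :
        FiniteMeasure (AdSBar n)) := by
  set Ψ := BoundedContinuousFunction.mkOfCompact
        (⟨density δ m x o, continuous_density δ hm.1 x o⟩ : C(AdSBar n, ℝ≥0)) with hΨ
  obtain ⟨μ, hμ, hlim⟩ := hπ
  have hfin : ∀ k, IsFiniteMeasure (pattersonMeasure Γ o h (s k) x) := fun k =>
    hΓ.isFiniteMeasure_pattersonMeasure ho hh (hs k) hx
  refine ⟨fun k => (⟨pattersonMeasure Γ o h (s k) x, hfin k⟩ : FiniteMeasure (AdSBar n)),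
    fun k => rfl, ?_⟩
  rw [FiniteMeasure.tendsto_iff_forall_lintegral_tendsto] at hlim
  refine FiniteMeasure.tendsto_iff_forall_lintegral_tendsto.2 fun f => ?_
  have hb := hlim (Ψ * f)
  have hlim_eq : ∫⁻ u, f u ∂((π : Measure (AdSBar n)).withDensity fun u => (Ψ u : ℝ≥0∞)) =
      ∫⁻ u, ((Ψ * f) u : ℝ≥0∞) ∂(π : Measure (AdSBar n)) := by
    refine (lintegral_withDensity_eq_lintegral_mul _
      (measurable_coe_nnreal_ennreal.comp Ψ.continuous.measurable)
      (measurable_coe_nnreal_ennreal.comp f.continuous.measurable)).trans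
        (lintegral_congr fun u => ?_)
    simp
  change Tendsto (fun k => ∫⁻ u, f u ∂(pattersonMeasure Γ o h (s k) x)) atTop
    (𝓝 (∫⁻ u, f u ∂((π : Measure (AdSBar n)).withDensity fun u => (Ψ u : ℝ≥0∞))))
  rw [hlim_eq]
  simp only [hμ] at hb
  -- both sequences of integrals are averages over `Γ` with almost proportional weights
  let p : ℕ → Γ → ℝ≥0∞ := fun k γ => ENNReal.ofReal (weight Γ o h (s k) x γ) * f (γ • o).toBar
  let q : ℕ → Γ → ℝ≥0∞ := fun k γ => ENNReal.ofReal (weight Γ o h (s k) o γ) * (Ψ * f) (γ • o).toBar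
  have hQ := hh.tendsto_poincareSeries hsδ
  obtain ⟨M, hM0, hM, hF⟩ := hΓ.exists_weight_le ho hh hx
  have hq_eq : ∀ k γ, q k γ = ENNReal.ofReal (weight Γ o h (s k) o γ *
      Real.exp (-δ * Real.log (pair ((γ • o : AdS n) : V n) x / pair ((γ • o : AdS n) : V n) o))) *
        f (γ • o).toBar := by
    intro k γ
    have h1 : ((Ψ * f) (γ • o).toBar : ℝ≥0∞) = (density δ m x o (γ • o).toBar : ℝ≥0∞) * f (γ • o).toBar := by
      simp [hΨ]
    simp only [q]
    rw [h1, density_of_mem_cone hm (coe_toBar_mem_cone (hΓ.smul_mem_hull γ ho)), pair_toBar_div,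
      ← mul_assoc, ← ENNReal.ofReal_mul (hh.weight_nonneg _ _ _)]
  have hexp : ∀ ε > 0, ∃ F : Set Γ, F.Finite ∧ ∀ᶠ k in atTop, ∀ γ ∉ F,
      p k γ ≤ ENNReal.ofReal (Real.exp ε) * q k γ ∧ q k γ ≤ ENNReal.ofReal (Real.exp ε) * p k γ := by
    intro ε hε
    obtain ⟨F, hFfin, hle⟩ := hF (ε / (2 * (2 + |δ|))) (by positivity)
    refine ⟨F, hFfin, ?_⟩
    have hc : Continuous fun t : ℝ => ε / (2 * (2 + |δ|)) * (1 + |t|) + (t - δ) * M := by fun_prop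
    have hlt : ε / (2 * (2 + |δ|)) * (1 + |δ|) + (δ - δ) * M < ε := by
      rw [sub_self, zero_mul, add_zero, div_mul_eq_mul_div, div_lt_iff₀ (by positivity)]
      gcongr
      linarith [abs_nonneg δ]
    filter_upwards [((hc.tendsto δ).comp hsδ).eventually (gt_mem_nhds hlt)] with k hk γ hγ
    have hk' : Real.exp (ε / (2 * (2 + |δ|)) * (1 + |s k|) + (s k - δ) * M) ≤ Real.exp ε :=
      Real.exp_le_exp.2 hk.le
    obtain ⟨h1, h2⟩ := hle (s k) (hs k).le γ hγ
    have hw1 := hh.weight_nonneg (s k) x γ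
    have hw2 := hh.weight_nonneg (s k) o γ
    constructor
    · rw [hq_eq, ← mul_assoc, ← ENNReal.ofReal_mul (by positivity)]
      exact mul_le_mul_left (ENNReal.ofReal_le_ofReal (h1.trans (by gcongr))) _
    · rw [hq_eq]
      simp only [p]
      rw [← mul_assoc, ← ENNReal.ofReal_mul (by positivity)]
      exact mul_le_mul_left (ENNReal.ofReal_le_ofReal (h2.trans (by gcongr))) _
  have hpR : ∀ k γ, p k γ ≤ ENNReal.ofReal (weight Γ o h δ x γ) * f (γ • o).toBar := fun k γ =>
    mul_le_mul_left (ENNReal.ofReal_le_ofReal (hh.weight_le (hs k).le x γ)) _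
  have hqR : ∀ k γ, q k γ ≤ ENNReal.ofReal (weight Γ o h δ o γ) * (Ψ * f) (γ • o).toBar := fun k γ =>
    mul_le_mul_left (ENNReal.ofReal_le_ofReal (hh.weight_le (hs k).le o γ)) _
  have ha_eq : ∀ k, ∫⁻ u, f u ∂(pattersonMeasure Γ o h (s k) x) =
      (poincareSeries Γ o h (s k))⁻¹ * ∑' γ, p k γ := fun k => lintegral_pattersonMeasure _ _ _
  have hb_eq : ∀ k, ∫⁻ u, ((Ψ * f) u : ℝ≥0∞) ∂(pattersonMeasure Γ o h (s k) o) =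
      (poincareSeries Γ o h (s k))⁻¹ * ∑' γ, q k γ := fun k => lintegral_pattersonMeasure _ _ _
  have hatop : ∀ k, ∫⁻ u, f u ∂(pattersonMeasure Γ o h (s k) x) ≠ ⊤ := fun k =>
    (f.lintegral_lt_top_of_nnreal _).ne
  have hbtop : ∀ k, ∫⁻ u, ((Ψ * f) u : ℝ≥0∞) ∂(pattersonMeasure Γ o h (s k) o) ≠ ⊤ := fun k => by
    have := hh.isProbabilityMeasure (hs k)
    exact ((Ψ * f).lintegral_lt_top_of_nnreal _).ne
  have hBtop : ∫⁻ u, ((Ψ * f) u : ℝ≥0∞) ∂(π : Measure (AdSBar n)) ≠ ⊤ :=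
    ((Ψ * f).lintegral_lt_top_of_nnreal _).ne
  have htoReal : ∀ (ε : ℝ) (a b : ℝ≥0∞), 0 < ε → b ≠ ⊤ →
      a ≤ ENNReal.ofReal (Real.exp ε) * b + ENNReal.ofReal ε → a.toReal ≤ Real.exp ε * b.toReal + ε := by
    intro ε a b hε hb hab
    have h1 : ENNReal.ofReal (Real.exp ε) * b ≠ ⊤ := ENNReal.mul_ne_top ENNReal.ofReal_ne_top hb
    have h2 := ENNReal.toReal_mono (ENNReal.add_ne_top.2 ⟨h1, ENNReal.ofReal_ne_top⟩) hab
    rwa [ENNReal.toReal_add h1 ENNReal.ofReal_ne_top, ENNReal.toReal_mul,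
      ENNReal.toReal_ofReal (Real.exp_pos _).le, ENNReal.toReal_ofReal hε.le] at h2
  rw [← ENNReal.tendsto_toReal_iff hatop hBtop]
  rw [← ENNReal.tendsto_toReal_iff hbtop hBtop] at hb
  refine tendsto_of_forall_exp_le hb (fun ε hε => ?_) (fun ε hε => ?_)
  · obtain ⟨F, hFfin, hev⟩ := hexp ε hε
    filter_upwards [eventually_inv_mul_tsum_le hQ
      (fun γ => ENNReal.mul_ne_top ENNReal.ofReal_ne_top ENNReal.coe_ne_top) hpR hε hFfin
      (hev.mono fun k hk γ hγ => (hk γ hγ).1)] with k hk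
    refine htoReal ε _ _ hε (hbtop k) ?_
    rw [ha_eq, hb_eq]
    exact hk
  · obtain ⟨F, hFfin, hev⟩ := hexp ε hε
    filter_upwards [eventually_inv_mul_tsum_le hQ
      (fun γ => ENNReal.mul_ne_top ENNReal.ofReal_ne_top ENNReal.coe_ne_top) hqR hε hFfin
      (hev.mono fun k hk γ hγ => (hk γ hγ).2)] with k hk
    refine htoReal ε _ _ hε (hatop k) ?_
    rw [ha_eq, hb_eq]
    exact hk

lemma pattersonMeasure_map (s : ℝ) (x : AdS n) (g : Γ) :
    (pattersonMeasure Γ o h s x).map (fun u => (g : SO2 n) • u) = pattersonMeasure Γ o h s (g • x) := by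
  ext A hA
  have hmeas : Measurable fun u : AdSBar n => (g : SO2 n) • u := (continuous_smul_bar _).measurable
  rw [Measure.map_apply hmeas hA, pattersonMeasure_apply _ _ (hmeas hA), pattersonMeasure_apply _ _ hA]
  congr 1
  refine (tsum_congr fun γ => ?_).trans ((Equiv.mulLeft g).tsum_eq _)
  have h1 : weight Γ o h s (g • x) (Equiv.mulLeft g γ) = weight Γ o h s x γ := by
    simp only [weight, Equiv.coe_mulLeft, mul_smul, lorentzDist_smul_smul]
  have h2 : ((Equiv.mulLeft g γ) • o).toBar = (g : SO2 n) • (γ • o).toBar := by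
    rw [Equiv.coe_mulLeft, mul_smul]
    exact toBar_smul (g : SO2 n) (γ • o)
  rw [h1, h2]
  rfl

end Patterson

/-! ### Invariant subsets of the limit set, and fixed points -/

section Dynamics

variable {n : ℕ} {Γ : Subgroup (SO2 n)} {Λ : Set (AdSBar n)} {o : AdS n} {C : ℝ}

lemma coe_geodesicPoint {v w : V n} (hv : form v v = 0) (hw : form w w = 0) (hvw : pair v w = 1 / 2)
    (t : ℝ) : (geodesicPoint v w hv hw hvw t : V n) = Real.exp t • w + Real.exp (-t) • v := rfl

/-- A closed `Γ`-invariant subset of `Λ` that misses a point `ξ` of `Λ` has at most one point: the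
elements of `Γ` that carry `o` near a point going to `ξ` along a geodesic multiply the vectors
of the cone over this subset by a factor that tends to zero. -/
lemma IsQuasiFuchsian.subsingleton_of_invariant (hΓ : IsQuasiFuchsian Γ Λ) (ho : o ∈ hull Λ)
    {F : Set (AdSBar n)} (hF : IsClosed F) (hFΛ : F ⊆ Λ) (hinv : ∀ g ∈ Γ, ∀ u ∈ F, g • u ∈ F)
    {ξ : AdSBar n} (hξ : ξ ∈ Λ) (hξF : ξ ∉ F) : F.Subsingleton := by
  obtain ⟨C, hC⟩ := hΓ.exists_isCoarseConst o
  obtain ⟨v, hv, hv0, hvξ⟩ := hΓ.exists_isotropic_partner ho hξ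
  have hξ0 : form (ξ : V n) ξ = 0 := hΓ.acausal.1 hξ
  have hC0 := hC.pos
  obtain ⟨c, hc, hcle⟩ : ∃ c : ℝ, 0 < c ∧ ∀ f ∈ F, c ≤ pair (ξ : V n) f := by
    rcases F.eq_empty_or_nonempty with rfl | hne
    · exact ⟨1, one_pos, fun f hf => absurd hf (Set.notMem_empty _)⟩
    · have hcont : Continuous fun f : AdSBar n => pair (ξ : V n) f :=
        continuous_pair.comp (continuous_const.prodMk continuous_subtype_val)
      obtain ⟨f, hf, hmin⟩ := hF.isCompact.exists_isMinOn hne hcont.continuousOn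
      exact ⟨_, neg_pos.2 (hΓ.acausal.2 ξ hξ f (hFΛ hf) fun h => hξF (h ▸ hf)), hmin⟩
  intro u₁ hu₁ u₂ hu₂
  by_contra hne
  have hp : 0 < pair (u₁ : V n) u₂ := neg_pos.2 (hΓ.acausal.2 _ (hFΛ hu₁) _ (hFΛ hu₂) hne)
  set A := ‖(o : V n)‖ * C ^ 2 / c with hA
  have key : ∀ t : ℝ, pair (u₁ : V n) u₂ ≤ A ^ 2 * Real.exp (-t) ^ 2 := by
    intro t
    set z := geodesicPoint v (ξ : V n) hv0 hξ0 hvξ t with hz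
    have hzΛ : z ∈ hull Λ := geodesicPoint_mem_hull hv0 hξ0 hvξ hv (coe_mem_cone hξ) t
    obtain ⟨γ, hγ⟩ := hC.dense z hzΛ
    have hγo := hΓ.smul_mem_hull γ ho
    have hnorm : ∀ u ∈ F, ‖act γ.1.1 (u : V n)‖ ≤ A * Real.exp (-t) := by
      intro u hu
      have hf := hinv γ.1 γ.2 u hu
      set f : AdSBar n := γ.1 • u with hfdef
      have hfc : (f : V n) ∈ cone Λ := coe_mem_cone (hFΛ hf)
      have h1 : Real.exp t * c ≤ pair (f : V n) z := by
        rw [hz, coe_geodesicPoint, pair_add_right, pair_smul_right, pair_smul_right,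
          pair_comm _ (ξ : V n)]
        have h2 := mul_le_mul_of_nonneg_left (hcle f hf) (Real.exp_pos t).le
        have h3 := mul_nonneg (Real.exp_pos (-t)).le (pair_nonneg_of_isAcausal hΓ.acausal hfc hv)
        linarith
      have hpos : 0 < pair (f : V n) (γ • o : AdS n) := by
        rw [pair_comm]; exact hΓ.pair_pos hγo hfc
      have h2 : Real.exp t * c ≤ C ^ 2 * pair (f : V n) (γ • o : AdS n) := by
        calc Real.exp t * c ≤ pair (f : V n) z := h1
          _ ≤ C * (pair (f : V n) (γ • o : AdS n) * pair ((γ • o : AdS n) : V n) z) :=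
            hC.triangle _ hfc _ hzΛ _ hγo
          _ ≤ C * (pair (f : V n) (γ • o : AdS n) * C) := by gcongr
          _ = _ := by ring
      have h3 : ‖act γ.1.1 (u : V n)‖ * pair (f : V n) (γ • o : AdS n) = pair (u : V n) o := by
        rw [← pair_smul_left, hfdef, ← act_eq_norm_smul, coe_smul, pair_act]
      have h4 : pair (u : V n) o ≤ ‖(o : V n)‖ := by
        have := pair_le (u : V n) o
        rwa [u.2.1, one_mul] at this
      have h5 : ‖act γ.1.1 (u : V n)‖ * (Real.exp t * c) ≤ ‖(o : V n)‖ * C ^ 2 := by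
        calc ‖act γ.1.1 (u : V n)‖ * (Real.exp t * c)
            ≤ ‖act γ.1.1 (u : V n)‖ * (C ^ 2 * pair (f : V n) (γ • o : AdS n)) := by gcongr
          _ = pair (u : V n) o * C ^ 2 := by rw [← h3]; ring
          _ ≤ _ := by gcongr
      rw [hA, Real.exp_neg, div_mul_eq_mul_div, le_div_iff₀ hc, ← div_eq_mul_inv,
        le_div_iff₀ (Real.exp_pos t)]
      linarith
    have h1 : pair (u₁ : V n) u₂ = ‖act γ.1.1 (u₁ : V n)‖ * (‖act γ.1.1 (u₂ : V n)‖ *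
        pair ((γ.1 • u₁ : AdSBar n) : V n) (γ.1 • u₂ : AdSBar n)) := by
      rw [← pair_smul_right, ← pair_smul_left, ← act_eq_norm_smul, ← act_eq_norm_smul, pair_act]
    have h2 : pair ((γ.1 • u₁ : AdSBar n) : V n) (γ.1 • u₂ : AdSBar n) ≤ 1 := by
      have := pair_le ((γ.1 • u₁ : AdSBar n) : V n) (γ.1 • u₂ : AdSBar n)
      rwa [(γ.1 • u₁ : AdSBar n).2.1, (γ.1 • u₂ : AdSBar n).2.1, one_mul] at this
    calc pair (u₁ : V n) u₂ ≤ ‖act γ.1.1 (u₁ : V n)‖ * (‖act γ.1.1 (u₂ : V n)‖ * 1) := by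
          rw [h1]; gcongr
      _ ≤ (A * Real.exp (-t)) * ((A * Real.exp (-t)) * 1) := by
        have := hnorm u₁ hu₁
        have := hnorm u₂ hu₂
        gcongr
      _ = _ := by ring
  have hlim : Tendsto (fun t : ℝ => A ^ 2 * Real.exp (-t) ^ 2) atTop (𝓝 (A ^ 2 * 0 ^ 2)) :=
    (Real.tendsto_exp_neg_atTop_nhds_zero.pow 2).const_mul _
  have := ge_of_tendsto' hlim key
  simp only [ne_eq, OfNat.ofNat_ne_zero, not_false_eq_true, zero_pow, mul_zero] at this
  linarith

variable {η : AdSBar n}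

/-- For a ray `η` fixed by `Γ`, the factor by which an element of `Γ` multiplies the unit vector of
`η`. -/
noncomputable def stretch (η : AdSBar n) (γ : Γ) : ℝ := ‖act γ.1.1 (η : V n)‖

lemma stretch_pos (γ : Γ) : 0 < stretch η γ :=
  norm_pos_iff.2 (act_ne_zero _ (AdSBar.ne_zero η))

lemma act_eq_stretch_smul (hη : ∀ γ : Γ, γ.1 • η = η) (γ : Γ) :
    act γ.1.1 (η : V n) = stretch η γ • (η : V n) := by
  conv_lhs => rw [act_eq_norm_smul, hη]
  rfl

lemma stretch_mul (hη : ∀ γ : Γ, γ.1 • η = η) (γ γ' : Γ) :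
    stretch η (γ * γ') = stretch η γ * stretch η γ' := by
  have h : act (γ * γ').1.1 (η : V n) = stretch η γ' • act γ.1.1 (η : V n) := by
    rw [← act_smul, ← act_eq_stretch_smul hη γ', ← act_mul]; rfl
  rw [stretch, h, norm_smul, Real.norm_of_nonneg (stretch_pos _).le, mul_comm]
  rfl

lemma stretch_inv (hη : ∀ γ : Γ, γ.1 • η = η) (γ : Γ) : stretch η γ⁻¹ = (stretch η γ)⁻¹ := by
  have h1 : stretch η (1 : Γ) = 1 := by
    change ‖act 1 (η : V n)‖ = 1
    rw [act_one, η.2.1]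
  refine eq_inv_of_mul_eq_one_left ?_
  rw [← stretch_mul hη, inv_mul_cancel, h1]

lemma pair_smul_of_fixed (hη : ∀ γ : Γ, γ.1 • η = η) (γ : Γ) (x : V n) :
    pair (act γ.1.1 x) (η : V n) = (stretch η γ)⁻¹ * pair x (η : V n) := by
  rw [pair_act_left, act_eq_stretch_smul hη, pair_smul_right, stretch_inv hη]

/-- If `Γ` fixes `η`, the elements of `Γ` that stretch `η` by a bounded factor are finitely many:
conjugation by elements that carry `o` near a point going to `η` along a geodesic moves any
finite set of such elements into a fixed ball. -/
lemma IsQuasiFuchsian.finite_setOf_stretch (hΓ : IsQuasiFuchsian Γ Λ) (ho : o ∈ hull Λ)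
    (hηΛ : η ∈ Λ) (hη : ∀ γ : Γ, γ.1 • η = η) (a : ℝ) :
    {γ : Γ | stretch η γ ≤ a ∧ (stretch η γ)⁻¹ ≤ a}.Finite := by
  obtain ⟨C, hC⟩ := hΓ.exists_isCoarseConst o
  obtain ⟨v, hv, hv0, hvη⟩ := hΓ.exists_isotropic_partner ho hηΛ
  have hη0 : form (η : V n) η = 0 := hΓ.acausal.1 hηΛ
  have hηη : pair (η : V n) η = 0 := by rw [pair, hη0, neg_zero]
  have hC0 := hC.pos
  have hfin := hΓ.finite_setOf_pair_le ho (C ^ 4 * (a + 1))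
  by_contra hinf
  obtain ⟨P, hPsub, hPcard⟩ := Set.Infinite.exists_subset_card_eq hinf (hfin.toFinset.card + 1)
  have hlim : ∀ p : Γ, Tendsto (fun t : ℝ => Real.exp (-t) ^ 2 * pair v (act p.1.1 v)) atTop (𝓝 0) := by
    intro p
    have := (Real.tendsto_exp_neg_atTop_nhds_zero.pow 2).mul_const (pair v (act p.1.1 v))
    simpa using this
  obtain ⟨t, ht⟩ : ∃ t : ℝ, ∀ p ∈ P, Real.exp (-t) ^ 2 * pair v (act p.1.1 v) < 1 :=
    ((Finset.eventually_all P).2 fun p _ => (hlim p).eventually (gt_mem_nhds one_pos)).exists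
  set z := geodesicPoint v (η : V n) hv0 hη0 hvη t with hz
  have hzΛ : z ∈ hull Λ := geodesicPoint_mem_hull hv0 hη0 hvη hv (coe_mem_cone hηΛ) t
  obtain ⟨γ, hγ⟩ := hC.dense z hzΛ
  have hγo := hΓ.smul_mem_hull γ ho
  have hpz : ∀ p ∈ P, pair (z : V n) (act p.1.1 (z : V n)) ≤ a + 1 := by
    intro p hp
    obtain ⟨h1, h2⟩ := hPsub hp
    have h3 : pair (η : V n) (act p.1.1 v) = (stretch η p)⁻¹ * (1 / 2) := by
      rw [pair_comm, pair_smul_of_fixed hη, hvη]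
    have h4 : Real.exp t * Real.exp (-t) = 1 := by rw [← Real.exp_add, add_neg_cancel, Real.exp_zero]
    have h5 : pair (z : V n) (act p.1.1 (z : V n)) = (Real.exp t * Real.exp (-t)) *
        ((stretch η p)⁻¹ * (1 / 2) + stretch η p * (1 / 2)) +
          Real.exp (-t) ^ 2 * pair v (act p.1.1 v) := by
      rw [hz, coe_geodesicPoint, act_add, act_smul, act_smul, act_eq_stretch_smul hη]
      simp only [pair_add_left, pair_add_right, pair_smul_left, pair_smul_right, hηη, h3, hvη]
      ring
    rw [h5, h4]
    linarith [ht p hp]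
  have hmaps : ∀ p ∈ P, γ⁻¹ * p * γ ∈ hfin.toFinset := by
    intro p hp
    rw [Set.Finite.mem_toFinset]
    change pair (((γ⁻¹ * p * γ) • o : AdS n) : V n) o ≤ _
    have hpzΛ := hΓ.smul_mem_hull p hzΛ
    have hpγo := hΓ.smul_mem_hull p hγo
    have h1 : pair (((γ⁻¹ * p * γ) • o : AdS n) : V n) o =
        pair ((p • γ • o : AdS n) : V n) (γ • o : AdS n) := by
      rw [← pair_smul_smul γ, smul_smul, smul_smul]
      congr 3
      group
    have h2 : 0 < pair ((p • z : AdS n) : V n) z := hΓ.pair_pos hpzΛ hzΛ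
    have h3 : 0 < pair ((p • z : AdS n) : V n) (γ • o : AdS n) := hΓ.pair_pos hpzΛ hγo
    calc pair (((γ⁻¹ * p * γ) • o : AdS n) : V n) o
        ≤ C * (pair ((p • γ • o : AdS n) : V n) (p • z : AdS n) *
            pair ((p • z : AdS n) : V n) (γ • o : AdS n)) := by
          rw [h1]; exact hC.triangle _ hpγo _ hγo _ hpzΛ
      _ ≤ C * (C * (C * (pair ((p • z : AdS n) : V n) z * C))) := by
        have h4 : pair ((p • γ • o : AdS n) : V n) (p • z : AdS n) ≤ C := by
          rwa [pair_smul_smul]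
        have h5 : pair ((p • z : AdS n) : V n) (γ • o : AdS n) ≤
            C * (pair ((p • z : AdS n) : V n) z * C) := by
          refine (hC.triangle _ hpzΛ _ hγo _ hzΛ).trans ?_
          rw [pair_comm (z : V n)]
          gcongr
        gcongr
      _ = C ^ 4 * pair ((p • z : AdS n) : V n) z := by ring
      _ ≤ _ := by
        have := hpz p hp
        rw [pair_comm] at this
        gcongr
        exact this
  have hcard := Finset.card_le_card_of_injOn _ hmaps fun p _ q _ hpq => by
    simpa using hpq
  omega

/-- If `Γ` fixes `η`, the points `γ o` for which `γ` does not stretch `η` stay outside a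
neighbourhood of `η`. -/
lemma IsQuasiFuchsian.exists_pair_le_of_fixed (hΓ : IsQuasiFuchsian Γ Λ) (ho : o ∈ hull Λ)
    (hηΛ : η ∈ Λ) (hη : ∀ γ : Γ, γ.1 • η = η) : ∃ v : V n, pair v (η : V n) = 1 / 2 ∧ ∃ B : ℝ,
      ∀ γ : Γ, stretch η γ ≤ 1 →
        pair ((γ • o : AdS n) : V n) v ≤ B * pair ((γ • o : AdS n) : V n) η := by
  obtain ⟨C, hC⟩ := hΓ.exists_isCoarseConst o
  obtain ⟨v, hv, hv0, hvη⟩ := hΓ.exists_isotropic_partner ho hηΛ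
  have hη0 : form (η : V n) η = 0 := hΓ.acausal.1 hηΛ
  have hηη : pair (η : V n) η = 0 := by rw [pair, hη0, neg_zero]
  have hηc : (η : V n) ∈ cone Λ := coe_mem_cone hηΛ
  have hC0 := hC.pos
  obtain ⟨B, hB⟩ : ∃ B : ℝ, ∀ p : Γ, stretch η p ≤ C ^ 2 → (stretch η p)⁻¹ ≤ C ^ 2 →
      pair ((p • o : AdS n) : V n) o ≤ B := by
    obtain ⟨B, hB⟩ := ((hΓ.finite_setOf_stretch ho hηΛ hη (C ^ 2)).image
      fun p : Γ => pair ((p • o : AdS n) : V n) o).bddAbove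
    exact ⟨B, fun p h1 h2 => hB ⟨p, ⟨h1, h2⟩, rfl⟩⟩
  set κ := pair (o : V n) η with hκ
  have hκ0 : 0 < κ := hΓ.pair_pos ho hηc
  refine ⟨v, hvη, C ^ 2 * B / (2 * κ ^ 2), fun γ hγ1 => ?_⟩
  set l := stretch η γ with hl
  have hl0 : 0 < l := stretch_pos γ
  -- the point of the geodesic at which `⟨·|η⟩` has the same value as at `γ o`
  set t := -Real.log (2 * κ / l) with ht
  have het : Real.exp (-t) = 2 * κ / l := by rw [ht, neg_neg, Real.exp_log (by positivity)]
  set z := geodesicPoint v (η : V n) hv0 hη0 hvη t with hz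
  have hzΛ : z ∈ hull Λ := geodesicPoint_mem_hull hv0 hη0 hvη hv hηc t
  have hzη : pair (z : V n) η = κ / l := by
    rw [hz, coe_geodesicPoint, pair_add_left, pair_smul_left, pair_smul_left, hηη, hvη, het]
    ring
  obtain ⟨γ', hγ'⟩ := hC.dense z hzΛ
  have hγo := hΓ.smul_mem_hull γ ho
  have hγo' := hΓ.smul_mem_hull γ' ho
  set l' := stretch η γ' with hl'
  have hl0' : 0 < l' := stretch_pos γ'
  have hy : pair ((γ • o : AdS n) : V n) η = l⁻¹ * κ := pair_smul_of_fixed hη γ _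
  have hy' : pair ((γ' • o : AdS n) : V n) η = l'⁻¹ * κ := pair_smul_of_fixed hη γ' _
  have h1 : l'⁻¹ * κ ≤ C ^ 2 * (κ / l) := by
    calc l'⁻¹ * κ ≤ C * (pair ((γ' • o : AdS n) : V n) z * pair (z : V n) η) := by
          rw [← hy']; exact hC.triangle _ hγo' _ hηc _ hzΛ
      _ ≤ C * (C * (κ / l)) := by rw [hzη]; gcongr
      _ = _ := by ring
  have h2 : κ / l ≤ C ^ 2 * (l'⁻¹ * κ) := by
    calc κ / l ≤ C * (pair (z : V n) (γ' • o : AdS n) * pair ((γ' • o : AdS n) : V n) η) := by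
          rw [← hzη]; exact hC.triangle _ hzΛ _ hηc _ hγo'
      _ ≤ C * (C * (l'⁻¹ * κ)) := by rw [hy', pair_comm]; gcongr
      _ = _ := by ring
  have hp : stretch η (γ'⁻¹ * γ) = l'⁻¹ * l := by rw [stretch_mul hη, stretch_inv hη]
  have h3 : l'⁻¹ * l ≤ C ^ 2 := by
    refine le_of_mul_le_mul_right ?_ (div_pos hκ0 hl0)
    calc l'⁻¹ * l * (κ / l) = l'⁻¹ * κ := by field_simp
      _ ≤ _ := h1
  have h4 : (l'⁻¹ * l)⁻¹ ≤ C ^ 2 := by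
    refine le_of_mul_le_mul_right ?_ (mul_pos (inv_pos.2 hl0') hκ0)
    calc (l'⁻¹ * l)⁻¹ * (l'⁻¹ * κ) = κ / l := by field_simp
      _ ≤ _ := h2
  have h5 : pair ((γ • o : AdS n) : V n) (γ' • o : AdS n) ≤ B := by
    have := hB (γ'⁻¹ * γ) (by rw [hp]; exact h3) (by rw [hp]; exact h4)
    rwa [← pair_smul_smul γ', smul_smul, mul_inv_cancel_left] at this
  have h6 : pair ((γ • o : AdS n) : V n) z ≤ C ^ 2 * B := by
    calc pair ((γ • o : AdS n) : V n) z ≤ C * (pair ((γ • o : AdS n) : V n) (γ' • o : AdS n) *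
          pair ((γ' • o : AdS n) : V n) z) := hC.triangle _ hγo _ hzΛ _ hγo'
      _ ≤ C * (B * C) := by
        have := (hΓ.pair_pos hγo hγo').le.trans h5
        have := hΓ.pair_pos hγo' hzΛ
        gcongr
      _ = _ := by ring
  have h7 : 2 * κ / l * pair ((γ • o : AdS n) : V n) v ≤ C ^ 2 * B := by
    refine le_trans ?_ h6
    rw [hz, coe_geodesicPoint, pair_add_right, pair_smul_right, pair_smul_right, het]
    have := mul_pos (Real.exp_pos t) (hΓ.pair_pos hγo hηc)
    linarith
  have hB0 : 0 ≤ B := (hΓ.pair_pos hγo hγo').le.trans h5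
  have h8 : pair ((γ • o : AdS n) : V n) v ≤ C ^ 2 * B * l / (2 * κ) := by
    rw [le_div_iff₀ (by positivity)]
    calc pair ((γ • o : AdS n) : V n) v * (2 * κ) =
          (2 * κ / l * pair ((γ • o : AdS n) : V n) v) * l := by field_simp
      _ ≤ _ := by gcongr
  calc pair ((γ • o : AdS n) : V n) v ≤ C ^ 2 * B * l / (2 * κ) := h8
    _ ≤ C ^ 2 * B * l⁻¹ / (2 * κ) := by
      have : l ≤ l⁻¹ := hγ1.trans ((one_le_inv₀ hl0).2 hγ1)
      gcongr
    _ = _ := by rw [hy]; field_simp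

end Dynamics

/-! ### The limits of Patterson's measures are conformal densities -/

section Limits

variable {n : ℕ} {Γ : Subgroup (SO2 n)} {Λ : Set (AdSBar n)} {o : AdS n} {δ : ℝ} {h : ℝ → ℝ}

lemma ConvergesWeakly.unique {m : ℕ → Measure (AdSBar n)} {π π' : FiniteMeasure (AdSBar n)}
    (h1 : ConvergesWeakly m π) (h2 : ConvergesWeakly m π') : π = π' := by
  obtain ⟨μ, hμ, hlim⟩ := h1
  obtain ⟨μ', hμ', hlim'⟩ := h2
  obtain rfl : μ = μ' := funext fun k => Subtype.ext ((hμ k).trans (hμ' k).symm)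
  exact tendsto_nhds_unique hlim hlim'

lemma ConvergesWeakly.map {m : ℕ → Measure (AdSBar n)} {π : FiniteMeasure (AdSBar n)}
    (h1 : ConvergesWeakly m π) {f : AdSBar n → AdSBar n} (hf : Continuous f) :
    ConvergesWeakly (fun k => (m k).map f) (π.map f) := by
  obtain ⟨μ, hμ, hlim⟩ := h1
  exact ⟨fun k => (μ k).map f, fun k => by rw [FiniteMeasure.toMeasure_map, hμ],
    FiniteMeasure.tendsto_map_of_tendsto_of_continuous μ π hlim hf⟩

/-- The limits of Patterson's measures of base point `o` are probability measures, and their mass on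
open sets is lower semicontinuous. -/
lemma IsPattersonFunction.apply_univ_and_apply_le (hh : IsPattersonFunction Γ o δ h) {s : ℕ → ℝ}
    (hs : ∀ k, δ < s k) {π : FiniteMeasure (AdSBar n)}
    (hπ : ConvergesWeakly (fun k => pattersonMeasure Γ o h (s k) o) π) :
    (π : Measure (AdSBar n)) Set.univ = 1 ∧ ∀ U : Set (AdSBar n), IsOpen U → ∀ a : ℝ≥0∞,
      (∀ᶠ k in atTop, pattersonMeasure Γ o h (s k) o U ≤ a) → (π : Measure (AdSBar n)) U ≤ a := by
  obtain ⟨μ, hμ, hlim⟩ := hπ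
  have hp : ∀ k, IsProbabilityMeasure (μ k : Measure (AdSBar n)) := fun k => by
    rw [hμ]; exact hh.isProbabilityMeasure (hs k)
  have h1 : π.mass = 1 := by
    refine tendsto_nhds_unique hlim.mass ?_
    have : ∀ k, (μ k).mass = 1 := fun k => by
      rw [← ENNReal.coe_inj, FiniteMeasure.ennreal_mass, (hp k).measure_univ, ENNReal.coe_one]
    simp only [this, tendsto_const_nhds]
  have h2 : (π : Measure (AdSBar n)) Set.univ = 1 := by
    rw [← FiniteMeasure.ennreal_mass, h1, ENNReal.coe_one]
  refine ⟨h2, fun U hU a ha => ?_⟩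
  let P : ℕ → ProbabilityMeasure (AdSBar n) := fun k => ⟨μ k, hp k⟩
  let P' : ProbabilityMeasure (AdSBar n) := ⟨π, ⟨h2⟩⟩
  have h3 : Tendsto P atTop (𝓝 P') :=
    (ProbabilityMeasure.tendsto_nhds_iff_toFiniteMeasure_tendsto_nhds _).2 hlim
  refine (ProbabilityMeasure.le_liminf_measure_open_of_tendsto h3 hU).trans ?_
  refine liminf_le_of_frequently_le' (ha.mono fun k hk => ?_).frequently
  change (μ k : Measure (AdSBar n)) U ≤ a
  rwa [hμ]

/-- The limits of Patterson's measures are supported by `Λ`. -/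
lemma IsQuasiFuchsian.apply_compl_eq_zero (hΓ : IsQuasiFuchsian Γ Λ) (ho : o ∈ hull Λ)
    (hh : IsPattersonFunction Γ o δ h) {s : ℕ → ℝ} (hs : ∀ k, δ < s k) (hsδ : Tendsto s atTop (𝓝 δ))
    {π : FiniteMeasure (AdSBar n)}
    (hπ : ConvergesWeakly (fun k => pattersonMeasure Γ o h (s k) o) π) :
    (π : Measure (AdSBar n)) Λᶜ = 0 := by
  have hne := nonempty_of_mem_hull ho
  have hcover : Λᶜ ⊆ ⋃ m : ℕ, {u | 1 / ((m : ℝ) + 1) < Metric.infDist u Λ} := by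
    intro u hu
    have h1 := (hΓ.isCompact.isClosed.notMem_iff_infDist_pos hne).1 hu
    exact Set.mem_iUnion.2 (exists_nat_one_div_lt h1)
  refine measure_mono_null hcover (measure_iUnion_null fun m => ?_)
  have hU : IsOpen {u : AdSBar n | 1 / ((m : ℝ) + 1) < Metric.infDist u Λ} :=
    isOpen_lt continuous_const (Metric.continuous_infDist_pt Λ)
  have hU' : IsOpen {u : AdSBar n | Metric.infDist u Λ < 1 / ((m : ℝ) + 1)} :=
    isOpen_lt (Metric.continuous_infDist_pt Λ) continuous_const
  have hfin := hΓ.finite_setOf_toBar_notMem ho hU' fun u hu => by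
    change Metric.infDist u Λ < _
    rw [Metric.infDist_zero_of_mem hu]
    positivity
  refine le_antisymm (ENNReal.le_of_forall_pos_le_add fun ε hε _ => ?_) zero_le
  refine (hh.apply_univ_and_apply_le hs hπ).2 _ hU _ ?_
  set G := {u : AdSBar n | 1 / ((m : ℝ) + 1) < Metric.infDist u Λ}
  have h1 : ∀ k (γ : Γ), ENNReal.ofReal (weight Γ o h (s k) o γ) * G.indicator 1 (γ • o).toBar ≤
      ENNReal.ofReal (weight Γ o h δ o γ) := fun k γ => by
    calc _ ≤ ENNReal.ofReal (weight Γ o h (s k) o γ) * 1 := by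
          gcongr
          exact Set.indicator_le_self' (fun _ _ => zero_le) _
      _ ≤ _ := by rw [mul_one]; exact ENNReal.ofReal_le_ofReal (hh.weight_le (hs k).le o γ)
  have h2 : ∀ k, ∀ γ ∉ {γ : Γ | (γ • o).toBar ∉ {u : AdSBar n | Metric.infDist u Λ < 1 / ((m : ℝ) + 1)}},
      ENNReal.ofReal (weight Γ o h (s k) o γ) * G.indicator 1 (γ • o).toBar ≤ 0 * (0 : ℝ≥0∞) := by
    intro k γ hγ
    have hγ' : Metric.infDist (γ • o).toBar Λ < 1 / ((m : ℝ) + 1) := not_not.1 hγ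
    rw [Set.indicator_of_notMem (s := G) fun h' => lt_asymm hγ' h', mul_zero, mul_zero]
  filter_upwards [eventually_inv_mul_tsum_le (hh.tendsto_poincareSeries hsδ)
    (fun γ => ENNReal.ofReal_ne_top) h1 (NNReal.coe_pos.2 hε) hfin
    (Eventually.of_forall h2)] with k hk
  rw [pattersonMeasure_apply _ _ hU.measurableSet]
  simpa using hk

lemma IsPattersonFunction.exists_subseq (hh : IsPattersonFunction Γ o δ h) {s : ℕ → ℝ}
    (hs : ∀ k, δ < s k) : ∃ φ : ℕ → ℕ, StrictMono φ ∧ ∃ π : FiniteMeasure (AdSBar n),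
      ConvergesWeakly (fun k => pattersonMeasure Γ o h (s (φ k)) o) π := by
  let P : ℕ → ProbabilityMeasure (AdSBar n) := fun k =>
    ⟨pattersonMeasure Γ o h (s k) o, hh.isProbabilityMeasure (hs k)⟩
  obtain ⟨π, φ, hφ, hlim⟩ := CompactSpace.tendsto_subseq P
  exact ⟨φ, hφ, π.toFiniteMeasure, fun k => (P (φ k)).toFiniteMeasure, fun k => rfl,
    (ProbabilityMeasure.tendsto_nhds_iff_toFiniteMeasure_tendsto_nhds _).1 hlim⟩

lemma IsQuasiFuchsian.exists_subseq (hΓ : IsQuasiFuchsian Γ Λ) (ho : o ∈ hull Λ)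
    (hh : IsPattersonFunction Γ o δ h) {s : ℕ → ℝ} (hs : ∀ k, δ < s k) (hsδ : Tendsto s atTop (𝓝 δ)) :
    ∃ φ : ℕ → ℕ, StrictMono φ ∧ ∃ ν : AdS n → FiniteMeasure (AdSBar n),
      ∀ x ∈ hull Λ, ConvergesWeakly (fun k => pattersonMeasure Γ o h (s (φ k)) x) (ν x) := by
  obtain ⟨φ, hφ, π, hπ⟩ := hh.exists_subseq hs
  have h1 : ∀ x : AdS n, ∃ ν : FiniteMeasure (AdSBar n), x ∈ hull Λ →
      ConvergesWeakly (fun k => pattersonMeasure Γ o h (s (φ k)) x) ν := by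
    intro x
    by_cases hx : x ∈ hull Λ
    · obtain ⟨m, hm⟩ := hΓ.exists_isLowerBound hx ho
      exact ⟨_, fun _ => hΓ.convergesWeakly_withDensity ho hh (fun k => hs (φ k))
        (hsδ.comp hφ.tendsto_atTop) hπ hx hm⟩
    · exact ⟨0, fun h => absurd h hx⟩
  choose ν hν using h1
  exact ⟨φ, hφ, ν, hν⟩

variable {s : ℕ → ℝ} {ν : AdS n → FiniteMeasure (AdSBar n)}

lemma IsQuasiFuchsian.map_eq_of_convergesWeakly (hΓ : IsQuasiFuchsian Γ Λ)
    (hν : ∀ x ∈ hull Λ, ConvergesWeakly (fun k => pattersonMeasure Γ o h (s k) x) (ν x))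
    (g : Γ) {x : AdS n} (hx : x ∈ hull Λ) :
    (ν x : Measure (AdSBar n)).map (fun ξ => g.1 • ξ) = (ν (g • x) : Measure (AdSBar n)) := by
  have h1 := (hν x hx).map (continuous_smul_bar g.1)
  simp only [pattersonMeasure_map] at h1
  rw [← FiniteMeasure.toMeasure_map, h1.unique (hν _ (hΓ.smul_mem_hull g hx))]

lemma IsQuasiFuchsian.eq_withDensity_busemann (hΓ : IsQuasiFuchsian Γ Λ) (ho : o ∈ hull Λ)
    (hh : IsPattersonFunction Γ o δ h) (hs : ∀ k, δ < s k) (hsδ : Tendsto s atTop (𝓝 δ))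
    (hν : ∀ x ∈ hull Λ, ConvergesWeakly (fun k => pattersonMeasure Γ o h (s k) x) (ν x))
    {x y : AdS n} (hx : x ∈ hull Λ) (hy : y ∈ hull Λ) :
    (ν x : Measure (AdSBar n)) = (ν y : Measure (AdSBar n)).withDensity
      (fun ξ => ENNReal.ofReal (Real.exp (-δ * busemann ξ x y))) := by
  have hrep : ∀ z ∈ hull Λ, ∃ m, ∃ hm : IsLowerBound Λ m z o, (ν z : Measure (AdSBar n)) =
      (ν o : Measure (AdSBar n)).withDensity (fun u => (density δ m z o u : ℝ≥0∞)) := by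
    intro z hz
    obtain ⟨m, hm⟩ := hΓ.exists_isLowerBound hz ho
    refine ⟨m, hm, ?_⟩
    rw [(hν z hz).unique (hΓ.convergesWeakly_withDensity ho hh hs hsδ (hν o ho) hz hm)]
    rfl
  obtain ⟨m, hm, hxo⟩ := hrep x hx
  obtain ⟨m', hm', hyo⟩ := hrep y hy
  have hcont : ∀ z : AdS n, Measurable fun ξ : AdSBar n => pair (ξ : V n) z := fun z =>
    ((continuous_pair_left _).comp continuous_subtype_val).measurable
  have hmeas : Measurable fun ξ : AdSBar n => ENNReal.ofReal (Real.exp (-δ * busemann ξ x y)) := by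
    simp only [busemann_eq]
    exact ENNReal.measurable_ofReal.comp (Real.measurable_exp.comp
      ((Real.measurable_log.comp ((hcont x).div (hcont y))).const_mul _))
  have hmeas' : Measurable fun u : AdSBar n => (density δ m' y o u : ℝ≥0∞) :=
    measurable_coe_nnreal_ennreal.comp (continuous_density δ hm'.1 y o).measurable
  rw [hxo, hyo, ← withDensity_mul _ hmeas' hmeas]
  refine withDensity_congr_ae ?_
  have hae : ∀ᵐ u ∂(ν o : Measure (AdSBar n)), u ∈ Λ :=
    hΓ.apply_compl_eq_zero ho hh hs hsδ (hν o ho)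
  filter_upwards [hae] with u hu
  have huc := coe_mem_cone hu
  have hp : ∀ z ∈ hull Λ, 0 < pair (u : V n) z := fun z hz => by
    rw [pair_comm]; exact hΓ.pair_pos hz huc
  have hpx := hp x hx
  have hpy := hp y hy
  have hpo := hp o ho
  rw [Pi.mul_apply, density_of_mem_cone hm huc, density_of_mem_cone hm' huc, busemann_eq,
    ← ENNReal.ofReal_mul (Real.exp_pos _).le, ← Real.exp_add, Real.log_div hpx.ne' hpo.ne',
    Real.log_div hpy.ne' hpo.ne', Real.log_div hpx.ne' hpy.ne']
  congr 2
  ring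

variable {η : AdSBar n}

/-- If `Γ` fixes `η`, a neighbourhood of `η` carries at most half of the mass of a limit of
Patterson's measures: on this neighbourhood only the elements of `Γ` that stretch `η` count, and
inversion exchanges them with elements that contract `η`, without changing the weights. -/
lemma IsQuasiFuchsian.exists_apply_le_of_fixed (hΓ : IsQuasiFuchsian Γ Λ) (ho : o ∈ hull Λ)
    (hh : IsPattersonFunction Γ o δ h) (hs : ∀ k, δ < s k) {π : FiniteMeasure (AdSBar n)}
    (hπ : ConvergesWeakly (fun k => pattersonMeasure Γ o h (s k) o) π)
    (hηΛ : η ∈ Λ) (hη : ∀ γ : Γ, γ.1 • η = η) :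
    ∃ U, IsOpen U ∧ η ∈ U ∧ (π : Measure (AdSBar n)) U ≤ 2⁻¹ := by
  obtain ⟨v, hvη, B, hB⟩ := hΓ.exists_pair_le_of_fixed ho hηΛ hη
  have hη0 : form (η : V n) η = 0 := hΓ.acausal.1 hηΛ
  have hcont : ∀ w : V n, Continuous fun u : AdSBar n => pair (u : V n) w := fun w =>
    (continuous_pair_left w).comp continuous_subtype_val
  have hU : IsOpen {u : AdSBar n | B * pair (u : V n) η < pair (u : V n) v} :=
    isOpen_lt (continuous_const.mul (hcont _)) (hcont _)
  refine ⟨_, hU, ?_, ?_⟩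
  · change B * pair (η : V n) η < pair (η : V n) v
    rw [pair_comm _ v, hvη, pair, hη0]
    norm_num
  refine (hh.apply_univ_and_apply_le hs hπ).2 _ hU _ (Eventually.of_forall fun k => ?_)
  set w : Γ → ℝ≥0∞ := fun γ => ENNReal.ofReal (weight Γ o h (s k) o γ) with hw
  have h1 : pattersonMeasure Γ o h (s k) o {u : AdSBar n | B * pair (u : V n) η < pair (u : V n) v} ≤
      (poincareSeries Γ o h (s k))⁻¹ * ∑' γ, {γ : Γ | 1 < stretch η γ}.indicator w γ := by
    rw [pattersonMeasure_apply _ _ hU.measurableSet]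
    refine mul_le_mul_right (ENNReal.tsum_le_tsum fun γ => ?_) _
    by_cases hγ : 1 < stretch η γ
    · rw [Set.indicator_of_mem (show γ ∈ {γ : Γ | 1 < stretch η γ} from hγ)]
      refine (mul_le_mul_right ?_ _).trans (mul_one _).le
      exact Set.indicator_le_self' (fun _ _ => zero_le) _
    · have h2 := hB γ (not_lt.1 hγ)
      rw [Set.indicator_of_notMem (s := {u : AdSBar n | B * pair (u : V n) η < pair (u : V n) v}),
        mul_zero]
      · exact zero_le
      · intro h3
        have h3' : B * pair ((γ • o).toBar : V n) η < pair ((γ • o).toBar : V n) v := h3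
        rw [coe_toBar, pair_smul_left, pair_smul_left, mul_left_comm] at h3'
        have h4 : 0 ≤ ‖((γ • o : AdS n) : V n)‖⁻¹ := by positivity
        exact absurd (mul_le_mul_of_nonneg_left h2 h4) (not_le.2 h3')
  have h2 : ∑' γ, {γ : Γ | stretch η γ < 1}.indicator w γ =
      ∑' γ, {γ : Γ | 1 < stretch η γ}.indicator w γ := by
    rw [← (Equiv.inv Γ).tsum_eq]
    refine tsum_congr fun γ => ?_
    have h3 : w γ⁻¹ = w γ := by rw [hw]; simp only [weight_inv]
    have h4 : stretch η γ⁻¹ < 1 ↔ 1 < stretch η γ := by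
      rw [stretch_inv hη, inv_lt_one₀ (stretch_pos γ)]
    simp only [Set.indicator, Set.mem_ofPred_eq, Equiv.inv_apply, h3, h4]
  have h3 : 2 * ∑' γ, {γ : Γ | 1 < stretch η γ}.indicator w γ ≤ poincareSeries Γ o h (s k) := by
    rw [two_mul]
    nth_rewrite 1 [← h2]
    rw [← ENNReal.tsum_add, poincareSeries_eq_tsum_weight]
    refine ENNReal.tsum_le_tsum fun γ => ?_
    simp only [Set.indicator, Set.mem_ofPred_eq]
    split_ifs with h4 h5 h5
    · exact absurd h4 h5.not_gt
    · rw [add_zero]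
    · rw [zero_add]
    · rw [add_zero]; exact zero_le
  refine h1.trans ?_
  rw [← ENNReal.mul_le_mul_iff_right two_ne_zero ENNReal.ofNat_ne_top,
    ENNReal.mul_inv_cancel two_ne_zero ENNReal.ofNat_ne_top, mul_left_comm]
  refine (mul_le_mul_right h3 _).trans ?_
  exact (ENNReal.inv_mul_cancel (hh.poincareSeries_ne_zero _) (hh.convergent _ (hs k))).le

/-- The support is a closed invariant subset of `Λ`. If it is not `Λ`, it is a fixed point of `Γ`,
which would carry the whole mass, while a neighbourhood of it carries at most one half. -/
lemma IsQuasiFuchsian.support_eq (hΓ : IsQuasiFuchsian Γ Λ) (ho : o ∈ hull Λ)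
    (hh : IsPattersonFunction Γ o δ h) (hs : ∀ k, δ < s k) (hsδ : Tendsto s atTop (𝓝 δ))
    (hν : ∀ x ∈ hull Λ, ConvergesWeakly (fun k => pattersonMeasure Γ o h (s k) x) (ν x))
    {x : AdS n} (hx : x ∈ hull Λ) : (ν x : Measure (AdSBar n)).support = Λ := by
  have hac : ∀ y ∈ hull Λ, ∀ z ∈ hull Λ,
      (ν y : Measure (AdSBar n)).support ⊆ (ν z : Measure (AdSBar n)).support := by
    intro y hy z hz
    rw [hΓ.eq_withDensity_busemann ho hh hs hsδ hν hy hz]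
    exact (withDensity_absolutelyContinuous _ _).support_mono
  rw [(hac x hx o ho).antisymm (hac o ho x hx)]
  have hcompl := hΓ.apply_compl_eq_zero ho hh hs hsδ (hν o ho)
  have huniv := (hh.apply_univ_and_apply_le hs (hν o ho)).1
  set F := (ν o : Measure (AdSBar n)).support with hF
  have hFΛ : F ⊆ Λ := Measure.support_subset_of_isClosed hΓ.isCompact.isClosed hcompl
  have hFinv : ∀ g ∈ Γ, ∀ u ∈ F, g • u ∈ F := by
    intro g hg u hu
    refine hac _ (hΓ.smul_mem_hull ⟨g, hg⟩ ho) o ho ?_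
    rw [← hΓ.map_eq_of_convergesWeakly hν ⟨g, hg⟩ ho, Measure.support_eq_forall_isOpen]
    intro U hgU hU
    rw [Measure.map_apply (continuous_smul_bar g).measurable hU.measurableSet]
    exact (Measure.mem_support_iff_forall u).1 hu _
      ((hU.preimage (continuous_smul_bar g)).mem_nhds hgU)
  refine hFΛ.antisymm fun ξ hξ => ?_
  by_contra hξF
  have hsub := hΓ.subsingleton_of_invariant ho Measure.isClosed_support hFΛ hFinv hξ hξF
  obtain ⟨η, hη⟩ : F.Nonempty := Measure.nonempty_support fun h0 => by simp [h0] at huniv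
  obtain ⟨U, -, hηU, hle⟩ := hΓ.exists_apply_le_of_fixed ho hh hs (hν o ho) (hFΛ hη)
    fun γ => hsub (hFinv γ.1 γ.2 η hη) hη
  have h1 : (ν o : Measure (AdSBar n)) Fᶜ = 0 := Measure.measure_compl_support
  have h2 : (ν o : Measure (AdSBar n)) Set.univ ≤ (ν o : Measure (AdSBar n)) U + 0 := by
    rw [← h1]
    refine (measure_mono fun u _ => ?_).trans (measure_union_le _ _)
    by_cases hu : u ∈ F
    · exact Or.inl (hsub hη hu ▸ hηU)
    · exact Or.inr hu
  rw [huniv, add_zero] at h2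
  exact absurd (h2.trans hle) (not_le.2 (ENNReal.inv_lt_one.2 ENNReal.one_lt_two))

end Limits

end AdSGeom

theorem mainTheorem8 (n : ℕ) (Γ : Subgroup (SO2 n)) (Λ : Set (AdSBar n))
    (hΓ : IsQuasiFuchsian Γ Λ) (o : AdS n) (ho : o ∈ hull Λ) :
    ∃ δ : ℝ, (∀ x ∈ hull Λ, criticalExponent Γ x = (δ : EReal)) ∧
      (∃ h : ℝ → ℝ, IsPattersonFunction Γ o δ h) ∧
      ∀ h : ℝ → ℝ, IsPattersonFunction Γ o δ h →
        ∀ s : ℕ → ℝ, (∀ k, δ < s k) → Tendsto s atTop (𝓝 δ) →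
          (∃ φ : ℕ → ℕ, StrictMono φ ∧ ∃ ν : AdS n → FiniteMeasure (AdSBar n),
            ∀ x ∈ hull Λ, ConvergesWeakly (fun k => pattersonMeasure Γ o h (s (φ k)) x) (ν x)) ∧
          (∀ ν : AdS n → FiniteMeasure (AdSBar n),
            (∀ x ∈ hull Λ, ConvergesWeakly (fun k => pattersonMeasure Γ o h (s k) x) (ν x)) →
            IsConformalDensity Γ Λ δ ν) := by
  obtain ⟨δ, hδ, hgrowth⟩ := hΓ.exists_growth ho
  refine ⟨δ, fun x hx => ?_, ?_, fun h hh s hs hsδ => ⟨hΓ.exists_subseq ho hh hs hsδ,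
    fun ν hν => ⟨fun g hg x hx => ?_, fun x hx y hy => ?_, fun x hx => ?_⟩⟩⟩
  · obtain ⟨R₀, -, ⟨c, hc, hlow⟩, hup⟩ := hgrowth x hx
    exact criticalExponent_eq (hΓ.finite_setOf_lorentzDist_le hx)
      (tendsto_log_div_of_growth hc hlow hup)
  · obtain ⟨R₀, hR₀, ⟨c, hc, hlow⟩, hup⟩ := hgrowth o ho
    exact ⟨_, hΓ.isPattersonFunction_one ho hδ hR₀ hc hlow hup⟩
  · exact hΓ.map_eq_of_convergesWeakly hν ⟨g, hg⟩ hx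
  · exact hΓ.eq_withDensity_busemann ho hh hs hsδ hν hx hy
  · exact hΓ.support_eq ho hh hs hsδ hν hx
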